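/- Let $0<s<1$, $N\in\mathbb N$ with $2s<N$, put $2_s^*=\frac{2N}{N-2s}$, and let $2<q<\min(r,2_s^*)$. Let $D^s(\mathbb R^N)$ be the completion of $C_c^\infty(\mathbb R^N)$ with respect to the Gagliardo norm $$[u]_s=\Big(\iint_{\mathbb R^{2N}}\frac{|u(x)-u(y)|^2}{|x-y|^{N+2s}}\,dx\,dy\Big)^{1/2},$$ regarded as a space of functions in $L^{2_s^*}(\mathbb R^N)$ (modulo equality almost everywhere). Let $f,g:\mathbb R^N\times\mathbb R\to\mathbb R$ be Carathéodory functions such that (F) $|f(x,t)|\le m(x)|t|^{q-1}$ for a.a. $x\in\mathbb R^N$ and all $t\in\mathbb R$, where $m>0$ and $m\in L^{\frac{2_s^*}{2_s^*-1}}(\mathbb R^N)\cap L^{\frac{2_s^*}{2_s^*-q}+\eta}(\mathbb R^N)$ for some $\eta>0$; (G) either $r<2_s^*$ and $|g(x,t)|\le h(x)|t|^{r-1}$ for a.a. $x\in\mathbb R^N$ and all $t\in\mathbb R$, where $h>0$ and $h\in L^{\frac{2_s^*}{2_s^*-r}}(\mathbb R^N)\cap L^{\frac{2_s^*}{2_s^*-r}+\eta'}(\mathbb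 R^N)$ for some $\eta'>0$; or $r=2_s^*$, $g(x,0)=0$ and $|g(x,t)|\le h(x)|t|^{2_s^*-1}$ for a.a. $x\in\mathbb R^N$ and all $t\in\mathbb R$, where $h\in L^\infty(\mathbb R^N)$. Let $F(x,t)=\int_0^t f(x,\xi)\,d\xi$. Suppose that, for some $1<\tau<2$, some positive function $\rho\in L^{\frac{2_s^*}{2_s^*-\tau}}(\mathbb R^N)$ and some $M\in\mathbb R$, $$\limsup_{|t|\to\infty}\frac{F(x,t)}{\rho(x)|t|^\tau}\le M\quad\text{uniformly for a.a. }x\in\mathbb R^N,$$ and that $\sup_{u\in D^s(\mathbb R^N)}\int_{\mathbb R^N}F(x,u)\,dx>0$. Set $$\theta=\frac12\inf\left\{\frac{[u]_s^2}{\int_{\mathbb R^N}F(x,u)\,dx}\;:\;u\in D^s(\mathbb R^N),\ \int_{\mathbb R^N}F(x,u)\,dx>0\right\}.$$ Then for each compact interval $[a,b]\subset\,]\theta,+\infty[$ there exists $r_1>0$ with the following property: for every $\lambda\in[a,b]$ there exists $\delta>0$ such that for each $\mu\in[0,\delta]$ the problem $$(-\Delta)^s u=\lambda f(x,u)+\mu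 g(x,u)\quad\text{in }\mathbb R^N$$ has at least two distinct nonzero weak solutions $u\in D^s(\mathbb R^N)$ with $[u]_s<r_1$. Here $u\in D^s(\mathbb R^N)$ is a weak solution if $$\iint_{\mathbb R^{2N}}\frac{[u(x)-u(y)][\varphi(x)-\varphi(y)]}{|x-y|^{N+2s}}\,dx\,dy=\int_{\mathbb R^N}\big(\lambda f(x,u)+\mu g(x,u)\big)\varphi\,dx\quad\text{for all }\varphi\in D^s(\mathbb R^N).$$ -/

import Mathlib

open MeasureTheory Filter Topology
open scoped ENNReal

namespace FracLap

noncomputable section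

/-- Euclidean space `ℝ^N`. -/
abbrev E (N : ℕ) : Type := EuclideanSpace ℝ (Fin N)

/-- The fractional critical exponent `2_s^* = 2N / (N - 2s)`. -/
def critExp (N : ℕ) (s : ℝ) : ℝ := 2 * (N : ℝ) / ((N : ℝ) - 2 * s)

/-- The squared Gagliardo seminorm
`∬ |u(x) - u(y)|² / |x - y|^(N + 2s) dx dy`, as an element of `[0, ∞]`. -/
def gagliardoSq {N : ℕ} (s : ℝ) (u : E N → ℝ) : ℝ≥0∞ :=
  ∫⁻ z : E N × E N, ENNReal.ofReal (|u z.1 - u z.2| ^ 2 / ‖z.1 - z.2‖ ^ ((N : ℝ) + 2 * s))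

/-- The Gagliardo norm `[u]_s` (a genuine finite quantity for every `u` in `D^s`). -/
def gagliardoNorm {N : ℕ} (s : ℝ) (u : E N → ℝ) : ℝ := Real.sqrt (gagliardoSq s u).toReal

/-- The bilinear form
`∬ (u(x) - u(y)) (φ(x) - φ(y)) / |x - y|^(N + 2s) dx dy`. -/
def gagliardoForm {N : ℕ} (s : ℝ) (u φ : E N → ℝ) : ℝ :=
  ∫ z : E N × E N, (u z.1 - u z.2) * (φ z.1 - φ z.2) / ‖z.1 - z.2‖ ^ ((N : ℝ) + 2 * s)

/-- Membership in `D^s(ℝ^N)`, the completion of `C_c^∞(ℝ^N)` with respect to the Gagliardo norm,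
realized as a space of functions in `L^{2_s^*}` (functions equal almost everywhere represent the
same element): the limits, in the Gagliardo norm and in `L^{2_s^*}`, of sequences of smooth
compactly supported functions. -/
def MemDs {N : ℕ} (s : ℝ) (u : E N → ℝ) : Prop :=
  MemLp u (ENNReal.ofReal (critExp N s)) volume ∧
    ∃ φ : ℕ → E N → ℝ,
      (∀ n, ContDiff ℝ ((⊤ : ℕ∞) : WithTop ℕ∞) (φ n) ∧ HasCompactSupport (φ n)) ∧
      Tendsto (fun n => eLpNorm (φ n - u) (ENNReal.ofReal (critExp N s)) volume) atTop (𝓝 0) ∧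
      Tendsto (fun n => gagliardoSq s (φ n - u)) atTop (𝓝 0)

/-- Carathéodory functions: (Lebesgue) measurable in `x` for every `t`, continuous in `t` for
almost every `x`. -/
def Caratheodory {N : ℕ} (f : E N → ℝ → ℝ) : Prop :=
  (∀ t : ℝ, AEMeasurable (fun x => f x t) volume) ∧ ∀ᵐ x ∂(volume : Measure (E N)), Continuous (f x)

/-- The growth condition on `f`. -/
def GrowthF {N : ℕ} (s q : ℝ) (f : E N → ℝ → ℝ) : Prop :=
  ∃ m : E N → ℝ, ∃ δ : ℝ, 0 < δ ∧
    (∀ᵐ x ∂(volume : Measure (E N)), 0 < m x) ∧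
    MemLp m (ENNReal.ofReal (critExp N s / (critExp N s - 1))) volume ∧
    MemLp m (ENNReal.ofReal (critExp N s / (critExp N s - q) + δ)) volume ∧
    ∀ᵐ x ∂(volume : Measure (E N)), ∀ t : ℝ, |f x t| ≤ m x * |t| ^ (q - 1)

/-- The growth condition on `g`: subcritical with exponent `r < 2_s^*`, or critical with
`r = 2_s^*` and a bounded weight. -/
def GrowthG {N : ℕ} (s r : ℝ) (g : E N → ℝ → ℝ) : Prop :=
  (1 < r ∧ r < critExp N s ∧
    ∃ h : E N → ℝ, ∃ δ : ℝ, 0 < δ ∧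
      (∀ᵐ x ∂(volume : Measure (E N)), 0 < h x) ∧
      MemLp h (ENNReal.ofReal (critExp N s / (critExp N s - r))) volume ∧
      MemLp h (ENNReal.ofReal (critExp N s / (critExp N s - r) + δ)) volume ∧
      ∀ᵐ x ∂(volume : Measure (E N)), ∀ t : ℝ, |g x t| ≤ h x * |t| ^ (r - 1)) ∨
  (r = critExp N s ∧
    ∃ h : E N → ℝ, MemLp h ∞ volume ∧
      (∀ᵐ x ∂(volume : Measure (E N)), ∀ t : ℝ, |g x t| ≤ h x * |t| ^ (critExp N s - 1)) ∧
      ∀ᵐ x ∂(volume : Measure (E N)), g x 0 = 0)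

/-- The primitive `F(x,t) = ∫_0^t f(x,ξ) dξ`. -/
def primitive {N : ℕ} (f : E N → ℝ → ℝ) (x : E N) (t : ℝ) : ℝ := ∫ ξ in (0 : ℝ)..t, f x ξ

/-- The functional `u ↦ ∫ F(x,u(x)) dx`. -/
def potential {N : ℕ} (f : E N → ℝ → ℝ) (u : E N → ℝ) : ℝ := ∫ x, primitive f x (u x)

/-- `limsup_{|t| → ∞} F(x,t) / (ρ(x) |t|^τ) ≤ M`, uniformly for almost every `x`. -/
def LimsupLeUniformly {N : ℕ} (f : E N → ℝ → ℝ) (ρ : E N → ℝ) (τ M : ℝ) : Prop :=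
  ∀ ε : ℝ, 0 < ε → ∃ A : ℝ, ∀ᵐ x ∂(volume : Measure (E N)), ∀ t : ℝ, A < |t| →
    primitive f x t / (ρ x * |t| ^ τ) ≤ M + ε

/-- The number `θ`, one half of the infimum of `[u]_s² / ∫ F(x,u) dx` over the `u ∈ D^s` with
`∫ F(x,u) dx > 0`. -/
def theta {N : ℕ} (s : ℝ) (f : E N → ℝ → ℝ) : ℝ :=
  (1 / 2) * sInf {c : ℝ | ∃ u : E N → ℝ, MemDs s u ∧ 0 < potential f u ∧
    c = (gagliardoSq s u).toReal / potential f u}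

/-- Weak solutions `u ∈ D^s` of `(-Δ)^s u = lam f(x,u) + mu g(x,u)` in `ℝ^N`. -/
def IsWeakSolution {N : ℕ} (s : ℝ) (f g : E N → ℝ → ℝ) (lam mu : ℝ) (u : E N → ℝ) : Prop :=
  MemDs s u ∧ ∀ φ : E N → ℝ, MemDs s φ →
    Integrable (fun x => (lam * f x (u x) + mu * g x (u x)) * φ x) volume ∧
    gagliardoForm s u φ = ∫ x, (lam * f x (u x) + mu * g x (u x)) * φ x

end

end FracLap

/-! Solutions are the critical points on the Hilbert space D^s of the energy E = ½[u]² − λJ(u) −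
μΨ(u), where J(u) = ∫F(x,u) and Ψ is the corresponding potential of g. For μ = 0 the geometry is the
classical one. The bound J(u) ≤ K‖u‖ + L‖u‖^τ with τ < 2 makes E coercive; J(u) ≤ κ‖u‖^q with q > 2
makes 0 a strict local minimum; and λ > θ gives an e with E(e) < 0. One therefore expects one
critical point of negative energy, by minimization, and one of positive energy, by mountain pass.

For μ > 0 the term μΨ may have critical growth, so global coercivity and compactness can both fail.
Everything is therefore localized. Coercivity at μ = 0 places all relevant sublevel points in a ball
of radius R depending only on b and e. For small μ the perturbation is tiny on the ball of radius R
+ 1, so inside it the sublevel set still lies in the ball of radius R. Ekeland's principle, applied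
to points of the larger ball and to paths in it, then produces almost critical points that never
touch the boundary (`exists_critical_le_of_ball`, `exists_critical_mountain_pass`).

Compactness on the ball (`palaisSmale_energyGrad`) needs only that the coefficient C of |t|^(2*−1)
in the growth bound be small relative to R: if u_n = v + w_n with w_n ⇀ 0, the critical contribution
is at most C·const·(2R)^(2*−2)‖w_n‖², which ½‖w_n‖² absorbs. By Young's inequality the subcritical f
admits every ε > 0 as such a coefficient (`critGrowth_of_subcritical`), while g contributes a
multiple of μ. Hence δ is chosen after R and λ.

The functional analysis rests on the difference quotient, which embeds D^s isometrically in
L²(ℝ^{2N}). Comparing u(x) with its average over a ball yields both the Sobolev inequality and, for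
weakly null sequences, almost everywhere convergence of a subsequence. -/

/-! ### Ekeland's variational principle. -/

/-- **Ekeland's variational principle** for a continuous function bounded below. -/
theorem ekeland_variational_principle {X : Type*} [MetricSpace X] [CompleteSpace X]
    {φ : X → ℝ} (hφ : Continuous φ) (hb : BddBelow (Set.range φ)) {κ : ℝ} (hκ : 0 < κ) (x₀ : X) :
    ∃ x, φ x ≤ φ x₀ ∧ ∀ y, φ x ≤ φ y + κ * dist x y := by
  let S : X → Set X := fun x => {y | φ y + κ * dist x y ≤ φ x}
  have hSself : ∀ x, x ∈ S x := fun x => by simp [S]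
  have hStrans : ∀ x y z, y ∈ S x → z ∈ S y → z ∈ S x := by
    intro x y z hy hz
    simp only [S, Set.mem_ofPred_eq] at *
    nlinarith [dist_triangle x y z]
  have hbdd : ∀ x, BddBelow (φ '' S x) := fun x => hb.mono (Set.image_subset_range _ _)
  have hnext : ∀ (x : X) (n : ℕ), ∃ y ∈ S x, φ y < sInf (φ '' S x) + 1 / 2 ^ n := by
    intro x n
    obtain ⟨_, ⟨y, hy, rfl⟩, h⟩ := exists_lt_of_csInf_lt (⟨_, Set.mem_image_of_mem φ (hSself x)⟩)
      (show sInf (φ '' S x) < sInf (φ '' S x) + 1 / 2 ^ n from by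
        have : (0 : ℝ) < 1 / 2 ^ n := by positivity
        linarith)
    exact ⟨y, hy, h⟩
  choose nx hnx hnx' using hnext
  obtain ⟨u, hu0, hu⟩ : ∃ u : ℕ → X, u 0 = x₀ ∧ ∀ n, u (n + 1) = nx (u n) n :=
    ⟨fun n => Nat.rec x₀ (fun n x => nx x n) n, rfl, fun n => rfl⟩
  have hmem : ∀ n m, n ≤ m → u m ∈ S (u n) := by
    intro n m hnm
    induction m, hnm using Nat.le_induction with
    | base => exact hSself _
    | succ m _ ih => exact hStrans _ _ _ ih (by rw [hu]; exact hnx _ _)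
  -- Each point is chosen within 1/2^n of the infimum of `φ` over the previous set. As the sets
  -- decrease, the value at `u (n + 1)` can drop by at most 1/2^n inside its own set, which bounds
  -- distances there.
  have hsmall : ∀ n, ∀ y ∈ S (u (n + 1)), κ * dist (u (n + 1)) y ≤ 1 / 2 ^ n := by
    intro n y hy
    have h1 : y ∈ S (u n) := hStrans _ _ _ (hmem n (n + 1) (Nat.le_succ n)) hy
    have h2 : sInf (φ '' S (u n)) ≤ φ y := csInf_le (hbdd _) (Set.mem_image_of_mem φ h1)
    have h3 := hnx' (u n) n
    rw [← hu] at h3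
    simp only [S, Set.mem_ofPred_eq] at hy
    linarith
  have hlim0 : Tendsto (fun n : ℕ => 1 / κ * (1 / 2 : ℝ) ^ n) atTop (𝓝 0) := by
    simpa using (tendsto_pow_atTop_nhds_zero_of_lt_one (by norm_num : (0 : ℝ) ≤ 1 / 2)
      (by norm_num)).const_mul (1 / κ)
  have hsmall' : ∀ n, ∀ y ∈ S (u (n + 1)), dist (u (n + 1)) y ≤ 1 / κ * (1 / 2 : ℝ) ^ n := by
    intro n y hy
    have := hsmall n y hy
    rw [one_div_pow, one_div_mul_eq_div, le_div_iff₀ hκ]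
    linarith
  have hcau : CauchySeq (fun n => u (n + 1)) := by
    refine cauchySeq_of_le_tendsto_0' (fun n => 1 / κ * (1 / 2 : ℝ) ^ n) ?_ hlim0
    intro n m hnm
    exact hsmall' n _ (hmem _ _ (by omega))
  obtain ⟨x, hx⟩ := cauchySeq_tendsto_of_complete hcau
  have hxS : ∀ n, x ∈ S (u n) := by
    intro n
    have hcl : IsClosed (S (u n)) := by
      apply isClosed_le <;> fun_prop
    exact hcl.mem_of_tendsto hx (by
      filter_upwards [eventually_ge_atTop n] with m hm
      exact hmem _ _ (by omega))
  refine ⟨x, ?_, ?_⟩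
  · have := hxS 0
    simp only [S, Set.mem_ofPred_eq, hu0] at this
    have h0 : 0 ≤ κ * dist x₀ x := by positivity
    linarith
  · intro y
    by_contra! hlt
    -- A violating `y` belongs to all the nested sets, whose radii shrink to zero, so it is the same
    -- limit `x`; the strict inequality then fails.
    have hy : y ∈ S x := hlt.le
    have hyl : Tendsto (fun n => u (n + 1)) atTop (𝓝 y) := by
      rw [tendsto_iff_dist_tendsto_zero]
      exact squeeze_zero (fun _ => dist_nonneg)
        (fun n => hsmall' n y (hStrans _ _ _ (hxS _) hy)) hlim0
    have : x = y := tendsto_nhds_unique hx hyl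
    subst this
    simp at hlt

/-! ### Critical points on balls: minimization and mountain pass. -/

section CriticalPoints

variable {H : Type*} [NormedAddCommGroup H]

/-- Sequences in the ball of radius `R` with vanishing gradient have convergent subsequences. -/
def PalaisSmaleOnBall (G : H → H) (R : ℝ) : Prop :=
  ∀ u : ℕ → H, (∀ n, ‖u n‖ ≤ R) → Tendsto (fun n => G (u n)) atTop (𝓝 0) →
    ∃ (v : H) (ns : ℕ → ℕ), StrictMono ns ∧ Tendsto (u ∘ ns) atTop (𝓝 v)

/-- This converts the approximate critical points delivered by Ekeland's principle, with tolerance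
1/(n+1), into a genuine one. A closed set of values `S` is carried along because both the upper and
the lower energy bounds must survive the limit. -/
theorem PalaisSmaleOnBall.exists_critical {I : H → ℝ} {G : H → H} {R : ℝ}
    (hPS : PalaisSmaleOnBall G R) (hG : Continuous G) (hI : Continuous I) {S : Set ℝ}
    (hS : IsClosed S)
    (h : ∀ κ : ℝ, 0 < κ → ∃ u, ‖u‖ ≤ R ∧ I u ∈ S ∧ ‖G u‖ ≤ κ) :
    ∃ u, ‖u‖ ≤ R ∧ I u ∈ S ∧ G u = 0 := by
  choose! w hwR hwS hwG using h
  let u : ℕ → H := fun n => w (1 / ((n : ℝ) + 1))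
  have hpos : ∀ n : ℕ, (0 : ℝ) < 1 / ((n : ℝ) + 1) := fun n => by positivity
  have hGu : Tendsto (fun n => G (u n)) atTop (𝓝 0) :=
    squeeze_zero_norm (fun n => hwG _ (hpos n)) tendsto_one_div_add_atTop_nhds_zero_nat
  obtain ⟨v, ns, hns, hv⟩ := hPS u (fun n => hwR _ (hpos n)) hGu
  refine ⟨v, ?_, ?_, ?_⟩
  · exact le_of_tendsto hv.norm (Eventually.of_forall fun n => hwR _ (hpos _))
  · exact hS.mem_of_tendsto ((hI.tendsto v).comp hv)
      (Eventually.of_forall fun n => hwS _ (hpos _))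
  · exact tendsto_nhds_unique ((hG.tendsto v).comp hv) (hGu.comp hns.tendsto_atTop)

variable [InnerProductSpace ℝ H]

/-- `I` is differentiable along every line, with gradient `G`. -/
def HasLineGradient (I : H → ℝ) (G : H → H) : Prop :=
  ∀ u v, HasDerivAt (fun t : ℝ => I (u + t • v)) (inner ℝ (G u) v) 0

theorem HasLineGradient.hasDerivAt {I : H → ℝ} {G : H → H} (h : HasLineGradient I G) (u v : H)
    (t : ℝ) : HasDerivAt (fun t : ℝ => I (u + t • v)) (inner ℝ (G (u + t • v)) v) t := by
  have h1 := h (u + t • v) v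
  have h2 : HasDerivAt (fun τ : ℝ => τ - t) 1 t := (hasDerivAt_id t).sub_const t
  have h3 := HasDerivAt.comp (h₂ := fun τ : ℝ => I (u + t • v + τ • v)) t (by simpa using h1) h2
  simp only [mul_one] at h3
  refine h3.congr_of_eventuallyEq (Eventually.of_forall fun τ => ?_)
  simp only [Function.comp]
  congr 1
  module

/-- Together with continuity of `G`, this one-dimensional mean value theorem replaces Fréchet
differentiability throughout. -/
theorem HasLineGradient.exists_mean_value {I : H → ℝ} {G : H → H} (h : HasLineGradient I G)
    (u v : H) {r : ℝ} (hr : 0 < r) :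
    ∃ ξ ∈ Set.Ioo 0 r, I (u + r • v) = I u + r * inner ℝ (G (u + ξ • v)) v := by
  obtain ⟨ξ, hξ, he⟩ := exists_hasDerivAt_eq_slope (fun t : ℝ => I (u + t • v))
    (fun t => inner ℝ (G (u + t • v)) v) hr
    (fun t _ => (h.hasDerivAt u v t).continuousAt.continuousWithinAt)
    (fun t _ => h.hasDerivAt u v t)
  refine ⟨ξ, hξ, ?_⟩
  simp only [zero_smul, add_zero, sub_zero] at he
  rw [eq_div_iff hr.ne'] at he
  linarith

theorem HasLineGradient.continuous {I : H → ℝ} {G : H → H} (h : HasLineGradient I G)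
    (hG : Continuous G) : Continuous I := by
  rw [Metric.continuous_iff]
  intro u ε hε
  obtain ⟨δ, hδ, hδ'⟩ := Metric.continuous_iff.1 hG u 1 one_pos
  have hK : 0 < ‖G u‖ + 1 := by positivity
  refine ⟨min δ (ε / (‖G u‖ + 1)), lt_min hδ (by positivity), fun w hw => ?_⟩
  obtain ⟨ξ, hξ, he⟩ := h.exists_mean_value u (w - u) one_pos
  rw [one_smul, add_sub_cancel] at he
  have h1 : dist (u + ξ • (w - u)) u < δ := by
    rw [dist_eq_norm, add_sub_cancel_left, norm_smul, Real.norm_of_nonneg hξ.1.le, ← dist_eq_norm]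
    have : ξ * dist w u ≤ 1 * dist w u := by gcongr; exact hξ.2.le
    linarith [hw.trans_le (min_le_left _ _)]
  have h2 : ‖G (u + ξ • (w - u))‖ ≤ ‖G u‖ + 1 := by
    have := hδ' _ h1
    rw [dist_eq_norm] at this
    linarith [norm_le_norm_add_norm_sub' (G (u + ξ • (w - u))) (G u)]
  rw [Real.dist_eq, he, one_mul, add_sub_cancel_left]
  calc |inner ℝ (G (u + ξ • (w - u))) (w - u)| ≤ ‖G (u + ξ • (w - u))‖ * ‖w - u‖ :=
        abs_real_inner_le_norm _ _
    _ ≤ (‖G u‖ + 1) * ‖w - u‖ := by gcongr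
    _ < (‖G u‖ + 1) * (ε / (‖G u‖ + 1)) := by
        gcongr
        rw [← dist_eq_norm]
        exact hw.trans_le (min_le_right _ _)
    _ = ε := by field_simp

variable [CompleteSpace H]

/-- A functional on a closed ball whose sublevel set is kept away from the boundary has a critical
point below any prescribed value in the sublevel set. -/
theorem exists_critical_le_of_ball {I : H → ℝ} {G : H → H} (hI : HasLineGradient I G)
    (hG : Continuous G) {R R' c B : ℝ} (hRR' : R < R')
    (hlev : ∀ u, ‖u‖ ≤ R' → I u ≤ c → ‖u‖ ≤ R) (hB : ∀ u, ‖u‖ ≤ R' → B ≤ I u)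
    (hPS : PalaisSmaleOnBall G R) (e : H) (he : ‖e‖ ≤ R') (hec : I e ≤ c) :
    ∃ u, ‖u‖ ≤ R ∧ I u ≤ I e ∧ G u = 0 := by
  have hIc := hI.continuous hG
  refine hPS.exists_critical hG hIc (S := Set.Iic (I e)) isClosed_Iic fun κ hκ => ?_
  let X := Metric.closedBall (0 : H) R'
  have hX : ∀ u, u ∈ X ↔ ‖u‖ ≤ R' := fun u => mem_closedBall_zero_iff
  have : CompleteSpace X := Metric.isClosed_closedBall.completeSpace_coe
  obtain ⟨⟨u, hu⟩, hu1, hu2⟩ := ekeland_variational_principle (X := X) (φ := fun x => I x.1)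
    (by fun_prop) ⟨B, by rintro _ ⟨x, rfl⟩; exact hB _ ((hX _).1 x.2)⟩ hκ ⟨e, (hX e).2 he⟩
  simp only [Subtype.forall, Subtype.dist_eq] at hu1 hu2
  -- The near-minimizer lies in the smaller ball, so every direction is admissible for short times
  -- and the boundary of the larger ball imposes no constraint. Moving along −G would decrease `I`
  -- at a rate above `κ` if ‖G‖ > `κ`.
  have huR : ‖u‖ ≤ R := hlev u ((hX u).1 hu) (hu1.trans hec)
  refine ⟨u, huR, hu1, ?_⟩
  by_contra! hlt
  set v := -G u with hv
  have hv0 : 0 < ‖v‖ := by rw [hv, norm_neg]; linarith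
  have key : ∀ r : ℝ, 0 < r → r < (R' - R) / ‖v‖ → ∃ ξ ∈ Set.Ioo 0 r,
      -(κ * ‖v‖) ≤ inner ℝ (G (u + ξ • v)) v := by
    intro r hr hr'
    obtain ⟨ξ, hξ, hm⟩ := hI.exists_mean_value u v hr
    refine ⟨ξ, hξ, ?_⟩
    rw [lt_div_iff₀ hv0] at hr'
    have hn : ‖r • v‖ = r * ‖v‖ := by rw [norm_smul, Real.norm_of_nonneg hr.le]
    have h1 := hu2 (u + r • v) (by
      rw [hX]
      linarith [norm_add_le u (r • v)])
    rw [hm, dist_self_add_right, hn] at h1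
    have : 0 ≤ r * (inner ℝ (G (u + ξ • v)) v + κ * ‖v‖) := by linarith
    have := (mul_nonneg_iff_of_pos_left hr).1 this
    linarith
  have hcont : Tendsto (fun t : ℝ => inner ℝ (G (u + t • v)) v) (𝓝[>] 0) (𝓝 (inner ℝ (G u) v)) := by
    have : Continuous (fun t : ℝ => inner ℝ (G (u + t • v)) v) := by fun_prop
    simpa using (this.tendsto 0).mono_left nhdsWithin_le_nhds
  have hlt' : inner ℝ (G u) v < -(κ * ‖v‖) := by
    rw [hv, inner_neg_right, real_inner_self_eq_norm_sq, norm_neg]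
    nlinarith
  obtain ⟨r, hr, hr'⟩ := (nhdsGT_basis (0 : ℝ)).eventually_iff.1 (hcont.eventually_lt_const hlt')
  have hr0 : 0 < (R' - R) / ‖v‖ := div_pos (by linarith) hv0
  obtain ⟨ξ, hξ, hm⟩ := key (min r ((R' - R) / ‖v‖) / 2) (by positivity)
    (by have := min_le_right r ((R' - R) / ‖v‖); have : 0 < min r ((R' - R) / ‖v‖) := by positivity
        linarith)
  have h2 : ξ < r := by
    have := min_le_left r ((R' - R) / ‖v‖)
    have := hξ.2
    have : 0 < min r ((R' - R) / ‖v‖) := by positivity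
    linarith
  have := hr' ⟨hξ.1, h2⟩
  linarith

/-- **Mountain pass theorem** on a ball: the competing paths stay in the ball of radius `R'`, and
points below the level `c` stay in the smaller ball of radius `R`. -/
theorem exists_critical_mountain_pass {I : H → ℝ} {G : H → H} (hI : HasLineGradient I G)
    (hG : Continuous G) {R R' c α ρ : ℝ} (hRR' : R < R')
    (hlev : ∀ u, ‖u‖ ≤ R' → I u ≤ c → ‖u‖ ≤ R)
    (hPS : PalaisSmaleOnBall G R) (e : H) (he : ‖e‖ ≤ R') (hα : 0 < α)
    (hρ : 0 ≤ ρ) (hρe : ρ ≤ ‖e‖) (hsphere : ∀ u, ‖u‖ = ρ → α ≤ I u) (h0 : I 0 ≤ 0) (hIe : I e ≤ 0)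
    (hseg : ∀ t ∈ Set.Icc (0 : ℝ) 1, I (t • e) ≤ c) :
    ∃ u, ‖u‖ ≤ R ∧ α ≤ I u ∧ G u = 0 := by
  have hIc := hI.continuous hG
  refine hPS.exists_critical hG hIc (S := Set.Ici α) isClosed_Ici fun κ hκ => ?_
  -- Ekeland's principle is applied to the maximum of `I` along a path, on the complete metric space
  -- of paths from 0 to `e` inside the larger ball.
  let X : Set C(unitInterval, H) := {γ | γ 0 = 0 ∧ γ 1 = e ∧ ∀ t, ‖γ t‖ ≤ R'}
  have hXc : IsClosed X := by
    refine IsClosed.and (isClosed_eq (by fun_prop) (by fun_prop)) (IsClosed.and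
      (isClosed_eq (by fun_prop) (by fun_prop)) ?_)
    have : {γ : C(unitInterval, H) | ∀ t, ‖γ t‖ ≤ R'} = ⋂ t, {γ | ‖γ t‖ ≤ R'} := by ext; simp
    rw [this]
    exact isClosed_iInter fun t => isClosed_le (by fun_prop) (by fun_prop)
  have : CompleteSpace X := hXc.completeSpace_coe
  let Φ : C(unitInterval, H) → C(unitInterval, ℝ) := fun γ => ⟨fun t => I (γ t), by fun_prop⟩
  have hΦ : Continuous Φ :=
    ContinuousMap.continuous_postcomp (⟨I, hIc⟩ : C(H, ℝ))
  let φ : C(unitInterval, H) → ℝ := fun γ => sSup (Set.range (Φ γ))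
  have hbdd : ∀ γ, BddAbove (Set.range (Φ γ)) := fun γ => (isCompact_range (Φ γ).continuous).bddAbove
  have hle : ∀ γ t, I (γ t) ≤ φ γ := fun γ t => le_csSup (hbdd γ) ⟨t, rfl⟩
  have hmax : ∀ γ, ∃ t, I (γ t) = φ γ := fun γ =>
    (isCompact_range (Φ γ).continuous).sSup_mem (Set.range_nonempty _)
  have hφ : Continuous φ := by
    rw [Metric.continuous_iff]
    intro γ ε hε
    obtain ⟨δ, hδ, hδ'⟩ := Metric.continuous_iff.1 hΦ γ ε hε
    refine ⟨δ, hδ, fun γ' hγ' => ?_⟩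
    have hd := fun t => (ContinuousMap.dist_lt_iff hε).1 (hδ' γ' hγ') t
    obtain ⟨t, ht⟩ := hmax γ
    obtain ⟨t', ht'⟩ := hmax γ'
    have h1 := abs_lt.1 (hd t)
    have h2 := abs_lt.1 (hd t')
    have h3 := hle γ t'
    have h4 := hle γ' t
    simp only [Φ, ContinuousMap.coe_mk] at h1 h2
    rw [Real.dist_eq, abs_lt]
    constructor <;> linarith
  have hαφ : ∀ γ ∈ X, α ≤ φ γ := by
    rintro γ ⟨hγ0, hγ1, -⟩
    have : ρ ∈ Set.range (fun t => ‖γ t‖) := by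
      refine intermediate_value_univ (0 : unitInterval) 1 (by fun_prop) ⟨?_, ?_⟩
      · simpa [hγ0] using hρ
      · simpa [hγ1] using hρe
    obtain ⟨t, ht⟩ := this
    exact (hsphere _ ht).trans (hle γ t)
  let γ₀ : C(unitInterval, H) := ⟨fun t => (t : ℝ) • e, by fun_prop⟩
  have hγ₀ : γ₀ ∈ X := by
    refine ⟨by simp [γ₀], by simp [γ₀], fun t => ?_⟩
    simp only [γ₀, ContinuousMap.coe_mk, norm_smul, Real.norm_of_nonneg t.2.1]
    nlinarith [t.2.2, norm_nonneg e]
  obtain ⟨⟨γ, hγ⟩, hγ1, hγ2⟩ := ekeland_variational_principle (X := X) (φ := fun x => φ x.1)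
    (by fun_prop) ⟨α, by rintro _ ⟨x, rfl⟩; exact hαφ _ x.2⟩ hκ ⟨γ₀, hγ₀⟩
  simp only [Subtype.forall, Subtype.dist_eq] at hγ1 hγ2
  have hφc : φ γ ≤ c := by
    obtain ⟨t, ht⟩ := hmax γ₀
    rw [← ht] at hγ1
    exact hγ1.trans (hseg t t.2)
  have hγR : ∀ t, ‖γ t‖ ≤ R := fun t => hlev _ (hγ.2.2 t) ((hle γ t).trans hφc)
  -- The descent field is −G/‖G‖, regularized by `κ` where the gradient is small so that it stays
  -- continuous. The cutoff is 1 where `I` ≥ `α` and 0 where `I` ≤ 0; the latter fixes the endpoints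
  -- of the path.
  let v : C(unitInterval, H) :=
    ⟨fun t => -((min 1 (max (I (γ t)) 0 / α)) • (max κ ‖G (γ t)‖)⁻¹ • G (γ t)), by
      have : ∀ t, max κ ‖G (γ t)‖ ≠ 0 := fun t => (lt_max_of_lt_left hκ).ne'
      fun_prop (disch := assumption)⟩
  have hvt : ∀ t, v t = -((min 1 (max (I (γ t)) 0 / α)) • (max κ ‖G (γ t)‖)⁻¹ • G (γ t)) :=
    fun t => rfl
  have hv1 : ∀ t, ‖v t‖ ≤ 1 := by
    intro t
    have hp : 0 < max κ ‖G (γ t)‖ := lt_max_of_lt_left hκ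
    have h1 : 0 ≤ min 1 (max (I (γ t)) 0 / α) := le_min zero_le_one (by positivity)
    rw [hvt, norm_neg, norm_smul, norm_smul, Real.norm_of_nonneg h1, Real.norm_of_nonneg (by positivity)]
    have h2 : (max κ ‖G (γ t)‖)⁻¹ * ‖G (γ t)‖ ≤ 1 := by
      rw [inv_mul_le_iff₀ hp, mul_one]
      exact le_max_right _ _
    exact mul_le_one₀ (min_le_left _ _) (by positivity) h2
  have hv0 : ∀ t, I (γ t) ≤ 0 → v t = 0 := by
    intro t ht
    rw [hvt, max_eq_right ht]
    simp
  -- Steps no longer than R' − R keep the deformed path in the larger ball, since the original path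
  -- lies in the smaller one.
  let r : ℕ → ℝ := fun n => (R' - R) * (1 / ((n : ℝ) + 1))
  have hr : ∀ n, 0 < r n := fun n => mul_pos (by linarith) (by positivity)
  have hr' : ∀ n, r n ≤ R' - R := fun n => by
    have : 1 / ((n : ℝ) + 1) ≤ 1 := by
      rw [div_le_one (by positivity)]
      have : (0 : ℝ) ≤ n := by positivity
      linarith
    have h2 : 0 ≤ R' - R := by linarith
    calc r n ≤ (R' - R) * 1 := mul_le_mul_of_nonneg_left this h2
      _ = _ := mul_one _
  have hr0 : Tendsto r atTop (𝓝 0) := by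
    simpa [r] using (tendsto_one_div_add_atTop_nhds_zero_nat (𝕜 := ℝ)).const_mul (R' - R)
  have key : ∀ n, ∃ t : unitInterval, ∃ ξ ∈ Set.Ioo 0 (r n),
      φ γ - κ * r n ≤ I (γ t + r n • v t) ∧ -κ ≤ inner ℝ (G (γ t + ξ • v t)) (v t) := by
    intro n
    obtain ⟨t, ht⟩ := hmax (γ + r n • v)
    obtain ⟨ξ, hξ, hm⟩ := hI.exists_mean_value (γ t) (v t) (hr n)
    have hmem : γ + r n • v ∈ X := by
      refine ⟨?_, ?_, fun t => ?_⟩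
      · simp [hγ.1, hv0 0 (by rw [hγ.1]; exact h0)]
      · simp [hγ.2.1, hv0 1 (by rw [hγ.2.1]; exact hIe)]
      · have h1 : ‖r n • v t‖ ≤ R' - R := by
          rw [norm_smul, Real.norm_of_nonneg (hr n).le]
          nlinarith [hv1 t, hr' n, hr n, norm_nonneg (v t)]
        have := norm_add_le (γ t) (r n • v t)
        simp only [ContinuousMap.add_apply, ContinuousMap.smul_apply]
        linarith [hγR t]
    have h1 := hγ2 _ hmem
    have h2 : dist γ (γ + r n • v) ≤ r n := by
      rw [ContinuousMap.dist_le (hr n).le]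
      intro t
      simp only [ContinuousMap.add_apply, ContinuousMap.smul_apply, dist_self_add_right, norm_smul,
        Real.norm_of_nonneg (hr n).le]
      nlinarith [hv1 t, hr n]
    have h3 : κ * dist γ (γ + r n • v) ≤ κ * r n := by gcongr
    rw [← ht] at h1
    simp only [ContinuousMap.add_apply, ContinuousMap.smul_apply] at h1
    refine ⟨t, ξ, hξ, by linarith, ?_⟩
    rw [hm] at h1
    have h4 := hle γ t
    have : 0 ≤ r n * (inner ℝ (G (γ t + ξ • v t)) (v t) + κ) := by linarith
    have := (mul_nonneg_iff_of_pos_left (hr n)).1 this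
    linarith
  choose t ξ hξ hk1 hk2 using key
  -- The maximum points of the deformed paths accumulate at a maximum point `T` of the original
  -- path. There the cutoff is 1, so ‖G‖ > `κ` would make the derivative along `v` equal to −‖G‖ <
  -- −`κ`, against the limit of the Ekeland inequalities.
  obtain ⟨T, -, ns, hns, hT⟩ := (isCompact_univ (X := unitInterval)).tendsto_subseq
    (fun n => Set.mem_univ (t n))
  have hrn : Tendsto (r ∘ ns) atTop (𝓝 0) := hr0.comp hns.tendsto_atTop
  have hξn : Tendsto (ξ ∘ ns) atTop (𝓝 0) :=
    squeeze_zero (fun n => (hξ _).1.le) (fun n => (hξ (ns n)).2.le) hrn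
  have hγT : Tendsto (fun n => γ (t (ns n))) atTop (𝓝 (γ T)) := (γ.continuous.tendsto T).comp hT
  have hvT : Tendsto (fun n => v (t (ns n))) atTop (𝓝 (v T)) := (v.continuous.tendsto T).comp hT
  have hIT : φ γ ≤ I (γ T) := by
    have h1 : Tendsto (fun n => I (γ (t (ns n)) + r (ns n) • v (t (ns n)))) atTop (𝓝 (I (γ T))) := by
      have := (hIc.tendsto _).comp (hγT.add (hrn.smul hvT))
      simpa [Function.comp_def] using this
    have h2 : Tendsto (fun n => φ γ - κ * r (ns n)) atTop (𝓝 (φ γ)) := by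
      simpa using (hrn.const_mul κ).const_sub (φ γ)
    exact le_of_tendsto_of_tendsto' h2 h1 fun n => hk1 (ns n)
  have hinner : -κ ≤ inner ℝ (G (γ T)) (v T) := by
    have h1 := (hG.tendsto _).comp (hγT.add (hξn.smul hvT))
    have h2 := h1.inner (𝕜 := ℝ) hvT
    rw [zero_smul, add_zero] at h2
    exact ge_of_tendsto' h2 fun n => hk2 (ns n)
  have hαT : α ≤ I (γ T) := (hαφ γ hγ).trans hIT
  refine ⟨γ T, hγR T, hαT, ?_⟩
  by_contra! hlt
  have hmin : min 1 (max (I (γ T)) 0 / α) = 1 := by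
    rw [min_eq_left]
    rw [le_div_iff₀ hα, one_mul]
    exact hαT.trans (le_max_left _ _)
  rw [hvt, hmin, one_smul, max_eq_right hlt.le, inner_neg_right, inner_smul_right,
    real_inner_self_eq_norm_sq] at hinner
  have hpos : 0 < ‖G (γ T)‖ := hκ.trans hlt
  have : ‖G (γ T)‖⁻¹ * ‖G (γ T)‖ ^ 2 = ‖G (γ T)‖ := by field_simp
  linarith

end CriticalPoints

/-! ### The critical exponent and the fractional Sobolev inequality. -/

namespace FracLap

section Exponent

variable {N : ℕ} {s : ℝ}

theorem one_div_critExp (hs0 : 0 < s) (hsN : 2 * s < (N : ℝ)) :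
    1 / critExp N s = 1 / 2 - s / N := by
  have hN : (0 : ℝ) < N := by linarith
  have : (N : ℝ) - 2 * s ≠ 0 := by linarith
  unfold critExp
  field_simp

theorem two_lt_critExp (hs0 : 0 < s) (hsN : 2 * s < (N : ℝ)) : 2 < critExp N s := by
  unfold critExp
  rw [lt_div_iff₀ (by linarith)]
  linarith

end Exponent

section Sobolev

variable {N : ℕ} {s : ℝ}

/-- The inner integral `∫ |u(x) - u(y)|² / |x - y|^(N + 2s) dy` of the Gagliardo seminorm. -/
noncomputable def gagliardoDensity (s : ℝ) (u : E N → ℝ) (x : E N) : ℝ≥0∞ :=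
  ∫⁻ y : E N, ENNReal.ofReal (|u x - u y| ^ 2 / ‖x - y‖ ^ ((N : ℝ) + 2 * s))

theorem aemeasurable_gagliardo_integrand {u : E N → ℝ} (hu : AEMeasurable u) (s : ℝ) :
    AEMeasurable (fun z : E N × E N =>
      ENNReal.ofReal (|u z.1 - u z.2| ^ 2 / ‖z.1 - z.2‖ ^ ((N : ℝ) + 2 * s))) := by
  have h1 : AEMeasurable (fun z : E N × E N => u z.1) :=
    hu.comp_quasiMeasurePreserving Measure.quasiMeasurePreserving_fst
  have h2 : AEMeasurable (fun z : E N × E N => u z.2) :=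
    hu.comp_quasiMeasurePreserving Measure.quasiMeasurePreserving_snd
  have h3 : Measurable (fun z : E N × E N => ‖z.1 - z.2‖ ^ ((N : ℝ) + 2 * s)) := by fun_prop
  have h4 : AEMeasurable (fun z : E N × E N => |u z.1 - u z.2| ^ 2) := by
    simp only [sq_abs]
    exact (h1.sub h2).pow_const 2
  exact (h4.div h3.aemeasurable).ennreal_ofReal

theorem gagliardoSq_eq_lintegral_density {u : E N → ℝ} (hu : AEMeasurable u) (s : ℝ) :
    gagliardoSq s u = ∫⁻ x, gagliardoDensity s u x := by
  unfold gagliardoSq gagliardoDensity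
  exact lintegral_prod _ (aemeasurable_gagliardo_integrand hu s)

theorem aemeasurable_gagliardoDensity {u : E N → ℝ} (hu : AEMeasurable u) (s : ℝ) :
    AEMeasurable (gagliardoDensity s u) :=
  (aemeasurable_gagliardo_integrand hu s).lintegral_prod_right'

theorem gagliardoSq_congr_ae {u v : E N → ℝ} (h : u =ᵐ[volume] v) :
    gagliardoSq s u = gagliardoSq s v := by
  unfold gagliardoSq
  refine lintegral_congr_ae ?_
  filter_upwards [Measure.quasiMeasurePreserving_fst.ae_eq_comp h,
    Measure.quasiMeasurePreserving_snd.ae_eq_comp h] with z h1 h2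
  simp only [Function.comp] at h1 h2
  rw [h1, h2]

/-- The volume of the unit ball of `ℝ^N`. -/
noncomputable def unitBallVolume (N : ℕ) : ℝ := volume.real (Metric.ball (0 : E N) 1)

theorem unitBallVolume_pos : 0 < unitBallVolume N :=
  ENNReal.toReal_pos (Metric.measure_ball_pos volume _ one_pos).ne' measure_ball_lt_top.ne

theorem volume_ball_eq (x : E N) {r : ℝ} (hr : 0 < r) :
    volume (Metric.ball x r) = ENNReal.ofReal (r ^ N * unitBallVolume N) := by
  rw [Measure.addHaar_ball_of_pos volume x hr, ENNReal.ofReal_mul (by positivity), unitBallVolume,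
    Measure.real, ENNReal.ofReal_toReal measure_ball_lt_top.ne]
  simp

/-- On the ball the singular kernel is at least r^(−(N+2s)), so it can be inserted at the cost of
this factor. -/
theorem setLIntegral_ball_sub_sq_le (hs0 : 0 < s) (u : E N → ℝ) (x : E N) {r : ℝ} (hr : 0 < r) :
    ∫⁻ y in Metric.ball x r, ‖u x - u y‖ₑ ^ 2 ≤
      ENNReal.ofReal (r ^ ((N : ℝ) + 2 * s)) * gagliardoDensity s u x := by
  unfold gagliardoDensity
  rw [← lintegral_const_mul' _ _ ENNReal.ofReal_ne_top]
  refine (setLIntegral_mono' measurableSet_ball fun y hy => ?_).trans (setLIntegral_le_lintegral _ _)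
  rw [← ENNReal.ofReal_mul (by positivity), Real.enorm_eq_ofReal_abs,
    ← ENNReal.ofReal_pow (abs_nonneg _)]
  apply ENNReal.ofReal_le_ofReal
  rcases eq_or_ne x y with rfl | hne
  · simp
  have hd : 0 < ‖x - y‖ := norm_pos_iff.2 (sub_ne_zero.2 hne)
  have hd' : ‖x - y‖ ≤ r := by
    rw [Metric.mem_ball, dist_comm, dist_eq_norm] at hy
    exact hy.le
  rw [← mul_div_assoc, le_div_iff₀ (by positivity), mul_comm]
  gcongr

/-- By Cauchy–Schwarz, the squared deviation from the average is at most the average squared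
deviation. The power r^(N+2s) from the kernel divided by the volume of order r^N leaves r^(2s). -/
theorem enorm_sub_average_sq_le (hs0 : 0 < s) {u : E N → ℝ} (hu : AEMeasurable u) (x : E N) {r : ℝ}
    (hr : 0 < r) (hint : IntegrableOn u (Metric.ball x r)) :
    ‖u x - ⨍ y in Metric.ball x r, u y‖ₑ ^ 2 ≤
      ENNReal.ofReal ((unitBallVolume N)⁻¹ * r ^ (2 * s)) * gagliardoDensity s u x := by
  set B := Metric.ball x r with hB
  set V := volume B with hV
  have hV0 : V ≠ 0 := (Metric.measure_ball_pos volume _ hr).ne'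
  have hVt : V ≠ ∞ := measure_ball_lt_top.ne
  have hfin : IsFiniteMeasure (volume.restrict B) := ⟨by simpa using measure_ball_lt_top⟩
  have hne : NeZero (volume.restrict B) := ⟨by
    intro h; apply hV0; rw [hV, ← Measure.restrict_apply_self, h]; simp⟩
  have h1 : u x - ⨍ y in B, u y = ⨍ y in B, (u x - u y) := by
    rw [average_eq, average_eq, integral_sub (integrable_const _) hint, smul_sub]
    congr 1
    rw [integral_const]
    simp only [smul_eq_mul]
    rw [← mul_assoc, inv_mul_cancel₀, one_mul]
    rw [Measure.real, Measure.restrict_apply_univ]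
    exact (ENNReal.toReal_pos hV0 hVt).ne'
  have h2 : ‖⨍ y in B, (u x - u y)‖ₑ ≤ V⁻¹ * ∫⁻ y in B, ‖u x - u y‖ₑ := by
    rw [average_eq, enorm_smul]
    gcongr
    · rw [Measure.real, Measure.restrict_apply_univ, enorm_inv, ← ofReal_norm,
        Real.norm_of_nonneg ENNReal.toReal_nonneg, ENNReal.ofReal_toReal hVt]
      exact (ENNReal.toReal_pos hV0 hVt).ne'
    · exact enorm_integral_le_lintegral_enorm _
  have h3 : (∫⁻ y in B, ‖u x - u y‖ₑ) ^ 2 ≤ V * ∫⁻ y in B, ‖u x - u y‖ₑ ^ 2 := by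
    have := eLpNorm_le_eLpNorm_mul_rpow_measure_univ (p := 1) (q := 2) (μ := volume.restrict B)
      (f := fun y => u x - u y) (by norm_num)
      (aestronglyMeasurable_const.sub hu.aestronglyMeasurable.restrict)
    rw [eLpNorm_one_eq_lintegral_enorm, Measure.restrict_apply_univ] at this
    calc _ ≤ (eLpNorm (fun y => u x - u y) 2 (volume.restrict B) *
          V ^ (1 / ENNReal.toReal 1 - 1 / ENNReal.toReal 2)) ^ 2 := by gcongr
      _ = _ := by
        rw [mul_pow, mul_comm]
        congr 1
        · rw [← ENNReal.rpow_natCast, ← ENNReal.rpow_mul]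
          norm_num
        · rw [eLpNorm_eq_lintegral_rpow_enorm_toReal (by norm_num) (by norm_num),
            ← ENNReal.rpow_natCast, ← ENNReal.rpow_mul]
          norm_num
  rw [h1]
  calc _ ≤ (V⁻¹ * ∫⁻ y in B, ‖u x - u y‖ₑ) ^ 2 := by gcongr
    _ = V⁻¹ ^ 2 * (∫⁻ y in B, ‖u x - u y‖ₑ) ^ 2 := mul_pow _ _ _
    _ ≤ V⁻¹ ^ 2 * (V * (ENNReal.ofReal (r ^ ((N : ℝ) + 2 * s)) * gagliardoDensity s u x)) := by
        gcongr
        exact h3.trans (by gcongr; exact setLIntegral_ball_sub_sq_le hs0 u x hr)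
    _ = V⁻¹ * ENNReal.ofReal (r ^ ((N : ℝ) + 2 * s)) * gagliardoDensity s u x := by
        rw [sq, ← mul_assoc, ← mul_assoc, mul_assoc (V⁻¹), ENNReal.inv_mul_cancel hV0 hVt, mul_one]
    _ = _ := by
        congr 1
        have hc := unitBallVolume_pos (N := N)
        rw [hV, hB, volume_ball_eq x hr, ← ENNReal.ofReal_inv_of_pos (by positivity),
          ← ENNReal.ofReal_mul (by positivity)]
        congr 1
        rw [Real.rpow_add hr, Real.rpow_natCast]
        field_simp

theorem abs_average_le {p : ℝ} (hp : 1 ≤ p) {u : E N → ℝ}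
    (hu : MemLp u (ENNReal.ofReal p)) (x : E N) {r : ℝ} (hr : 0 < r) :
    |⨍ y in Metric.ball x r, u y| ≤
      (r ^ N * unitBallVolume N) ^ (-(1 / p)) * (eLpNorm u (ENNReal.ofReal p)).toReal := by
  set B := Metric.ball x r with hB
  have hc := unitBallVolume_pos (N := N)
  set v := r ^ N * unitBallVolume N with hv
  have hv0 : 0 < v := by positivity
  have hV : volume B = ENNReal.ofReal v := volume_ball_eq x hr
  have h3 : ∫⁻ y in B, ‖u y‖ₑ ≤ eLpNorm u (ENNReal.ofReal p) * ENNReal.ofReal (v ^ (1 - 1 / p)) := by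
    have := eLpNorm_le_eLpNorm_mul_rpow_measure_univ (p := 1) (q := ENNReal.ofReal p)
      (μ := volume.restrict B) (f := u) (by simpa using hp) hu.1.restrict
    rw [eLpNorm_one_eq_lintegral_enorm, Measure.restrict_apply_univ, hV,
      ENNReal.toReal_ofReal (by linarith), ENNReal.toReal_one, one_div_one,
      ENNReal.ofReal_rpow_of_pos hv0] at this
    exact this.trans (by gcongr; exact Measure.restrict_le_self)
  have h4 : |∫ y in B, u y| ≤ (eLpNorm u (ENNReal.ofReal p)).toReal * v ^ (1 - 1 / p) := by
    rw [← Real.norm_eq_abs]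
    refine (norm_integral_le_lintegral_norm _).trans ?_
    simp only [ofReal_norm]
    refine (ENNReal.toReal_mono ?_ h3).trans_eq ?_
    · exact ENNReal.mul_ne_top hu.2.ne ENNReal.ofReal_ne_top
    · rw [ENNReal.toReal_mul, ENNReal.toReal_ofReal (by positivity)]
  rw [average_eq, Measure.real, Measure.restrict_apply_univ, hV, ENNReal.toReal_ofReal hv0.le,
    smul_eq_mul, abs_mul, abs_of_pos (inv_pos.2 hv0)]
  calc _ ≤ v⁻¹ * ((eLpNorm u (ENNReal.ofReal p)).toReal * v ^ (1 - 1 / p)) := by gcongr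
    _ = _ := by
      rw [Real.rpow_sub hv0, Real.rpow_neg hv0.le, Real.rpow_one]
      field_simp

theorem MemLp.integrableOn_ball {p : ℝ} (hp : 1 ≤ p) {u : E N → ℝ}
    (hu : MemLp u (ENNReal.ofReal p)) (x : E N) (r : ℝ) : IntegrableOn u (Metric.ball x r) := by
  have hfin : IsFiniteMeasure (volume.restrict (Metric.ball x r)) :=
    ⟨by simpa using measure_ball_lt_top⟩
  exact (hu.restrict _).integrable (by simpa using hp)

/-- The constant of the pointwise estimate behind the fractional Sobolev inequality. -/
noncomputable def sobolevConst (N : ℕ) (s : ℝ) : ℝ :=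
  (unitBallVolume N) ^ (-(1 / 2 : ℝ)) + (unitBallVolume N) ^ (-(1 / critExp N s))

theorem sobolevConst_pos : 0 < sobolevConst N s := by
  have := unitBallVolume_pos (N := N)
  unfold sobolevConst
  positivity

/-- A Hedberg-type argument: u(x) is compared with its average over a ball. The deviation is of
order r^s D^(1/2) and the average, by Hölder, of order r^(−N/p) A with p = 2*; the radius is then
optimized. -/
theorem abs_le_of_gagliardoDensity_lt (hs0 : 0 < s) (hsN : 2 * s < (N : ℝ)) {u : E N → ℝ}
    (hu : MemLp u (ENNReal.ofReal (critExp N s))) (x : E N) {D A : ℝ} (hD : 0 < D) (hA : 0 < A)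
    (hAu : (eLpNorm u (ENNReal.ofReal (critExp N s))).toReal = A)
    (hDx : gagliardoDensity s u x ≤ ENNReal.ofReal D) :
    |u x| ≤ sobolevConst N s * (A ^ (2 * s / N) * D ^ (1 / critExp N s)) := by
  have hN : (0 : ℝ) < N := by linarith
  have hp := two_lt_critExp hs0 hsN
  have hc := unitBallVolume_pos (N := N)
  set c := unitBallVolume N
  -- This radius balances the two terms, since s + N/p = N/2. Both then become multiples of A^(2s/N)
  -- D^(1/p).
  set r : ℝ := (A ^ 2 / D) ^ (1 / (N : ℝ)) with hr
  have hr0 : 0 < r := by positivity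
  have h1 := enorm_sub_average_sq_le hs0 hu.1.aemeasurable x hr0
    (MemLp.integrableOn_ball (by linarith) hu x r)
  have h2 := abs_average_le (by linarith) hu x hr0
  set a := ⨍ y in Metric.ball x r, u y
  have h3 : |u x - a| ^ 2 ≤ c⁻¹ * r ^ (2 * s) * D := by
    rw [Real.enorm_eq_ofReal_abs, ← ENNReal.ofReal_pow (abs_nonneg _)] at h1
    have h4 := h1.trans (mul_le_mul_right hDx _)
    rw [← ENNReal.ofReal_mul (by positivity)] at h4
    exact (ENNReal.ofReal_le_ofReal_iff (by positivity)).1 h4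
  have e1 : c⁻¹ * r ^ (2 * s) * D = (c ^ (-(1 / 2 : ℝ)) * (A ^ (2 * s / N) * D ^ (1 / critExp N s))) ^ 2 := by
    rw [one_div_critExp hs0 hsN, hr, ← Real.rpow_mul (by positivity), Real.div_rpow (by positivity) hD.le,
      mul_pow, mul_pow, ← Real.rpow_natCast (c ^ _), ← Real.rpow_mul hc.le, ← Real.rpow_natCast A 2,
      ← Real.rpow_mul hA.le, ← Real.rpow_natCast (A ^ _), ← Real.rpow_mul hA.le,
      ← Real.rpow_natCast (D ^ _), ← Real.rpow_mul hD.le]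
    have : (1 / 2 - s / N) * ((2 : ℕ) : ℝ) = 1 - 1 / N * (2 * s) := by push_cast; ring
    rw [this, Real.rpow_sub hD, Real.rpow_one]
    have : -(1 / 2 : ℝ) * ((2 : ℕ) : ℝ) = -1 := by norm_num
    rw [this, Real.rpow_neg_one]
    have : (2 * s / N) * ((2 : ℕ) : ℝ) = ((2 : ℕ) : ℝ) * (1 / N * (2 * s)) := by push_cast; ring
    rw [this]
    field_simp
  have h5 : |u x - a| ≤ c ^ (-(1 / 2 : ℝ)) * (A ^ (2 * s / N) * D ^ (1 / critExp N s)) := by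
    rw [e1] at h3
    exact (pow_le_pow_iff_left₀ (abs_nonneg _) (by positivity) two_ne_zero).1 h3
  have e2 : (r ^ N * c) ^ (-(1 / critExp N s)) * A =
      c ^ (-(1 / critExp N s)) * (A ^ (2 * s / N) * D ^ (1 / critExp N s)) := by
    have hrN : r ^ N = A ^ 2 / D := by
      rw [hr, ← Real.rpow_natCast, ← Real.rpow_mul (by positivity), one_div_mul_cancel hN.ne',
        Real.rpow_one]
    rw [hrN, Real.mul_rpow (by positivity) hc.le, Real.rpow_neg (by positivity) (1 / critExp N s),
      Real.div_rpow (by positivity) hD.le, ← Real.rpow_natCast A 2, ← Real.rpow_mul hA.le]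
    have : 2 * s / N = 1 - ((2 : ℕ) : ℝ) * (1 / critExp N s) := by
      rw [one_div_critExp hs0 hsN]; push_cast; ring
    rw [this, Real.rpow_sub hA, Real.rpow_one]
    field_simp
  rw [hAu, e2] at h2
  unfold sobolevConst
  rw [add_mul]
  calc |u x| = |(u x - a) + a| := by rw [sub_add_cancel]
    _ ≤ |u x - a| + |a| := abs_add_le _ _
    _ ≤ _ := add_le_add h5 h2

/-- **Fractional Sobolev inequality**, for functions already known to be in `L^{2_s^*}`. -/
theorem eLpNorm_critExp_le (hs0 : 0 < s) (hsN : 2 * s < (N : ℝ)) {u : E N → ℝ}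
    (hu : MemLp u (ENNReal.ofReal (critExp N s))) :
    eLpNorm u (ENNReal.ofReal (critExp N s)) ≤
      ENNReal.ofReal (sobolevConst N s ^ (critExp N s / 2)) * gagliardoSq s u ^ (1 / 2 : ℝ) := by
  have hN : (0 : ℝ) < N := by linarith
  have hp := two_lt_critExp hs0 hsN
  have hK := sobolevConst_pos (N := N) (s := s)
  have hdiv := one_div_critExp hs0 hsN
  set p := critExp N s
  set K := sobolevConst N s
  set A := (eLpNorm u (ENNReal.ofReal p)).toReal with hAdef
  have hAe : eLpNorm u (ENNReal.ofReal p) = ENNReal.ofReal A := (ENNReal.ofReal_toReal hu.2.ne).symm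
  have hA0 : 0 ≤ A := ENNReal.toReal_nonneg
  rcases hA0.eq_or_lt with hA | hA
  · rw [hAe, ← hA]; simp
  -- The p-th power of the pointwise bound is linear in the density, because (2s/N)p = p − 2.
  -- Integration gives A^p ≤ K^p A^(p−2)[u]², and A^(p−2) cancels since A is finite and positive.
  have hpt : ∀ x, ‖u x‖ₑ ^ p ≤ ENNReal.ofReal (K ^ p * A ^ (p - 2)) * gagliardoDensity s u x := by
    intro x
    rw [Real.enorm_eq_ofReal_abs, ENNReal.ofReal_rpow_of_nonneg (abs_nonneg _) (by linarith)]
    by_cases htop : gagliardoDensity s u x = ∞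
    · rw [htop, ENNReal.mul_top (by simp; positivity)]
      exact le_top
    have hreal : |u x| ^ p ≤ K ^ p * A ^ (p - 2) * (gagliardoDensity s u x).toReal := by
      -- The pointwise bound needs a positive density; a vanishing one is reached by letting ε → 0.
      have : ∀ ε : ℝ, 0 < ε → |u x| ^ p ≤
          K ^ p * A ^ (p - 2) * ((gagliardoDensity s u x).toReal + ε) := by
        intro ε hε
        have hD : 0 < (gagliardoDensity s u x).toReal + ε := by positivity
        have h := abs_le_of_gagliardoDensity_lt hs0 hsN hu x hD hA rfl (by
          rw [ENNReal.le_ofReal_iff_toReal_le htop hD.le]; linarith)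
        calc |u x| ^ p ≤ (K * (A ^ (2 * s / N) * ((gagliardoDensity s u x).toReal + ε) ^ (1 / p))) ^ p :=
              Real.rpow_le_rpow (abs_nonneg _) h (by linarith)
          _ = _ := by
            rw [Real.mul_rpow hK.le (by positivity), Real.mul_rpow (by positivity) (by positivity),
              ← Real.rpow_mul hA.le, ← Real.rpow_mul hD.le, one_div_mul_cancel (by linarith),
              Real.rpow_one, mul_assoc]
            congr 3
            have : 2 * s / N = 1 - 2 * (1 / p) := by rw [hdiv]; ring
            rw [this]
            field_simp
      have hlim : Tendsto (fun ε : ℝ => K ^ p * A ^ (p - 2) * ((gagliardoDensity s u x).toReal + ε))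
          (𝓝[>] 0) (𝓝 (K ^ p * A ^ (p - 2) * ((gagliardoDensity s u x).toReal + 0))) := by
        apply Tendsto.mono_left _ nhdsWithin_le_nhds
        apply Continuous.tendsto
        fun_prop
      rw [add_zero] at hlim
      exact ge_of_tendsto hlim (eventually_mem_nhdsWithin.mono fun ε hε => this ε hε)
    rw [← ENNReal.ofReal_toReal htop, ← ENNReal.ofReal_mul (by positivity)]
    exact ENNReal.ofReal_le_ofReal hreal
  have hint : ENNReal.ofReal (A ^ p) ≤ ENNReal.ofReal (K ^ p * A ^ (p - 2)) * gagliardoSq s u := by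
    rw [gagliardoSq_eq_lintegral_density hu.1.aemeasurable, ← lintegral_const_mul' _ _ ENNReal.ofReal_ne_top,
      ← ENNReal.ofReal_rpow_of_pos hA, ← hAe, eLpNorm_eq_lintegral_rpow_enorm_toReal (by simp; linarith)
      ENNReal.ofReal_ne_top, ENNReal.toReal_ofReal (by linarith), ← ENNReal.rpow_mul,
      one_div_mul_cancel (by linarith), ENNReal.rpow_one]
    exact lintegral_mono hpt
  have hsq : ENNReal.ofReal (A ^ 2) ≤ ENNReal.ofReal (K ^ p) * gagliardoSq s u := by
    have e : A ^ p = A ^ (p - 2) * A ^ 2 := by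
      rw [← Real.rpow_natCast A 2, ← Real.rpow_add hA]; norm_num
    rw [e, ENNReal.ofReal_mul (by positivity), mul_comm (K ^ p), ENNReal.ofReal_mul (by positivity),
      mul_assoc] at hint
    exact (ENNReal.mul_le_mul_iff_right (by simp; positivity) ENNReal.ofReal_ne_top).1 hint
  rw [hAe]
  calc ENNReal.ofReal A = ENNReal.ofReal (A ^ 2) ^ (1 / 2 : ℝ) := by
        rw [ENNReal.ofReal_rpow_of_pos (by positivity), ← Real.rpow_natCast, ← Real.rpow_mul hA.le]
        norm_num
    _ ≤ (ENNReal.ofReal (K ^ p) * gagliardoSq s u) ^ (1 / 2 : ℝ) := by gcongr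
    _ = _ := by
      rw [ENNReal.mul_rpow_of_nonneg _ _ (by norm_num), ENNReal.ofReal_rpow_of_pos (by positivity),
        ← Real.rpow_mul hK.le]
      congr 3
      ring

end Sobolev

end FracLap

/-! ### Difference quotients and finiteness of the Gagliardo norm of test functions. -/

namespace FracLap

/-- The standing assumptions `0 < s < 1` and `2s < N`. -/
class Admissible (N : ℕ) (s : ℝ) : Prop where
  pos : 0 < s
  lt_one : s < 1
  two_mul_lt : 2 * s < (N : ℝ)

section DifferenceQuotient

variable {N : ℕ} {s : ℝ}

/-- The difference quotient `(u(x) - u(y)) / |x - y|^((N + 2s)/2)`. -/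
noncomputable def diffQuot (s : ℝ) (u : E N → ℝ) (z : E N × E N) : ℝ :=
  (u z.1 - u z.2) / ‖z.1 - z.2‖ ^ (((N : ℝ) + 2 * s) / 2)

theorem diffQuot_add (u v : E N → ℝ) : diffQuot s (u + v) = diffQuot s u + diffQuot s v := by
  ext z; simp only [diffQuot, Pi.add_apply]; ring

theorem diffQuot_sub (u v : E N → ℝ) : diffQuot s (u - v) = diffQuot s u - diffQuot s v := by
  ext z; simp only [diffQuot, Pi.sub_apply]; ring

theorem diffQuot_smul (c : ℝ) (u : E N → ℝ) : diffQuot s (c • u) = c • diffQuot s u := by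
  ext z; simp only [diffQuot, Pi.smul_apply, smul_eq_mul]; ring

theorem diffQuot_zero : diffQuot s (0 : E N → ℝ) = 0 := by
  ext z; simp [diffQuot]

theorem diffQuot_congr_ae {u v : E N → ℝ} (h : u =ᵐ[volume] v) :
    diffQuot s u =ᵐ[volume] diffQuot s v := by
  filter_upwards [Measure.quasiMeasurePreserving_fst.ae_eq_comp h,
    Measure.quasiMeasurePreserving_snd.ae_eq_comp h] with z h1 h2
  simp only [Function.comp] at h1 h2
  rw [diffQuot, diffQuot, h1, h2]

theorem aestronglyMeasurable_diffQuot {u : E N → ℝ} (hu : AEStronglyMeasurable u) :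
    AEStronglyMeasurable (diffQuot s u) := by
  have h1 : AEMeasurable (fun z : E N × E N => u z.1) :=
    hu.aemeasurable.comp_quasiMeasurePreserving Measure.quasiMeasurePreserving_fst
  have h2 : AEMeasurable (fun z : E N × E N => u z.2) :=
    hu.aemeasurable.comp_quasiMeasurePreserving Measure.quasiMeasurePreserving_snd
  have h3 : Measurable (fun z : E N × E N => ‖z.1 - z.2‖ ^ (((N : ℝ) + 2 * s) / 2)) := by fun_prop
  exact ((h1.sub h2).div h3.aemeasurable).aestronglyMeasurable

theorem norm_rpow_half_sq (z : E N) :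
    (‖z‖ ^ (((N : ℝ) + 2 * s) / 2)) ^ 2 = ‖z‖ ^ ((N : ℝ) + 2 * s) := by
  rw [← Real.rpow_natCast, ← Real.rpow_mul (norm_nonneg _)]
  norm_num

theorem eLpNorm_diffQuot_sq (u : E N → ℝ) : eLpNorm (diffQuot s u) 2 ^ 2 = gagliardoSq s u := by
  rw [eLpNorm_eq_lintegral_rpow_enorm_toReal (by norm_num) (by norm_num),
    ← ENNReal.rpow_natCast, ← ENNReal.rpow_mul]
  norm_num
  unfold gagliardoSq
  congr 1
  ext z
  rw [Real.enorm_eq_ofReal_abs, ← ENNReal.ofReal_pow (abs_nonneg _), diffQuot, abs_div, div_pow,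
    abs_of_nonneg (a := ‖z.1 - z.2‖ ^ (((N : ℝ) + 2 * s) / 2)) (by positivity), norm_rpow_half_sq]

theorem gagliardoSq_rpow_half (u : E N → ℝ) :
    gagliardoSq s u ^ (1 / 2 : ℝ) = eLpNorm (diffQuot s u) 2 := by
  rw [← eLpNorm_diffQuot_sq, ← ENNReal.rpow_natCast, ← ENNReal.rpow_mul]
  norm_num

theorem gagliardoForm_eq (u φ : E N → ℝ) :
    gagliardoForm s u φ = ∫ z, diffQuot s u z * diffQuot s φ z := by
  unfold gagliardoForm
  congr 1
  ext z
  rw [diffQuot, diffQuot, div_mul_div_comm, ← sq, norm_rpow_half_sq]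

/-- Near the origin the function is of order |h|^(2−N−2s), integrable because s < 1; at infinity it
is |h|^(−N−2s), integrable because s > 0. -/
theorem integrable_min_norm_sq_div (hs0 : 0 < s) (hs1 : s < 1) (hN : 1 ≤ N) :
    Integrable (fun h : E N => min (‖h‖ ^ 2) 1 / ‖h‖ ^ ((N : ℝ) + 2 * s)) := by
  have hmeas : Measurable (fun h : E N => min (‖h‖ ^ 2) 1 / ‖h‖ ^ ((N : ℝ) + 2 * s)) := by fun_prop
  have hdim : Module.finrank ℝ (E N) = N := finrank_euclideanSpace_fin
  have hnn : ∀ h : E N, 0 ≤ min (‖h‖ ^ 2) 1 / ‖h‖ ^ ((N : ℝ) + 2 * s) := fun h => by positivity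
  have h1 : IntegrableOn (fun h : E N => min (‖h‖ ^ 2) 1 / ‖h‖ ^ ((N : ℝ) + 2 * s))
      (Metric.ball 0 1) := by
    refine integrableOn_ball_of_norm_le_rpow (C := 1) (α := N + 2 * s - 2) (by rw [hdim]; exact hN)
      (by rw [hdim]; linarith) (Eventually.of_forall fun h => ?_) hmeas.aestronglyMeasurable
    rw [Real.norm_of_nonneg (hnn h), one_mul]
    rcases eq_or_ne h 0 with rfl | hne
    · simp only [norm_zero]
      rw [Real.zero_rpow (by positivity), div_zero]
      positivity
    have hp : 0 < ‖h‖ := norm_pos_iff.2 hne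
    rw [div_le_iff₀ (by positivity), ← Real.rpow_add hp]
    have : -((N : ℝ) + 2 * s - 2) + (N + 2 * s) = (2 : ℕ) := by push_cast; ring
    rw [this, Real.rpow_natCast]
    exact min_le_left _ _
  have h2 : IntegrableOn (fun h : E N => min (‖h‖ ^ 2) 1 / ‖h‖ ^ ((N : ℝ) + 2 * s))
      (Metric.ball 0 1)ᶜ := by
    have hb := (integrable_one_add_norm (E := E N) (μ := volume) (r := N + 2 * s)
      (by rw [hdim]; linarith)).const_mul (2 ^ ((N : ℝ) + 2 * s))
    refine Integrable.mono' hb.integrableOn hmeas.aestronglyMeasurable ?_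
    refine (ae_restrict_iff' measurableSet_ball.compl).2 (Eventually.of_forall fun h hh => ?_)
    have hh1 : 1 ≤ ‖h‖ := by simpa using hh
    have hp : 0 < ‖h‖ := by linarith
    rw [Real.norm_of_nonneg (hnn h), Real.rpow_neg (by positivity), ← div_eq_mul_inv,
      ← Real.div_rpow (by positivity) (by positivity)]
    calc min (‖h‖ ^ 2) 1 / ‖h‖ ^ ((N : ℝ) + 2 * s) ≤ 1 / ‖h‖ ^ ((N : ℝ) + 2 * s) := by
          gcongr; exact min_le_right _ _
      _ = (1 / ‖h‖) ^ ((N : ℝ) + 2 * s) := by rw [Real.div_rpow zero_le_one hp.le, Real.one_rpow]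
      _ ≤ _ := by
        apply Real.rpow_le_rpow (by positivity) _ (by positivity)
        rw [div_le_div_iff₀ hp (by positivity)]
        linarith
  rw [← integrableOn_univ, ← Set.union_compl_self (Metric.ball (0 : E N) 1)]
  exact h1.union h2

/-- Smooth compactly supported functions have finite Gagliardo norm. -/
theorem gagliardoSq_lt_top_of_contDiff [hA : Admissible N s] {φ : E N → ℝ}
    (hφ : ContDiff ℝ ((⊤ : ℕ∞) : WithTop ℕ∞) φ) (hc : HasCompactSupport φ) :
    gagliardoSq s φ < ∞ := by
  have hs0 := hA.pos
  have hs1 := hA.lt_one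
  have hsN := hA.two_mul_lt
  have hN : 1 ≤ N := by
    have : (0 : ℝ) < N := by linarith
    exact_mod_cast this
  obtain ⟨L, hL⟩ := hφ.lipschitzWith_of_hasCompactSupport hc (by simp)
  obtain ⟨M, hM⟩ := hc.exists_bound_of_continuous hφ.continuous
  set K := tsupport φ with hK
  have hKc : IsCompact K := hc
  -- The Lipschitz bound serves for close points and the uniform bound for distant ones.
  set C : ℝ := (L : ℝ) ^ 2 + (2 * M) ^ 2 with hC
  set k : E N → ℝ := fun h => min (‖h‖ ^ 2) 1 / ‖h‖ ^ ((N : ℝ) + 2 * s) with hk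
  have hki : Integrable k := integrable_min_norm_sq_div hs0 hs1 hN
  have hknn : ∀ h, 0 ≤ k h := fun h => by simp only [hk]; positivity
  have hkm : Measurable k := by simp only [hk]; fun_prop
  set κ : E N → ℝ≥0∞ := fun h => ENNReal.ofReal (C * k h) with hκ
  have hκm : Measurable κ := (hkm.const_mul C).ennreal_ofReal
  have hκfin : ∫⁻ h, κ h ≠ ∞ := by
    have := (hki.const_mul C).2
    rw [hasFiniteIntegral_iff_ofReal (Eventually.of_forall fun h => mul_nonneg (by positivity) (hknn h))] at this
    exact this.ne
  have hbound : ∀ x y, |φ x - φ y| ^ 2 / ‖x - y‖ ^ ((N : ℝ) + 2 * s) ≤ C * k (x - y) := by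
    intro x y
    simp only [hk]
    rw [← mul_div_assoc]
    gcongr
    have h1 : |φ x - φ y| ^ 2 ≤ (L : ℝ) ^ 2 * ‖x - y‖ ^ 2 := by
      rw [← mul_pow]
      gcongr
      simpa [dist_eq_norm] using hL.dist_le_mul x y
    have h2 : |φ x - φ y| ^ 2 ≤ (2 * M) ^ 2 * 1 := by
      rw [mul_one]
      gcongr
      have := hM x; have := hM y
      rw [Real.norm_eq_abs] at *
      linarith [abs_sub (φ x) (φ y)]
    rcases min_cases (‖x - y‖ ^ 2) 1 with ⟨h, -⟩ | ⟨h, -⟩ <;> rw [h, hC]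
    · nlinarith [sq_nonneg (2 * M), sq_nonneg ‖x - y‖]
    · nlinarith [sq_nonneg (L : ℝ)]
  have hmeas : MeasurableSet K := hKc.isClosed.measurableSet
  -- The integrand vanishes unless one of the two points lies in the support `K`. By Tonelli each of
  -- the two summands integrates to the measure of `K` times the integral of `κ`.
  have hle : gagliardoSq s φ ≤ ∫⁻ z : E N × E N,
      (K.indicator 1 z.1 * κ (z.1 - z.2) + K.indicator 1 z.2 * κ (z.1 - z.2)) := by
    refine lintegral_mono fun z => ?_
    have hb := ENNReal.ofReal_le_ofReal (hbound z.1 z.2)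
    by_cases h1 : z.1 ∈ K
    · simp only [Set.indicator_of_mem h1, Pi.one_apply, one_mul]
      exact hb.trans le_self_add
    by_cases h2 : z.2 ∈ K
    · simp only [Set.indicator_of_mem h2, Pi.one_apply, one_mul]
      exact hb.trans le_add_self
    · have e1 : φ z.1 = 0 := image_eq_zero_of_notMem_tsupport h1
      have e2 : φ z.2 = 0 := image_eq_zero_of_notMem_tsupport h2
      simp [e1, e2]
  have hind : Measurable (K.indicator (1 : E N → ℝ≥0∞)) := measurable_one.indicator hmeas
  refine hle.trans_lt ?_
  rw [lintegral_add_left (by fun_prop)]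
  have hKfin : ∫⁻ x, K.indicator (1 : E N → ℝ≥0∞) x ≠ ∞ := by
    rw [lintegral_indicator_one hmeas]
    exact hKc.measure_lt_top.ne
  refine ENNReal.add_lt_top.2 ⟨?_, ?_⟩
  · rw [Measure.volume_eq_prod, lintegral_prod _ (by fun_prop)]
    have : ∀ x : E N, ∫⁻ y, K.indicator 1 x * κ (x - y) = K.indicator 1 x * ∫⁻ h, κ h := by
      intro x
      rw [lintegral_const_mul _ (by fun_prop), lintegral_sub_left_eq_self κ x]
    simp only [this]
    rw [lintegral_mul_const _ hind]
    exact ENNReal.mul_lt_top hKfin.lt_top hκfin.lt_top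
  · rw [Measure.volume_eq_prod, lintegral_prod_symm _ (by fun_prop)]
    have : ∀ y : E N, ∫⁻ x, K.indicator 1 y * κ (x - y) = K.indicator 1 y * ∫⁻ h, κ h := by
      intro y
      rw [lintegral_const_mul _ (by fun_prop), lintegral_sub_right_eq_self κ y]
    simp only [this]
    rw [lintegral_mul_const _ hind]
    exact ENNReal.mul_lt_top hKfin.lt_top hκfin.lt_top

end DifferenceQuotient

end FracLap

/-! ### The Hilbert space D^s as a closed subspace of L²(ℝ^{2N}). -/

namespace FracLap

section MemDs

/-- The constant of the fractional Sobolev inequality. -/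
noncomputable def sobolevBound (N : ℕ) (s : ℝ) : ℝ := sobolevConst N s ^ (critExp N s / 2)

theorem sobolevBound_pos {N : ℕ} {s : ℝ} : 0 < sobolevBound N s := by
  have := sobolevConst_pos (N := N) (s := s)
  unfold sobolevBound
  positivity

variable {N : ℕ} {s : ℝ} [hA : Admissible N s]

theorem two_lt_critExp' : 2 < critExp N s := two_lt_critExp hA.pos hA.two_mul_lt

theorem one_le_ofReal_critExp : 1 ≤ ENNReal.ofReal (critExp N s) := by
  have := two_lt_critExp' (N := N) (s := s)
  simp only [ENNReal.one_le_ofReal]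
  linarith

theorem eLpNorm_critExp_le_diffQuot {u : E N → ℝ}
    (hu : MemLp u (ENNReal.ofReal (critExp N s))) :
    eLpNorm u (ENNReal.ofReal (critExp N s)) ≤
      ENNReal.ofReal (sobolevConst N s ^ (critExp N s / 2)) * eLpNorm (diffQuot s u) 2 := by
  rw [← gagliardoSq_rpow_half]
  exact eLpNorm_critExp_le hA.pos hA.two_mul_lt hu

/-- By the Sobolev inequality, approximation in the Gagliardo norm is enough for membership in
`D^s`. -/
theorem memDs_iff {u : E N → ℝ} : MemDs s u ↔ MemLp u (ENNReal.ofReal (critExp N s)) ∧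
    ∀ ε : ℝ≥0∞, 0 < ε → ∃ φ : E N → ℝ, ContDiff ℝ ((⊤ : ℕ∞) : WithTop ℕ∞) φ ∧
      HasCompactSupport φ ∧ eLpNorm (diffQuot s (φ - u)) 2 < ε := by
  constructor
  · rintro ⟨hu, φ, hφ, -, hlim⟩
    refine ⟨hu, fun ε hε => ?_⟩
    have h1 := hlim.ennrpow_const (1 / 2 : ℝ)
    rw [ENNReal.zero_rpow_of_pos (by norm_num)] at h1
    simp only [gagliardoSq_rpow_half] at h1
    obtain ⟨n, hn⟩ := (h1.eventually_lt_const hε).exists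
    exact ⟨φ n, (hφ n).1, (hφ n).2, hn⟩
  · rintro ⟨hu, h⟩
    have h' : ∀ n : ℕ, (0 : ℝ≥0∞) < ((n : ℝ≥0∞) + 1)⁻¹ := fun n => by simp
    choose φ hφ1 hφ2 hφ3 using fun n : ℕ => h _ (h' n)
    have hlim : Tendsto (fun n : ℕ => ((n : ℝ≥0∞) + 1)⁻¹) atTop (𝓝 0) := by
      have := (tendsto_add_atTop_iff_nat 1).2 ENNReal.tendsto_inv_nat_nhds_zero
      simpa using this
    have hq : Tendsto (fun n => eLpNorm (diffQuot s (φ n - u)) 2) atTop (𝓝 0) :=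
      tendsto_of_tendsto_of_tendsto_of_le_of_le tendsto_const_nhds hlim (fun _ => zero_le)
        fun n => (hφ3 n).le
    refine ⟨hu, φ, fun n => ⟨hφ1 n, hφ2 n⟩, ?_, ?_⟩
    · have h2 : Tendsto (fun n => ENNReal.ofReal (sobolevConst N s ^ (critExp N s / 2)) *
          eLpNorm (diffQuot s (φ n - u)) 2) atTop (𝓝 0) := by
        simpa using ENNReal.Tendsto.const_mul hq (Or.inr ENNReal.ofReal_ne_top)
      refine tendsto_of_tendsto_of_tendsto_of_le_of_le tendsto_const_nhds h2 (fun _ => zero_le)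
        fun n => eLpNorm_critExp_le_diffQuot ?_
      exact ((hφ1 n).continuous.memLp_of_hasCompactSupport (hφ2 n)).sub hu
    · have h2 := ENNReal.Tendsto.pow (n := 2) hq
      simpa [eLpNorm_diffQuot_sq] using h2

/-- A function of D^s is a test function, whose norm is finite, minus an error of norm less than 1.
-/
theorem MemDs.memLp_diffQuot {u : E N → ℝ} (hu : MemDs s u) : MemLp (diffQuot s u) 2 := by
  refine ⟨aestronglyMeasurable_diffQuot hu.1.1, ?_⟩
  obtain ⟨φ, h1, h2, h3⟩ := (memDs_iff.1 hu).2 1 one_pos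
  have e : diffQuot s u = diffQuot s φ - diffQuot s (φ - u) := by
    rw [← diffQuot_sub]; congr 1; abel
  rw [e]
  refine (eLpNorm_sub_le (aestronglyMeasurable_diffQuot h1.continuous.aestronglyMeasurable)
    (aestronglyMeasurable_diffQuot (h1.continuous.aestronglyMeasurable.sub hu.1.1))
    (by norm_num)).trans_lt (ENNReal.add_lt_top.2 ⟨?_, h3.trans (by simp)⟩)
  rw [← gagliardoSq_rpow_half]
  exact ENNReal.rpow_lt_top_of_nonneg (by norm_num) (gagliardoSq_lt_top_of_contDiff h1 h2).ne

theorem MemDs.add {u v : E N → ℝ} (hu : MemDs s u) (hv : MemDs s v) : MemDs s (u + v) := by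
  have hum := hu.1.1
  have hvm := hv.1.1
  rw [memDs_iff] at hu hv ⊢
  refine ⟨hu.1.add hv.1, fun ε hε => ?_⟩
  obtain ⟨φ, h1, h2, h3⟩ := hu.2 (ε / 2) (ENNReal.half_pos hε.ne')
  obtain ⟨ψ, k1, k2, k3⟩ := hv.2 (ε / 2) (ENNReal.half_pos hε.ne')
  refine ⟨φ + ψ, h1.add k1, h2.add k2, ?_⟩
  have e : φ + ψ - (u + v) = (φ - u) + (ψ - v) := by abel
  rw [e, diffQuot_add]
  refine (eLpNorm_add_le (aestronglyMeasurable_diffQuot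
    (h1.continuous.aestronglyMeasurable.sub hum)) (aestronglyMeasurable_diffQuot
    (k1.continuous.aestronglyMeasurable.sub hvm)) (by norm_num)).trans_lt ?_
  calc _ < ε / 2 + ε / 2 := ENNReal.add_lt_add h3 k3
    _ = ε := ENNReal.add_halves ε

theorem MemDs.zero : MemDs s (0 : E N → ℝ) := by
  rw [memDs_iff]
  refine ⟨MemLp.zero, fun ε hε => ⟨0, contDiff_const, HasCompactSupport.zero, ?_⟩⟩
  rw [sub_zero, diffQuot_zero]
  simpa using hε

theorem MemDs.const_smul {u : E N → ℝ} (hu : MemDs s u) (c : ℝ) : MemDs s (c • u) := by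
  rcases eq_or_ne c 0 with rfl | hc
  · rw [zero_smul]; exact MemDs.zero
  rw [memDs_iff] at hu ⊢
  refine ⟨hu.1.const_smul c, fun ε hε => ?_⟩
  have hc' : ‖c‖ₑ ≠ 0 := by simpa using hc
  obtain ⟨φ, h1, h2, h3⟩ := hu.2 (ε / ‖c‖ₑ) (ENNReal.div_pos hε.ne' enorm_ne_top)
  refine ⟨c • φ, h1.const_smul c, h2.comp_left (g := fun t => c • t) (smul_zero c), ?_⟩
  rw [← smul_sub, diffQuot_smul, eLpNorm_const_smul, mul_comm]
  exact (ENNReal.lt_div_iff_mul_lt (Or.inl hc') (Or.inl enorm_ne_top)).1 h3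

end MemDs

section HilbertSpace

/-- The space `D^s(ℝ^N)`, realized in `L²(ℝ^N × ℝ^N)` through difference quotients. -/
noncomputable def Ds (N : ℕ) (s : ℝ) [Admissible N s] :
    Submodule ℝ (Lp ℝ 2 (volume : Measure (E N × E N))) where
  carrier := {U | ∃ u : E N → ℝ, MemDs s u ∧ U =ᵐ[volume] diffQuot s u}
  add_mem' := by
    rintro U V ⟨u, hu, hU⟩ ⟨v, hv, hV⟩
    refine ⟨u + v, hu.add hv, ?_⟩
    rw [diffQuot_add]
    exact (Lp.coeFn_add U V).trans (hU.add hV)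
  zero_mem' := ⟨0, MemDs.zero, by rw [diffQuot_zero]; exact Lp.coeFn_zero _ _ _⟩
  smul_mem' := by
    rintro c U ⟨u, hu, hU⟩
    refine ⟨c • u, hu.const_smul c, ?_⟩
    rw [diffQuot_smul]
    exact (Lp.coeFn_smul c U).trans (hU.const_smul c)

variable {N : ℕ} {s : ℝ} [hA : Admissible N s]

/-- A function representing an element of `Ds N s`. -/
noncomputable def rep (U : Ds N s) : E N → ℝ := U.2.choose

theorem memDs_rep (U : Ds N s) : MemDs s (rep U) := U.2.choose_spec.1

theorem coe_ae_eq_diffQuot_rep (U : Ds N s) :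
    (U : Lp ℝ 2 (volume : Measure (E N × E N))) =ᵐ[volume] diffQuot s (rep U) :=
  U.2.choose_spec.2

/-- The element of `Ds N s` given by a function. -/
noncomputable def toDs {u : E N → ℝ} (hu : MemDs s u) : Ds N s :=
  ⟨hu.memLp_diffQuot.toLp, u, hu, hu.memLp_diffQuot.coeFn_toLp⟩

theorem MemDs.eLpNorm_le_of_ae_eq {u : E N → ℝ} (hu : MemDs s u)
    {U : Lp ℝ 2 (volume : Measure (E N × E N))} (h : U =ᵐ[volume] diffQuot s u) :
    eLpNorm u (ENNReal.ofReal (critExp N s)) ≤ ENNReal.ofReal (sobolevBound N s * ‖U‖) := by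
  refine (eLpNorm_critExp_le_diffQuot hu.1).trans_eq ?_
  rw [← eLpNorm_congr_ae h, ENNReal.ofReal_mul sobolevBound_pos.le, Lp.norm_def,
    ENNReal.ofReal_toReal (Lp.eLpNorm_ne_top U)]
  rfl

theorem eLpNorm_rep_le (U : Ds N s) :
    eLpNorm (rep U) (ENNReal.ofReal (critExp N s)) ≤ ENNReal.ofReal (sobolevBound N s * ‖U‖) :=
  (memDs_rep U).eLpNorm_le_of_ae_eq (coe_ae_eq_diffQuot_rep U)

theorem MemDs.sub {u v : E N → ℝ} (hu : MemDs s u) (hv : MemDs s v) : MemDs s (u - v) := by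
  have := hu.add (hv.const_smul (-1))
  rwa [neg_one_smul, ← sub_eq_add_neg] at this

/-- The representative is determined almost everywhere by its difference quotient. -/
theorem ae_eq_of_diffQuot_ae_eq {u v : E N → ℝ} (hu : MemDs s u) (hv : MemDs s v)
    (h : diffQuot s u =ᵐ[volume] diffQuot s v) : u =ᵐ[volume] v := by
  have h1 := eLpNorm_critExp_le_diffQuot (hu.sub hv).1
  have h2 : eLpNorm (diffQuot s (u - v)) 2 = 0 := by
    rw [diffQuot_sub, eLpNorm_congr_ae (h.sub (EventuallyEq.refl _ _))]
    simp
  rw [h2, mul_zero, nonpos_iff_eq_zero, eLpNorm_eq_zero_iff (hu.1.1.sub hv.1.1)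
    (by have := one_le_ofReal_critExp (N := N) (s := s); positivity)] at h1
  filter_upwards [h1] with x hx
  simpa [sub_eq_zero] using hx

theorem rep_ae_eq_of {U : Ds N s} {u : E N → ℝ} (hu : MemDs s u)
    (h : (U : Lp ℝ 2 (volume : Measure (E N × E N))) =ᵐ[volume] diffQuot s u) :
    rep U =ᵐ[volume] u :=
  ae_eq_of_diffQuot_ae_eq (memDs_rep U) hu ((coe_ae_eq_diffQuot_rep U).symm.trans h)

theorem rep_toDs {u : E N → ℝ} (hu : MemDs s u) : rep (toDs hu) =ᵐ[volume] u :=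
  rep_ae_eq_of hu hu.memLp_diffQuot.coeFn_toLp

theorem rep_add (U V : Ds N s) : rep (U + V) =ᵐ[volume] rep U + rep V := by
  refine rep_ae_eq_of ((memDs_rep U).add (memDs_rep V)) ?_
  rw [diffQuot_add]
  exact (Lp.coeFn_add _ _).trans ((coe_ae_eq_diffQuot_rep U).add (coe_ae_eq_diffQuot_rep V))

theorem rep_smul (c : ℝ) (U : Ds N s) : rep (c • U) =ᵐ[volume] c • rep U := by
  refine rep_ae_eq_of ((memDs_rep U).const_smul c) ?_
  rw [diffQuot_smul]
  exact (Lp.coeFn_smul _ _).trans ((coe_ae_eq_diffQuot_rep U).const_smul c)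

theorem rep_sub (U V : Ds N s) : rep (U - V) =ᵐ[volume] rep U - rep V := by
  refine rep_ae_eq_of ((memDs_rep U).sub (memDs_rep V)) ?_
  rw [diffQuot_sub]
  exact (Lp.coeFn_sub _ _).trans ((coe_ae_eq_diffQuot_rep U).sub (coe_ae_eq_diffQuot_rep V))

theorem inner_eq_gagliardoForm {U V : Ds N s} {u v : E N → ℝ} (hu : rep U =ᵐ[volume] u)
    (hv : rep V =ᵐ[volume] v) : inner ℝ U V = gagliardoForm s u v := by
  rw [Submodule.coe_inner, L2.inner_def, gagliardoForm_eq]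
  refine integral_congr_ae ?_
  filter_upwards [(coe_ae_eq_diffQuot_rep U).trans (diffQuot_congr_ae hu),
    (coe_ae_eq_diffQuot_rep V).trans (diffQuot_congr_ae hv)] with z h1 h2
  rw [h1, h2, real_inner_eq_re_inner ℝ]
  simp [mul_comm]

theorem gagliardoSq_rep (U : Ds N s) : gagliardoSq s (rep U) = ENNReal.ofReal (‖U‖ ^ 2) := by
  have hn : ‖U‖ = ‖(U : Lp ℝ 2 (volume : Measure (E N × E N)))‖ := rfl
  rw [← eLpNorm_diffQuot_sq, ← eLpNorm_congr_ae (coe_ae_eq_diffQuot_rep U), hn,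
    Lp.norm_def, ← ENNReal.toReal_pow, ENNReal.ofReal_toReal]
  exact ENNReal.pow_ne_top (Lp.eLpNorm_ne_top _)

theorem gagliardoNorm_rep (U : Ds N s) : gagliardoNorm s (rep U) = ‖U‖ := by
  rw [gagliardoNorm, gagliardoSq_rep, ENNReal.toReal_ofReal (by positivity),
    Real.sqrt_sq (norm_nonneg _)]

theorem norm_toDs_sq {u : E N → ℝ} (hu : MemDs s u) :
    ‖toDs hu‖ ^ 2 = (gagliardoSq s u).toReal := by
  rw [← gagliardoSq_congr_ae (rep_toDs hu), gagliardoSq_rep, ENNReal.toReal_ofReal (by positivity)]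

/-- If the difference quotients converge in L², the Sobolev inequality makes the functions Cauchy in
L^{2*}. Their limit `W` has the right difference quotient, as seen by comparing almost everywhere
limits, and it inherits approximation by test functions. -/
theorem isClosed_Ds : IsClosed (Ds N s : Set (Lp ℝ 2 (volume : Measure (E N × E N)))) := by
  have hfact : Fact (1 ≤ ENNReal.ofReal (critExp N s)) := ⟨one_le_ofReal_critExp⟩
  rw [← isSeqClosed_iff_isClosed]
  intro U V hU hlim
  choose u hu hUu using hU
  set S := sobolevBound N s
  let w : ℕ → Lp ℝ (ENNReal.ofReal (critExp N s)) (volume : Measure (E N)) := fun n => (hu n).1.toLp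
  have hdist : ∀ n m, dist (w n) (w m) ≤ S * dist (U n) (U m) := by
    intro n m
    rw [dist_eq_norm, dist_eq_norm, ← MemLp.toLp_sub, Lp.norm_toLp]
    refine ENNReal.toReal_le_of_le_ofReal (mul_nonneg sobolevBound_pos.le (norm_nonneg _))
      (((hu n).sub (hu m)).eLpNorm_le_of_ae_eq ?_)
    rw [diffQuot_sub]
    exact (Lp.coeFn_sub _ _).trans ((hUu n).sub (hUu m))
  have hcau : CauchySeq w := by
    rw [Metric.cauchySeq_iff]
    intro ε hε
    obtain ⟨n₀, hn₀⟩ := Metric.cauchySeq_iff.1 hlim.cauchySeq (ε / S) (div_pos hε sobolevBound_pos)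
    refine ⟨n₀, fun m hm n hn => (hdist m n).trans_lt ?_⟩
    have := hn₀ m hm n hn
    rwa [lt_div_iff₀ sobolevBound_pos, mul_comm] at this
  obtain ⟨W, hW⟩ := cauchySeq_tendsto_of_complete hcau
  -- Two successive extractions give almost everywhere convergence of the functions and of their
  -- difference quotients along a common subsequence.
  obtain ⟨ns, hns, hae⟩ := (tendstoInMeasure_of_tendsto_Lp hW).exists_seq_tendsto_ae
  obtain ⟨ms, hms, hae'⟩ :=
    (tendstoInMeasure_of_tendsto_Lp (hlim.comp hns.tendsto_atTop)).exists_seq_tendsto_ae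
  have hVW : V =ᵐ[volume] diffQuot s (W : E N → ℝ) := by
    have hu' : ∀ᵐ x : E N, ∀ n, w n x = u n x := ae_all_iff.2 fun n => (hu n).1.coeFn_toLp
    have hU' : ∀ᵐ z : E N × E N, ∀ n, U n z = diffQuot s (u n) z := ae_all_iff.2 hUu
    have hux : ∀ᵐ x : E N, Tendsto (fun n => u (ns (ms n)) x) atTop (𝓝 (W x)) := by
      filter_upwards [hae, hu'] with x h1 h2
      simp only [h2] at h1
      exact h1.comp hms.tendsto_atTop
    filter_upwards [hU', hae', Measure.quasiMeasurePreserving_fst.ae hux,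
      Measure.quasiMeasurePreserving_snd.ae hux] with z h1 h2 h3 h4
    refine tendsto_nhds_unique h2 ?_
    simp only [Function.comp, h1, diffQuot]
    exact (h3.sub h4).div_const _
  refine ⟨W, memDs_iff.2 ⟨Lp.memLp W, fun ε hε => ?_⟩, hVW⟩
  have hε2 : 0 < ε / 2 := ENNReal.half_pos hε.ne'
  have hlim' : Tendsto (fun n => eLpNorm (U n - V : E N × E N → ℝ) 2 volume) atTop (𝓝 0) := 
    (Lp.tendsto_Lp_iff_tendsto_eLpNorm' _ _).1 hlim
  obtain ⟨n, hn⟩ := (hlim'.eventually_lt_const hε2).exists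
  obtain ⟨φ, h1, h2, h3⟩ := (memDs_iff.1 (hu n)).2 (ε / 2) hε2
  refine ⟨φ, h1, h2, ?_⟩
  have e : diffQuot s (φ - (W : E N → ℝ)) =
      diffQuot s (φ - u n) + (diffQuot s (u n) - diffQuot s W) := by
    rw [diffQuot_sub, diffQuot_sub]; abel
  rw [e]
  have h4 : eLpNorm (diffQuot s (u n) - diffQuot s W) 2 < ε / 2 := by
    rwa [eLpNorm_congr_ae ((hUu n).sub hVW)] at hn
  refine (eLpNorm_add_le (aestronglyMeasurable_diffQuot
    (h1.continuous.aestronglyMeasurable.sub (hu n).1.1)) ((aestronglyMeasurable_diffQuot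
    (hu n).1.1).sub (aestronglyMeasurable_diffQuot (Lp.aestronglyMeasurable W))) (by norm_num)).trans_lt ?_
  calc _ < ε / 2 + ε / 2 := ENNReal.add_lt_add h3 h4
    _ = ε := ENNReal.add_halves ε

instance : CompleteSpace (Ds N s) := isClosed_Ds.completeSpace_coe

/-- Separability is what permits the extraction of weakly convergent subsequences from bounded
sequences. -/
instance : SecondCountableTopology (Ds N s) := by
  have : Fact ((2 : ℝ≥0∞) ≠ ∞) := ⟨by norm_num⟩
  have : SFinite (volume : Measure (E N × E N)) := by
    rw [Measure.volume_eq_prod]; infer_instance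
  have : SecondCountableTopology (Lp ℝ 2 (volume : Measure (E N × E N))) := inferInstance
  exact TopologicalSpace.Subtype.secondCountableTopology _

end HilbertSpace

end FracLap

/-! ### Duality: weak compactness and Riesz representatives. -/

/-- Hölder's inequality for the Bochner integral, with `eLpNorm`s. -/
theorem MeasureTheory.integral_abs_mul_le_toReal_eLpNorm {α : Type*} [MeasurableSpace α]
    {μ : Measure α} {p q : ℝ≥0∞} [p.HolderConjugate q] {φ w : α → ℝ} (hφ : MemLp φ p μ)
    (hw : MemLp w q μ) :
    ∫ x, |φ x * w x| ∂μ ≤ (eLpNorm φ p μ).toReal * (eLpNorm w q μ).toReal := by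
  have h := eLpNorm_smul_le_mul_eLpNorm (r := 1) hw.1 hφ.1 (p := p) (q := q)
  rw [eLpNorm_one_eq_lintegral_enorm] at h
  rw [← ENNReal.toReal_mul]
  simp only [← Real.norm_eq_abs]
  rw [integral_norm_eq_lintegral_enorm (f := fun x => φ x * w x) (hφ.1.mul hw.1)]
  exact ENNReal.toReal_mono (ENNReal.mul_ne_top hφ.2.ne hw.2.ne) h

/-- Bounded sequences in a separable Hilbert space have weakly convergent subsequences. -/
theorem exists_subseq_weakly_tendsto {H : Type*} [NormedAddCommGroup H] [InnerProductSpace ℝ H]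
    [CompleteSpace H] [TopologicalSpace.SeparableSpace H] {u : ℕ → H} {R : ℝ}
    (hu : ∀ n, ‖u n‖ ≤ R) : ∃ (v : H) (ns : ℕ → ℕ), ‖v‖ ≤ R ∧ StrictMono ns ∧
      ∀ w, Tendsto (fun n => inner ℝ (u (ns n)) w) atTop (𝓝 (inner ℝ v w)) := by
  -- Sequential Banach–Alaoglu in the dual, transported through the Riesz isomorphism.
  obtain ⟨L, hLR, ns, hns, hL⟩ := (WeakDual.isSeqCompact_closedBall ℝ H 0 R).subseq_of_frequently_in
    (x := fun n => StrongDual.toWeakDual (InnerProductSpace.toDual ℝ H (u n)))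
    (Frequently.of_forall fun n => by simpa using hu n)
  refine ⟨(InnerProductSpace.toDual ℝ H).symm (WeakDual.toStrongDual L), ns, ?_, hns, fun w => ?_⟩
  · simpa using hLR
  rw [InnerProductSpace.toDual_symm_apply]
  have := ((WeakDual.eval_continuous w).tendsto L).comp hL
  simpa [Function.comp_def] using this

namespace FracLap

/-- The exponent conjugate to `2_s^*`. -/
noncomputable def critConj (N : ℕ) (s : ℝ) : ℝ := critExp N s / (critExp N s - 1)

section Pairing

variable {N : ℕ} {s : ℝ} [hA : Admissible N s]

theorem holderConjugate_critExp : (critExp N s).HolderConjugate (critConj N s) :=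
  Real.HolderConjugate.conjExponent (by have := two_lt_critExp' (N := N) (s := s); linarith)

instance instHolderConjugateCrit : (ENNReal.ofReal (critConj N s)).HolderConjugate
    (ENNReal.ofReal (critExp N s)) := holderConjugate_critExp.symm.ennrealOfReal

theorem toReal_eLpNorm_rep_le (U : Ds N s) :
    (eLpNorm (rep U) (ENNReal.ofReal (critExp N s))).toReal ≤ sobolevBound N s * ‖U‖ :=
  ENNReal.toReal_le_of_le_ofReal (mul_nonneg sobolevBound_pos.le (norm_nonneg _)) (eLpNorm_rep_le U)

theorem integrable_mul_rep {φ : E N → ℝ} (hφ : MemLp φ (ENNReal.ofReal (critConj N s)))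
    (U : Ds N s) : Integrable (fun x => φ x * rep U x) :=
  hφ.integrable_mul (memDs_rep U).1

theorem integral_abs_mul_rep_le {φ : E N → ℝ} (hφ : MemLp φ (ENNReal.ofReal (critConj N s)))
    (U : Ds N s) : ∫ x, |φ x * rep U x| ≤
      (eLpNorm φ (ENNReal.ofReal (critConj N s))).toReal * (sobolevBound N s * ‖U‖) := by
  refine (integral_abs_mul_le_toReal_eLpNorm hφ (memDs_rep U).1).trans ?_
  gcongr
  exact toReal_eLpNorm_rep_le U

theorem integral_mul_rep_add {φ : E N → ℝ} (hφ : MemLp φ (ENNReal.ofReal (critConj N s)))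
    (U V : Ds N s) :
    ∫ x, φ x * rep (U + V) x = (∫ x, φ x * rep U x) + ∫ x, φ x * rep V x := by
  rw [← integral_add (integrable_mul_rep hφ U) (integrable_mul_rep hφ V)]
  refine integral_congr_ae ?_
  filter_upwards [rep_add U V] with x hx
  rw [hx, Pi.add_apply, mul_add]

theorem integral_mul_rep_smul (φ : E N → ℝ) (c : ℝ) (U : Ds N s) :
    ∫ x, φ x * rep (c • U) x = c * ∫ x, φ x * rep U x := by
  rw [← integral_const_mul]
  refine integral_congr_ae ?_
  filter_upwards [rep_smul c U] with x hx
  rw [hx, Pi.smul_apply, smul_eq_mul]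
  ring

/-- The functional `u ↦ ∫ φ u` on `D^s`. -/
noncomputable def pairing {φ : E N → ℝ} (hφ : MemLp φ (ENNReal.ofReal (critConj N s))) :
    Ds N s →L[ℝ] ℝ :=
  LinearMap.mkContinuous
    (IsLinearMap.mk' (fun U : Ds N s => ∫ x, φ x * rep U x)
      ⟨integral_mul_rep_add hφ, integral_mul_rep_smul φ⟩)
    ((eLpNorm φ (ENNReal.ofReal (critConj N s))).toReal * sobolevBound N s) fun U => by
      rw [mul_assoc]
      exact (norm_integral_le_integral_norm _).trans (integral_abs_mul_rep_le hφ U)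

/-- The Riesz representative of `u ↦ ∫ φ u` in `D^s`. -/
noncomputable def riesz {φ : E N → ℝ} (hφ : MemLp φ (ENNReal.ofReal (critConj N s))) : Ds N s :=
  (InnerProductSpace.toDual ℝ (Ds N s)).symm (pairing hφ)

theorem inner_riesz {φ : E N → ℝ} (hφ : MemLp φ (ENNReal.ofReal (critConj N s))) (U : Ds N s) :
    inner ℝ (riesz hφ) U = ∫ x, φ x * rep U x := by
  rw [riesz, InnerProductSpace.toDual_symm_apply]
  rfl

/-- Testing the difference of the two representatives against itself and applying Hölder and
Sobolev. The estimate transfers continuity of u ↦ f(·,u) into the dual Lebesgue space to continuity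
of the energy gradient. -/
theorem norm_riesz_sub_le {φ ψ : E N → ℝ} (hφ : MemLp φ (ENNReal.ofReal (critConj N s)))
    (hψ : MemLp ψ (ENNReal.ofReal (critConj N s))) :
    ‖riesz hφ - riesz hψ‖ ≤
      sobolevBound N s * (eLpNorm (φ - ψ) (ENNReal.ofReal (critConj N s))).toReal := by
  set U := riesz hφ - riesz hψ with hU
  have h1 : ‖U‖ ^ 2 ≤ (eLpNorm (φ - ψ) (ENNReal.ofReal (critConj N s))).toReal *
      (sobolevBound N s * ‖U‖) := by
    refine le_trans ?_ (integral_abs_mul_rep_le (hφ.sub hψ) U)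
    rw [← real_inner_self_eq_norm_sq]
    nth_rw 1 [hU]
    rw [inner_sub_left, inner_riesz, inner_riesz, ← integral_sub (integrable_mul_rep hφ U)
      (integrable_mul_rep hψ U)]
    simp only [Pi.sub_apply, sub_mul]
    exact (le_abs_self _).trans (abs_integral_le_integral_abs)
  rcases (norm_nonneg U).eq_or_lt with h0 | h0
  · rw [← h0]
    exact mul_nonneg sobolevBound_pos.le ENNReal.toReal_nonneg
  · have h2 : ‖U‖ * ‖U‖ ≤ (sobolevBound N s *
      (eLpNorm (φ - ψ) (ENNReal.ofReal (critConj N s))).toReal) * ‖U‖ := by nlinarith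
    exact le_of_mul_le_mul_right h2 h0

end Pairing

/-! ### Almost everywhere convergence from weak convergence, by averaging. -/

section Compactness

variable {N : ℕ} {s : ℝ} [hA : Admissible N s]

/-- Averages over balls of fixed radius. -/
noncomputable def ballAverage (r : ℝ) (u : E N → ℝ) (x : E N) : ℝ := ⨍ y in Metric.ball x r, u y

/-- Balls of a fixed radius all have the same volume, so the average is a parameter integral of a
jointly measurable function. -/
theorem aestronglyMeasurable_ballAverage (r : ℝ) {u : E N → ℝ} (hu : AEStronglyMeasurable u) :
    AEStronglyMeasurable (ballAverage r u) := by
  have hset : MeasurableSet {z : E N × E N | dist z.2 z.1 < r} :=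
    (isOpen_lt (by fun_prop) (by fun_prop)).measurableSet
  have h1 : AEStronglyMeasurable ({z : E N × E N | dist z.2 z.1 < r}.indicator
      (fun z => u z.2)) ((volume : Measure (E N)).prod volume) :=
    (hu.comp_quasiMeasurePreserving Measure.quasiMeasurePreserving_snd).indicator hset
  have h2 := h1.integral_prod_right'
  have h3 : ballAverage r u = fun x => (volume.real (Metric.ball (0 : E N) r))⁻¹ *
      ∫ y, {z : E N × E N | dist z.2 z.1 < r}.indicator (fun z => u z.2) (x, y) := by
    ext x
    rw [ballAverage, setAverage_eq, smul_eq_mul, ← integral_indicator measurableSet_ball]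
    congr 2
    rw [Measure.real, Measure.real, Measure.addHaar_ball_center]
  rw [h3]
  exact h2.const_mul _

/-- Integration over a ball is a continuous functional on D^s: it pairs with the indicator, which
lies in the dual exponent. -/
theorem tendsto_ballAverage_of_weakly_tendsto {W : ℕ → Ds N s}
    (hW : ∀ V, Tendsto (fun n => inner ℝ (W n) V) atTop (𝓝 0)) (r : ℝ) (x : E N) :
    Tendsto (fun n => ballAverage r (rep (W n)) x) atTop (𝓝 0) := by
  have hφ : MemLp ((Metric.ball x r).indicator fun _ => (1 : ℝ)) (ENNReal.ofReal (critConj N s)) :=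
    memLp_indicator_const _ measurableSet_ball _ (Or.inr measure_ball_lt_top.ne)
  have h1 := hW (riesz hφ)
  simp only [real_inner_comm (riesz hφ), inner_riesz] at h1
  have h2 : ∀ n, ∫ y, (Metric.ball x r).indicator (fun _ => (1 : ℝ)) y * rep (W n) y =
      ∫ y in Metric.ball x r, rep (W n) y := by
    intro n
    rw [← integral_indicator measurableSet_ball]
    congr 1
    ext y
    by_cases hy : y ∈ Metric.ball x r <;> simp [hy]
  simp only [h2] at h1
  have h3 := h1.const_mul (volume.real (Metric.ball x r))⁻¹
  simpa [ballAverage, setAverage_eq] using h3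

/-- A positive weight, bounded by `1` and integrable. -/
noncomputable def decayWeight (x : E N) : ℝ := (1 + ‖x‖) ^ (-((N : ℝ) + 1))

theorem decayWeight_pos (x : E N) : 0 < decayWeight x := by
  unfold decayWeight; positivity

theorem decayWeight_le_one (x : E N) : decayWeight x ≤ 1 := by
  refine Real.rpow_le_one_of_one_le_of_nonpos (by linarith [norm_nonneg x]) ?_
  have : (0 : ℝ) ≤ N := by positivity
  linarith

theorem measurable_decayWeight : Measurable (decayWeight (N := N)) := by
  unfold decayWeight; fun_prop

theorem integrable_decayWeight : Integrable (decayWeight (N := N)) :=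
  integrable_one_add_norm (by rw [finrank_euclideanSpace_fin]; linarith)

theorem two_mul_ofReal (a : ℝ) : 2 * ENNReal.ofReal a = ENNReal.ofReal (2 * a) := by
  rw [ENNReal.ofReal_mul zero_le_two, ENNReal.ofReal_ofNat]

/-- Writing w as its deviation from the ball average plus the average, the deviation is small with
r, uniformly on bounded sets, and the average is handled by weak convergence for fixed r. The weight
makes the bounded averages square integrable over the whole space; being at most 1, it dominates its
own square. -/
theorem lintegral_weighted_sq_le (W : Ds N s) {r : ℝ} (hr : 0 < r) :
    ∫⁻ x, ‖decayWeight x * rep W x‖ₑ ^ 2 ≤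
      ENNReal.ofReal (2 * ((unitBallVolume N)⁻¹ * r ^ (2 * s)) * ‖W‖ ^ 2) +
      2 * ∫⁻ x, ENNReal.ofReal (decayWeight x * (ballAverage r (rep W) x) ^ 2) := by
  have hc := unitBallVolume_pos (N := N)
  set w := rep W with hw
  have hwL := (memDs_rep W).1
  have hp := two_lt_critExp' (N := N) (s := s)
  have hpt : ∀ x, ‖decayWeight x * w x‖ₑ ^ 2 ≤
      2 * (ENNReal.ofReal ((unitBallVolume N)⁻¹ * r ^ (2 * s)) * gagliardoDensity s w x) +
      2 * ENNReal.ofReal (decayWeight x * (ballAverage r w x) ^ 2) := by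
    intro x
    have h1 := enorm_sub_average_sq_le hA.pos hwL.1.aemeasurable x hr
      (MemLp.integrableOn_ball (by linarith) hwL x r)
    refine le_trans ?_ (add_le_add_left (mul_le_mul_right h1 2) _)
    rw [Real.enorm_eq_ofReal_abs, Real.enorm_eq_ofReal_abs, ← ENNReal.ofReal_pow (abs_nonneg _),
      ← ENNReal.ofReal_pow (abs_nonneg _), two_mul_ofReal, two_mul_ofReal, ← ENNReal.ofReal_add (by positivity)
        (by have := decayWeight_pos x; positivity)]
    apply ENNReal.ofReal_le_ofReal
    rw [sq_abs, sq_abs, mul_pow]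
    change _ ≤ 2 * (w x - ballAverage r w x) ^ 2 + _
    have hd0 := decayWeight_pos x
    have hd1 := decayWeight_le_one x
    set d := decayWeight x
    set a := ballAverage r w x
    have h3 : w x ^ 2 ≤ 2 * (w x - a) ^ 2 + 2 * a ^ 2 := by nlinarith [sq_nonneg (w x - 2 * a)]
    have h4 : d ^ 2 ≤ d := by nlinarith
    calc d ^ 2 * w x ^ 2 ≤ d * (2 * (w x - a) ^ 2 + 2 * a ^ 2) := by gcongr
      _ ≤ _ := by nlinarith [sq_nonneg (w x - a)]
  refine (lintegral_mono hpt).trans ?_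
  have hDm := aemeasurable_gagliardoDensity hwL.1.aemeasurable s
  rw [lintegral_add_left' ((hDm.const_mul _).const_mul _), lintegral_const_mul'' _ (hDm.const_mul _),
    lintegral_const_mul'' _ hDm, ← gagliardoSq_eq_lintegral_density hwL.1.aemeasurable,
    gagliardoSq_rep, lintegral_const_mul' _ _ (by norm_num)]
  gcongr
  rw [← ENNReal.ofReal_mul (by positivity), two_mul_ofReal]
  apply le_of_eq
  congr 1
  ring

theorem tendsto_lintegral_ballAverage {W : ℕ → Ds N s} {R : ℝ} (hR : ∀ n, ‖W n‖ ≤ R)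
    (hW : ∀ V, Tendsto (fun n => inner ℝ (W n) V) atTop (𝓝 0)) {r : ℝ} (hr : 0 < r) :
    Tendsto (fun n => ∫⁻ x, ENNReal.ofReal (decayWeight x * (ballAverage r (rep (W n)) x) ^ 2))
      atTop (𝓝 0) := by
  have hc := unitBallVolume_pos (N := N)
  have hp := two_lt_critExp' (N := N) (s := s)
  set K : ℝ := (r ^ N * unitBallVolume N) ^ (-(1 / critExp N s)) * (sobolevBound N s * R)
  have hb : ∀ n x, |ballAverage r (rep (W n)) x| ≤ K := by
    intro n x
    refine (abs_average_le (by linarith) (memDs_rep (W n)).1 x hr).trans ?_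
    have h1 := toReal_eLpNorm_rep_le (W n)
    have h2 : sobolevBound N s * ‖W n‖ ≤ sobolevBound N s * R :=
      mul_le_mul_of_nonneg_left (hR n) sobolevBound_pos.le
    exact mul_le_mul_of_nonneg_left (h1.trans h2) (by positivity)
  have h0 : ∫⁻ x : E N, (0 : ℝ≥0∞) = 0 := lintegral_zero
  rw [← h0]
  refine tendsto_lintegral_of_dominated_convergence'
    (fun x => ENNReal.ofReal (decayWeight x * K ^ 2)) (fun n => ?_) (fun n => ?_) ?_ ?_
  · exact (measurable_decayWeight.aemeasurable.mul
      ((aestronglyMeasurable_ballAverage r (memDs_rep (W n)).1.1).aemeasurable.pow_const 2)).ennreal_ofReal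
  · refine Eventually.of_forall fun x => ENNReal.ofReal_le_ofReal ?_
    have := decayWeight_pos x
    refine mul_le_mul_of_nonneg_left ?_ this.le
    rw [← sq_abs]
    gcongr
    exact hb n x
  · have := (integrable_decayWeight (N := N)).mul_const (K ^ 2)
    have h2 := this.2
    rw [hasFiniteIntegral_iff_ofReal (Eventually.of_forall fun x =>
      mul_nonneg (decayWeight_pos x).le (sq_nonneg K))] at h2
    exact h2.ne
  · refine Eventually.of_forall fun x => ?_
    have h1 := ((tendsto_ballAverage_of_weakly_tendsto hW r x).pow 2).const_mul (decayWeight x)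
    have h2 := ENNReal.tendsto_ofReal h1
    simpa using h2

/-- Weak convergence in `D^s` implies almost everywhere convergence of a subsequence. -/
theorem exists_subseq_ae_tendsto_zero {W : ℕ → Ds N s} {R : ℝ} (hR : ∀ n, ‖W n‖ ≤ R)
    (hW : ∀ V, Tendsto (fun n => inner ℝ (W n) V) atTop (𝓝 0)) :
    ∃ ns : ℕ → ℕ, StrictMono ns ∧
      ∀ᵐ x, Tendsto (fun n => rep (W (ns n)) x) atTop (𝓝 0) := by
  have hc := unitBallVolume_pos (N := N)
  have hs := hA.pos
  have hlim : Tendsto (fun n => ∫⁻ x, ‖decayWeight x * rep (W n) x‖ₑ ^ 2) atTop (𝓝 0) := by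
    rw [ENNReal.tendsto_nhds_zero]
    intro ε hε
    have hr : Tendsto (fun r : ℝ => ENNReal.ofReal
        (2 * ((unitBallVolume N)⁻¹ * r ^ (2 * s)) * R ^ 2)) (𝓝[>] 0) (𝓝 0) := by
      have h1 : Tendsto (fun r : ℝ => r ^ (2 * s)) (𝓝[>] 0) (𝓝 0) := by
        have := (Real.continuousAt_rpow_const 0 (2 * s) (Or.inr (by positivity))).tendsto
        rw [Real.zero_rpow (by positivity)] at this
        exact this.mono_left nhdsWithin_le_nhds
      have h2 := ((h1.const_mul (unitBallVolume N)⁻¹).const_mul 2).mul_const (R ^ 2)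
      simpa using ENNReal.tendsto_ofReal h2
    -- The radius is fixed before n: the deviation term is small for all n at once, and only then
    -- are the averages sent to zero.
    obtain ⟨r, hr1, hr0⟩ := ((hr.eventually_le_const (ENNReal.half_pos hε.ne')).and
      eventually_mem_nhdsWithin).exists
    have h3 : Tendsto (fun n => 2 * ∫⁻ x, ENNReal.ofReal
        (decayWeight x * (ballAverage r (rep (W n)) x) ^ 2)) atTop (𝓝 0) := by
      simpa using ENNReal.Tendsto.const_mul (tendsto_lintegral_ballAverage hR hW hr0)
        (Or.inr (by norm_num : (2 : ℝ≥0∞) ≠ ∞))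
    filter_upwards [h3.eventually_le_const (ENNReal.half_pos hε.ne')] with n hn
    refine (lintegral_weighted_sq_le (W n) hr0).trans ?_
    rw [← ENNReal.add_halves ε]
    refine add_le_add (le_trans (ENNReal.ofReal_le_ofReal ?_) hr1) hn
    have : 0 < r := hr0
    have := hR n
    gcongr
  have hmeas : ∀ n, AEStronglyMeasurable (fun x => decayWeight x * rep (W n) x) := fun n =>
    measurable_decayWeight.aestronglyMeasurable.mul (memDs_rep (W n)).1.1
  have hL2 : Tendsto (fun n => eLpNorm ((fun x => decayWeight x * rep (W n) x) - 0) 2 volume)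
      atTop (𝓝 0) := by
    have h1 := hlim.ennrpow_const (1 / 2 : ℝ)
    rw [ENNReal.zero_rpow_of_pos (by norm_num)] at h1
    refine h1.congr fun n => ?_
    rw [sub_zero, eLpNorm_eq_lintegral_rpow_enorm_toReal (by norm_num) (by norm_num)]
    simp
  obtain ⟨ns, hns, hae⟩ := (tendstoInMeasure_of_tendsto_eLpNorm (by norm_num) hmeas
    aestronglyMeasurable_zero hL2).exists_seq_tendsto_ae
  refine ⟨ns, hns, hae.mono fun x hx => ?_⟩
  have h1 := hx.const_mul (decayWeight x)⁻¹
  simpa [(decayWeight_pos x).ne'] using h1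

end Compactness

end FracLap

/-! ### Convergence lemmas in Lebesgue spaces. -/

theorem Real.add_rpow_le_two_rpow_mul {x y e : ℝ} (hx : 0 ≤ x) (hy : 0 ≤ y) (he : 0 ≤ e) :
    (x + y) ^ e ≤ 2 ^ e * (x ^ e + y ^ e) := by
  have hx' := Real.rpow_nonneg hx e
  have hy' := Real.rpow_nonneg hy e
  have h1 : (x + y) ^ e ≤ (2 * max x y) ^ e := by
    apply Real.rpow_le_rpow (by positivity) _ he
    linarith [le_max_left x y, le_max_right x y]
  rw [Real.mul_rpow (by norm_num) (le_max_of_le_left hx)] at h1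
  refine h1.trans (mul_le_mul_of_nonneg_left ?_ (by positivity))
  rcases max_cases x y with ⟨h, -⟩ | ⟨h, -⟩ <;> rw [h] <;> linarith

/-- Dominated convergence in `L^p`, for the limit zero. -/
theorem MeasureTheory.tendsto_eLpNorm_zero_of_dominated {α : Type*} [MeasurableSpace α]
    {μ : Measure α} {p : ℝ≥0∞} (hp0 : p ≠ 0) (hpt : p ≠ ∞) {v : ℕ → α → ℝ} {B : α → ℝ}
    (hv : ∀ n, AEStronglyMeasurable (v n) μ) (hB : MemLp B p μ)
    (hle : ∀ n, ∀ᵐ x ∂μ, |v n x| ≤ B x)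
    (hlim : ∀ᵐ x ∂μ, Tendsto (fun n => v n x) atTop (𝓝 0)) :
    Tendsto (fun n => eLpNorm (v n) p μ) atTop (𝓝 0) := by
  have hp : 0 < p.toReal := ENNReal.toReal_pos hp0 hpt
  have h1 : Tendsto (fun n => ∫⁻ x, ‖v n x‖ₑ ^ p.toReal ∂μ) atTop (𝓝 (∫⁻ _, 0 ∂μ)) := by
    refine tendsto_lintegral_of_dominated_convergence' (fun x => ‖B x‖ₑ ^ p.toReal)
      (fun n => (hv n).enorm.pow_const _) (fun n => ?_) ?_ ?_
    · filter_upwards [hle n] with x hx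
      gcongr
      rw [Real.enorm_eq_ofReal_abs, Real.enorm_eq_ofReal_abs]
      exact ENNReal.ofReal_le_ofReal (hx.trans (le_abs_self _))
    · exact (lintegral_rpow_enorm_lt_top_of_eLpNorm_lt_top hp0 hpt hB.2).ne
    · filter_upwards [hlim] with x hx
      have := (hx.enorm).ennrpow_const p.toReal
      simpa [ENNReal.zero_rpow_of_pos hp] using this
  rw [lintegral_zero] at h1
  have h2 := h1.ennrpow_const (1 / p.toReal)
  rw [ENNReal.zero_rpow_of_pos (by positivity)] at h2
  refine h2.congr fun n => ?_
  rw [eLpNorm_eq_lintegral_rpow_enorm_toReal hp0 hpt]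

theorem MeasureTheory.MemLp.integral_abs_rpow {α : Type*} [MeasurableSpace α]
    {μ : Measure α} {p : ℝ} (hp : 0 < p) {u : α → ℝ} (hu : MemLp u (ENNReal.ofReal p) μ) :
    ∫ x, |u x| ^ p ∂μ = (eLpNorm u (ENNReal.ofReal p) μ).toReal ^ p := by
  have h := hu.eLpNorm_eq_integral_rpow_norm (by simpa using hp) ENNReal.ofReal_ne_top
  rw [ENNReal.toReal_ofReal hp.le] at h
  have hnn : 0 ≤ ∫ x, ‖u x‖ ^ p ∂μ := integral_nonneg fun x => by positivity
  rw [h, ENNReal.toReal_ofReal (by positivity), ← Real.rpow_mul hnn, inv_mul_cancel₀ hp.ne',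
    Real.rpow_one]
  rfl

theorem MeasureTheory.MemLp.integrable_abs_rpow {α : Type*} [MeasurableSpace α]
    {μ : Measure α} {p : ℝ} (hp : 0 < p) {u : α → ℝ} (hu : MemLp u (ENNReal.ofReal p) μ) :
    Integrable (fun x => |u x| ^ p) μ := by
  have := hu.integrable_norm_rpow (by simpa using hp) ENNReal.ofReal_ne_top
  rwa [ENNReal.toReal_ofReal hp.le] at this

/-- A sequence bounded in `L^p` which tends to zero almost everywhere tends to zero weakly, even
after taking absolute values. -/
theorem MeasureTheory.tendsto_integral_mul_abs_zero {α : Type*} [MeasurableSpace α]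
    {μ : Measure α} {p q : ℝ} (hpq : p.HolderConjugate q) {w : ℕ → α → ℝ} {φ : α → ℝ} {B : ℝ}
    (hφ : MemLp φ (ENNReal.ofReal q) μ) (hw : ∀ n, MemLp (w n) (ENNReal.ofReal p) μ)
    (hB : ∀ n, ∫ x, |w n x| ^ p ∂μ ≤ B)
    (hlim : ∀ᵐ x ∂μ, Tendsto (fun n => w n x) atTop (𝓝 0)) :
    Tendsto (fun n => ∫ x, |φ x| * |w n x| ∂μ) atTop (𝓝 0) := by
  have hp := hpq.pos
  have hq := hpq.symm.pos
  have : (ENNReal.ofReal q).HolderConjugate (ENNReal.ofReal p) := hpq.symm.ennrealOfReal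
  have hB0 : 0 ≤ B := (integral_nonneg fun x => by positivity).trans (hB 0)
  have hint : ∀ n, Integrable (fun x => |φ x| * |w n x|) μ := fun n =>
    hφ.abs.integrable_mul (hw n).abs
  have hintp := fun n => (hw n).integrable_abs_rpow hp
  have hintq := hφ.integrable_abs_rpow hq
  -- The `w n` need have no common dominating function. After subtracting η|w|^p, however, Young's
  -- inequality bounds the positive part by a multiple of |φ|^q independent of n, so dominated
  -- convergence applies; the subtracted part contributes at most ηB.
  have key : ∀ η : ℝ, 0 < η → Tendsto
      (fun n => ∫ x, max (|φ x| * |w n x| - η * |w n x| ^ p) 0 ∂μ) atTop (𝓝 0) := by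
    intro η hη
    suffices h : Tendsto (fun n => ∫ x, max (|φ x| * |w n x| - η * |w n x| ^ p) 0 ∂μ) atTop
        (𝓝 (∫ _, (0 : ℝ) ∂μ)) by simpa only [integral_zero] using h
    refine tendsto_integral_of_dominated_convergence
      (fun x => (η ^ (-(1 / p))) ^ q * |φ x| ^ q) (fun n => ?_) (hintq.const_mul _)
      (fun n => Eventually.of_forall fun x => ?_) ?_
    · exact ((hint n).sub ((hintp n).const_mul η)).1.sup aestronglyMeasurable_const
    · rw [Real.norm_of_nonneg (le_max_right _ _)]
      refine max_le ?_ (by positivity)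
      have hy := Real.young_inequality_of_nonneg (a := η ^ (1 / p) * |w n x|)
        (b := η ^ (-(1 / p)) * |φ x|) (by positivity) (by positivity) hpq
      rw [Real.mul_rpow (by positivity) (abs_nonneg _), Real.mul_rpow (by positivity) (abs_nonneg _),
        ← Real.rpow_mul hη.le (1 / p) p, one_div_mul_cancel hp.ne', Real.rpow_one,
        Real.rpow_neg hη.le] at hy
      have e : η ^ (1 / p) * |w n x| * ((η ^ (1 / p))⁻¹ * |φ x|) = |φ x| * |w n x| := by
        have : 0 < η ^ (1 / p) := by positivity
        field_simp
      rw [e] at hy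
      have h1 : η * |w n x| ^ p / p ≤ η * |w n x| ^ p := div_le_self (by positivity) hpq.lt.le
      rw [Real.rpow_neg hη.le]
      have h2 : ((η ^ (1 / p))⁻¹) ^ q * |φ x| ^ q / q ≤ ((η ^ (1 / p))⁻¹) ^ q * |φ x| ^ q :=
        div_le_self (by positivity) hpq.symm.lt.le
      linarith
    · filter_upwards [hlim] with x hx
      have h1 : Tendsto (fun n => |w n x|) atTop (𝓝 0) := by simpa using hx.abs
      have h2 : Tendsto (fun n => |w n x| ^ p) atTop (𝓝 0) := by
        simpa [Real.zero_rpow hp.ne'] using h1.rpow_const (p := p) (Or.inr hp.le)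
      have h3 := ((h1.const_mul |φ x|).sub (h2.const_mul η)).max (tendsto_const_nhds (x := (0 : ℝ)))
      simpa using h3
  rw [Metric.tendsto_atTop]
  intro ε hε
  have hη : 0 < ε / (2 * (B + 1)) := by positivity
  obtain ⟨n₀, hn₀⟩ := Metric.tendsto_atTop.1 (key _ hη) (ε / 2) (by positivity)
  refine ⟨n₀, fun n hn => ?_⟩
  have h1 := hn₀ n hn
  set η := ε / (2 * (B + 1)) with hηdef
  rw [Real.dist_eq, sub_zero, abs_of_nonneg (integral_nonneg fun x => le_max_right _ _)] at h1
  rw [Real.dist_eq, sub_zero, abs_of_nonneg (integral_nonneg fun x => by positivity)]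
  have hmax : Integrable (fun x => max (|φ x| * |w n x| - η * |w n x| ^ p) 0) μ :=
    ((hint n).sub ((hintp n).const_mul η)).sup (integrable_zero _ _ _)
  calc ∫ x, |φ x| * |w n x| ∂μ
      ≤ ∫ x, (max (|φ x| * |w n x| - η * |w n x| ^ p) 0 + η * |w n x| ^ p) ∂μ := by
        refine integral_mono (hint n) (hmax.add ((hintp n).const_mul η)) fun x => ?_
        have := le_max_left (|φ x| * |w n x| - η * |w n x| ^ p) 0
        simp only
        linarith
    _ = (∫ x, max (|φ x| * |w n x| - η * |w n x| ^ p) 0 ∂μ) + η * ∫ x, |w n x| ^ p ∂μ := by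
        rw [integral_add hmax ((hintp n).const_mul η), integral_const_mul]
    _ < ε / 2 + ε / 2 := by
        refine add_lt_add_of_lt_of_le h1 ?_
        calc η * ∫ x, |w n x| ^ p ∂μ ≤ η * (B + 1) := by gcongr; linarith [hB n]
          _ = ε / 2 := by rw [hηdef]; field_simp
    _ = ε := by ring

/-! ### Carathéodory functions and their primitives. -/

namespace FracLap

section Caratheodory

variable {N : ℕ}

/-- Continuity in t reduces measurability to rational t, so one null set accounts for all
exceptions; setting the function to 0 there makes it regular everywhere. Joint measurability, and
hence measurability of compositions and primitives, follows. -/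
theorem Caratheodory.exists_regular {f : E N → ℝ → ℝ} (hf : Caratheodory f) :
    ∃ f' : E N → ℝ → ℝ, (∀ x, Continuous (f' x)) ∧ (∀ t, Measurable fun x => f' x t) ∧
      ∀ᵐ x, f x = f' x := by
  obtain ⟨hm, hc⟩ := hf
  have hae : ∀ᵐ x : E N, Continuous (f x) ∧ ∀ q : ℚ, f x q = (hm q).mk _ x :=
    hc.and (ae_all_iff.2 fun q => (hm q).ae_eq_mk)
  obtain ⟨A, hAs, hAm, hA0⟩ := exists_measurable_superset_of_null (ae_iff.1 hae)
  have hmem : ∀ x ∈ Aᶜ, Continuous (f x) ∧ ∀ q : ℚ, f x q = (hm q).mk _ x := by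
    intro x hx
    by_contra h
    exact hx (hAs h)
  have hcont : ∀ x, Continuous fun t => Aᶜ.indicator (fun x => f x t) x := by
    intro x
    by_cases hx : x ∈ Aᶜ
    · simpa [Set.indicator_of_mem hx] using (hmem x hx).1
    · simpa [Set.indicator_of_notMem hx] using continuous_const
  have hrat : ∀ q : ℚ, Measurable (Aᶜ.indicator fun x => f x q) := by
    intro q
    have : (Aᶜ.indicator fun x => f x q) = Aᶜ.indicator ((hm q).mk _) :=
      Set.indicator_congr fun x hx => (hmem x hx).2 q
    rw [this]
    exact (hm q).measurable_mk.indicator hAm.compl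
  refine ⟨fun x t => Aᶜ.indicator (fun x => f x t) x, hcont, fun t => ?_, ?_⟩
  · obtain ⟨a, ha, hlim⟩ := mem_closure_iff_seq_limit.1 (Rat.denseRange_cast (𝕜 := ℝ) t)
    choose b hb using ha
    refine measurable_of_tendsto_metrizable (f := fun n x => Aᶜ.indicator (fun x => f x (b n)) x)
      (fun n => hrat (b n)) ?_
    rw [tendsto_pi_nhds]
    intro x
    have := ((hcont x).tendsto t).comp hlim
    simpa only [Function.comp_def, ← hb] using this
  · have : ∀ᵐ x : E N, x ∈ Aᶜ := by
      rw [ae_iff]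
      simpa using hA0
    filter_upwards [this] with x hx
    ext t
    simp [Set.indicator_of_mem hx]

theorem Caratheodory.aestronglyMeasurable_comp {f : E N → ℝ → ℝ} (hf : Caratheodory f)
    {u : E N → ℝ} (hu : AEStronglyMeasurable u) : AEStronglyMeasurable fun x => f x (u x) := by
  obtain ⟨f', hc, hm, he⟩ := hf.exists_regular
  have h1 : Measurable (Function.uncurry fun t x => f' x t) :=
    measurable_uncurry_of_continuous_of_measurable hc hm
  have h2 := (h1.comp_aemeasurable (hu.aemeasurable.prodMk aemeasurable_id)).aestronglyMeasurable
  refine h2.congr ?_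
  filter_upwards [he] with x hx
  simp [hx]

theorem Caratheodory.aestronglyMeasurable_primitive {f : E N → ℝ → ℝ} (hf : Caratheodory f)
    {u : E N → ℝ} (hu : AEStronglyMeasurable u) :
    AEStronglyMeasurable fun x => primitive f x (u x) := by
  obtain ⟨f', hc, hm, he⟩ := hf.exists_regular
  have h0 : Measurable (Function.uncurry fun t x => f' x t) :=
    measurable_uncurry_of_continuous_of_measurable hc hm
  have h1 : ∀ t, Measurable fun x => primitive f' x t := by
    intro t
    have h2 : StronglyMeasurable (Function.uncurry f') :=
      (h0.comp measurable_swap).stronglyMeasurable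
    simp only [primitive, intervalIntegral]
    exact h2.integral_prod_right.measurable.sub h2.integral_prod_right.measurable
  have h2 : ∀ x, Continuous fun t => primitive f' x t := fun x =>
    intervalIntegral.continuous_primitive (fun a b => (hc x).intervalIntegrable a b) 0
  have h3 : Measurable (Function.uncurry fun t x => primitive f' x t) :=
    measurable_uncurry_of_continuous_of_measurable h2 h1
  have h4 := (h3.comp_aemeasurable (hu.aemeasurable.prodMk aemeasurable_id)).aestronglyMeasurable
  refine h4.congr ?_
  filter_upwards [he] with x hx
  simp [primitive, hx]

theorem abs_primitive_le {f : E N → ℝ → ℝ} {x : E N} {k C a : ℝ} (hC : 0 ≤ C) (ha : 0 ≤ a)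
    (h : ∀ t, |f x t| ≤ k + C * |t| ^ a) (t : ℝ) :
    |primitive f x t| ≤ (k + C * |t| ^ a) * |t| := by
  have := intervalIntegral.norm_integral_le_of_norm_le_const (f := f x) (a := 0) (b := t)
    (C := k + C * |t| ^ a) fun ξ hξ => by
      refine (h ξ).trans ?_
      have : |ξ| ≤ |t| := by
        simpa using Set.abs_sub_left_of_mem_uIcc (Set.uIoc_subset_uIcc hξ)
      gcongr
  simpa [primitive] using this

theorem hasDerivAt_primitive {f : E N → ℝ → ℝ} {x : E N} (hc : Continuous (f x)) (t : ℝ) :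
    HasDerivAt (primitive f x) (f x t) t :=
  intervalIntegral.integral_hasDerivAt_right (hc.intervalIntegrable _ _)
    (hc.stronglyMeasurableAtFilter _ _) hc.continuousAt

end Caratheodory

end FracLap

/-! ### Superposition operators and potentials under critical growth. -/

namespace FracLap

/-- Critical growth `|f(x,t)| ≤ k(x) + C |t|^(2_s^* - 1)` with `k` in the dual exponent. -/
def CritGrowth {N : ℕ} (s C : ℝ) (f : E N → ℝ → ℝ) : Prop :=
  ∃ k : E N → ℝ, MemLp k (ENNReal.ofReal (critConj N s)) volume ∧ (∀ᵐ x, 0 ≤ k x) ∧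
    ∀ᵐ x, ∀ t : ℝ, |f x t| ≤ k x + C * |t| ^ (critExp N s - 1)

section Nemytskii

variable {N : ℕ} {s C : ℝ} [hA : Admissible N s] {f : E N → ℝ → ℝ}

theorem critConj_pos : 0 < critConj N s := holderConjugate_critExp.symm.pos

theorem critConj_mul_sub_one : critConj N s * (critExp N s - 1) = critExp N s := by
  have := two_lt_critExp' (N := N) (s := s)
  unfold critConj
  exact div_mul_cancel₀ _ (by linarith)

theorem eLpNorm_abs_rpow_critConj (u : E N → ℝ) :
    eLpNorm (fun x => |u x| ^ (critExp N s - 1)) (ENNReal.ofReal (critConj N s)) =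
      eLpNorm u (ENNReal.ofReal (critExp N s)) ^ (critExp N s - 1) := by
  have := two_lt_critExp' (N := N) (s := s)
  have h := eLpNorm_norm_rpow (p := ENNReal.ofReal (critConj N s)) (q := critExp N s - 1)
    (μ := volume) u (by linarith)
  rw [← ENNReal.ofReal_mul critConj_pos.le, critConj_mul_sub_one] at h
  exact h

theorem memLp_abs_rpow_critConj {u : E N → ℝ} (hu : MemLp u (ENNReal.ofReal (critExp N s))) :
    MemLp (fun x => |u x| ^ (critExp N s - 1)) (ENNReal.ofReal (critConj N s)) := by
  have hp := two_lt_critExp' (N := N) (s := s)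
  refine ⟨(hu.1.aemeasurable.abs.pow_const _).aestronglyMeasurable, ?_⟩
  rw [eLpNorm_abs_rpow_critConj]
  exact ENNReal.rpow_lt_top_of_nonneg (by linarith) hu.2.ne

theorem CritGrowth.memLp_comp (hg : CritGrowth s C f) (hf : Caratheodory f) {u : E N → ℝ}
    (hu : MemLp u (ENNReal.ofReal (critExp N s))) :
    MemLp (fun x => f x (u x)) (ENNReal.ofReal (critConj N s)) := by
  obtain ⟨k, hk, -, hb⟩ := hg
  refine (hk.add ((memLp_abs_rpow_critConj hu).const_mul C)).of_le
    (hf.aestronglyMeasurable_comp hu.1) ?_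
  filter_upwards [hb] with x hx
  exact (hx (u x)).trans (le_abs_self _)

theorem sub_le_of_growth {C e k a b y z : ℝ} (hC : 0 ≤ C) (he : 0 ≤ e)
    (hy : |y| ≤ k + C * |a| ^ e) (hz : |z| ≤ k + C * |b| ^ e) :
    |y - z| - C * 2 ^ e * |a - b| ^ e ≤ 2 * k + (C * 2 ^ e + C) * |b| ^ e := by
  have h3 : |a| ^ e ≤ 2 ^ e * (|a - b| ^ e + |b| ^ e) := by
    refine le_trans (Real.rpow_le_rpow (abs_nonneg _) ?_ he)
      (Real.add_rpow_le_two_rpow_mul (abs_nonneg _) (abs_nonneg _) he)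
    simpa using abs_add_le (a - b) b
  have h4 : C * |a| ^ e ≤ C * (2 ^ e * (|a - b| ^ e + |b| ^ e)) := by gcongr
  have h5 := abs_sub y z
  linarith

/-- A Brezis–Lieb type splitting: once D|u_n − v|^e is subtracted from |f(x,u_n) − f(x,v)|, the
positive part is dominated by a fixed function (`sub_le_of_growth`) and tends to zero. The
subtracted term is small because u_n → v in L^{2*}. -/
theorem CritGrowth.tendsto_comp_of_ae (hg : CritGrowth s C f) (hC : 0 ≤ C) (hf : Caratheodory f)
    {u : ℕ → E N → ℝ} {v : E N → ℝ} (hu : ∀ n, MemLp (u n) (ENNReal.ofReal (critExp N s)))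
    (hv : MemLp v (ENNReal.ofReal (critExp N s)))
    (hlim : Tendsto (fun n => eLpNorm (u n - v) (ENNReal.ofReal (critExp N s))) atTop (𝓝 0))
    (hae : ∀ᵐ x, Tendsto (fun n => u n x) atTop (𝓝 (v x))) :
    Tendsto (fun n => eLpNorm ((fun x => f x (u n x)) - fun x => f x (v x))
      (ENNReal.ofReal (critConj N s))) atTop (𝓝 0) := by
  have hp := two_lt_critExp' (N := N) (s := s)
  obtain ⟨k, hk, hk0, hb⟩ := id hg
  set e := critExp N s - 1 with he
  have he0 : 0 < e := by linarith
  set D := C * 2 ^ e with hD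
  have hD0 : 0 ≤ D := by positivity
  set r : ℕ → E N → ℝ := fun n x =>
    max (|f x (u n x) - f x (v x)| - D * |u n x - v x| ^ e) 0 with hr
  set B : E N → ℝ := fun x => 2 * k x + (D + C) * |v x| ^ e with hB
  have hBL : MemLp B (ENNReal.ofReal (critConj N s)) :=
    (hk.const_mul 2).add ((memLp_abs_rpow_critConj hv).const_mul _)
  have hdm : ∀ n, AEStronglyMeasurable (fun x => f x (u n x) - f x (v x)) := fun n =>
    (hf.aestronglyMeasurable_comp (hu n).1).sub (hf.aestronglyMeasurable_comp hv.1)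
  have hwL : ∀ n, MemLp (fun x => |u n x - v x| ^ e) (ENNReal.ofReal (critConj N s)) := fun n =>
    memLp_abs_rpow_critConj ((hu n).sub hv)
  have hrm : ∀ n, AEStronglyMeasurable (r n) := fun n =>
    (((hdm n).aemeasurable.abs.sub ((hwL n).1.aemeasurable.const_mul D)).max
      aemeasurable_const).aestronglyMeasurable
  have hrB : ∀ n, ∀ᵐ x, |r n x| ≤ B x := by
    intro n
    filter_upwards [hb, hk0] with x hx hkx
    rw [abs_of_nonneg (le_max_right _ _)]
    refine max_le ?_ (by simp only [hB]; positivity)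
    exact sub_le_of_growth hC he0.le (hx _) (hx _)
  have hr0 : ∀ᵐ x, Tendsto (fun n => r n x) atTop (𝓝 0) := by
    filter_upwards [hae, hf.2] with x hx hc
    have h1 : Tendsto (fun n => |f x (u n x) - f x (v x)|) atTop (𝓝 0) := by
      have := (((hc.tendsto (v x)).comp hx).sub_const (f x (v x))).abs
      simpa using this
    have h2 : Tendsto (fun n => |u n x - v x| ^ e) atTop (𝓝 0) := by
      have := ((hx.sub_const (v x)).abs).rpow_const (p := e) (Or.inr he0.le)
      simpa [Real.zero_rpow he0.ne'] using this
    have h3 := (h1.sub (h2.const_mul D)).max (tendsto_const_nhds (x := (0 : ℝ)))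
    simpa [hr] using h3
  have hpc := critConj_pos (N := N) (s := s)
  have h1 := tendsto_eLpNorm_zero_of_dominated (by simpa using hpc) ENNReal.ofReal_ne_top hrm hBL
    hrB hr0
  have h2 : Tendsto (fun n => ENNReal.ofReal D *
      eLpNorm (u n - v) (ENNReal.ofReal (critExp N s)) ^ e) atTop (𝓝 0) := by
    have := ENNReal.Tendsto.const_mul (hlim.ennrpow_const e) (Or.inr (ENNReal.ofReal_ne_top (r := D)))
    simpa [ENNReal.zero_rpow_of_pos he0] using this
  have h3 := h1.add h2
  rw [add_zero] at h3
  refine tendsto_of_tendsto_of_tendsto_of_le_of_le tendsto_const_nhds h3 (fun _ => zero_le)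
    fun n => ?_
  have hpc1 : 1 ≤ ENNReal.ofReal (critConj N s) := by
    simpa using (holderConjugate_critExp (N := N) (s := s)).symm.lt.le
  have e1 : eLpNorm ((fun x => f x (u n x)) - fun x => f x (v x)) (ENNReal.ofReal (critConj N s)) ≤
      eLpNorm (r n + D • fun x => |u n x - v x| ^ e) (ENNReal.ofReal (critConj N s)) := by
    refine eLpNorm_mono_real fun x => ?_
    have := le_max_left (|f x (u n x) - f x (v x)| - D * |u n x - v x| ^ e) 0
    simp only [Pi.add_apply, Pi.sub_apply, Pi.smul_apply, smul_eq_mul, hr, Real.norm_eq_abs]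
    linarith
  have e2 := eLpNorm_add_le (hrm n) ((hwL n).1.const_smul D) hpc1
  have e3 : eLpNorm (fun x => |u n x - v x| ^ e) (ENNReal.ofReal (critConj N s)) =
      eLpNorm (u n - v) (ENNReal.ofReal (critExp N s)) ^ e :=
    eLpNorm_abs_rpow_critConj (s := s) (u n - v)
  rw [eLpNorm_const_smul, Real.enorm_eq_ofReal hD0, e3] at e2
  exact e1.trans e2

/-- Every subsequence has a further one converging almost everywhere, which is enough for
convergence of the whole sequence. -/
theorem CritGrowth.tendsto_comp (hg : CritGrowth s C f) (hC : 0 ≤ C) (hf : Caratheodory f)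
    {u : ℕ → E N → ℝ} {v : E N → ℝ} (hu : ∀ n, MemLp (u n) (ENNReal.ofReal (critExp N s)))
    (hv : MemLp v (ENNReal.ofReal (critExp N s)))
    (hlim : Tendsto (fun n => eLpNorm (u n - v) (ENNReal.ofReal (critExp N s))) atTop (𝓝 0)) :
    Tendsto (fun n => eLpNorm ((fun x => f x (u n x)) - fun x => f x (v x))
      (ENNReal.ofReal (critConj N s))) atTop (𝓝 0) := by
  have hp := two_lt_critExp' (N := N) (s := s)
  refine tendsto_of_subseq_tendsto fun ns hns => ?_
  have h1 := hlim.comp hns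
  obtain ⟨ms, hms, hae⟩ := (tendstoInMeasure_of_tendsto_eLpNorm (by simp; linarith)
    (fun n => (hu (ns n)).1) hv.1 h1).exists_seq_tendsto_ae
  exact ⟨ms, hg.tendsto_comp_of_ae hC hf (fun n => hu _) hv (h1.comp hms.tendsto_atTop) hae⟩

theorem CritGrowth.integrable_primitive (hg : CritGrowth s C f) (hC : 0 ≤ C)
    (hf : Caratheodory f) {u : E N → ℝ} (hu : MemLp u (ENNReal.ofReal (critExp N s))) :
    Integrable fun x => primitive f x (u x) := by
  have hp := two_lt_critExp' (N := N) (s := s)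
  obtain ⟨k, hk, hk0, hb⟩ := id hg
  have h1 : Integrable fun x => (k x + C * |u x| ^ (critExp N s - 1)) * |u x| :=
    (hk.add ((memLp_abs_rpow_critConj hu).const_mul C)).integrable_mul hu.abs
  refine h1.mono' (hf.aestronglyMeasurable_primitive hu.1) ?_
  filter_upwards [hb] with x hx
  exact abs_primitive_le hC (by linarith) hx (u x)

theorem CritGrowth.abs_potential_le (hg : CritGrowth s C f) (hC : 0 ≤ C) :
    ∃ K : ℝ, 0 ≤ K ∧ ∀ U : Ds N s, |potential f (rep U)| ≤
      K * (sobolevBound N s * ‖U‖) + C * (sobolevBound N s * ‖U‖) ^ critExp N s := by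
  have hp := two_lt_critExp' (N := N) (s := s)
  obtain ⟨k, hk, hk0, hb⟩ := id hg
  refine ⟨(eLpNorm k (ENNReal.ofReal (critConj N s))).toReal, ENNReal.toReal_nonneg, fun U => ?_⟩
  have hU := (memDs_rep U).1
  have hi1 : Integrable fun x => |k x * rep U x| := (integrable_mul_rep hk U).abs
  have hi2 := (hU.integrable_abs_rpow (by linarith)).const_mul C
  calc |potential f (rep U)| ≤ ∫ x, (|k x * rep U x| + C * |rep U x| ^ critExp N s) := by
        change ‖∫ x, primitive f x (rep U x)‖ ≤ _
        refine norm_integral_le_of_norm_le (hi1.add hi2) ?_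
        filter_upwards [hb, hk0] with x hx hkx
        refine (abs_primitive_le hC (by linarith) hx (rep U x)).trans_eq ?_
        rw [abs_mul, abs_of_nonneg hkx, add_mul, mul_assoc]
        congr 2
        rcases (abs_nonneg (rep U x)).eq_or_lt with h0 | h0
        · rw [← h0, mul_zero, Real.zero_rpow (by linarith)]
        · rw [Real.rpow_sub_one h0.ne', div_mul_cancel₀ _ h0.ne']
    _ = (∫ x, |k x * rep U x|) + C * ∫ x, |rep U x| ^ critExp N s := by
        rw [integral_add hi1 hi2, integral_const_mul]
    _ ≤ _ := by
        rw [hU.integral_abs_rpow (by linarith)]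
        have := toReal_eLpNorm_rep_le U
        gcongr
        exact integral_abs_mul_rep_le hk U

/-- Differentiation under the integral: for |t| < 1 the derivative is dominated through |u + tv| ≤
|u| + |v|, and Hölder makes the bound integrable. -/
theorem CritGrowth.hasDerivAt_potential (hg : CritGrowth s C f) (hC : 0 ≤ C)
    (hf : Caratheodory f) {u v : E N → ℝ} (hu : MemLp u (ENNReal.ofReal (critExp N s)))
    (hv : MemLp v (ENNReal.ofReal (critExp N s))) :
    HasDerivAt (fun t : ℝ => potential f (u + t • v)) (∫ x, f x (u x) * v x) 0 := by
  have hp := two_lt_critExp' (N := N) (s := s)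
  obtain ⟨k, hk, hk0, hb⟩ := id hg
  have hbound : Integrable fun x =>
      (k x + C * |(|u x| + |v x|)| ^ (critExp N s - 1)) * |v x| :=
    (hk.add ((memLp_abs_rpow_critConj (hu.abs.add hv.abs)).const_mul C)).integrable_mul hv.abs
  have h := hasDerivAt_integral_of_dominated_loc_of_deriv_le (μ := (volume : Measure (E N)))
    (F := fun t x => primitive f x ((u + t • v) x))
    (F' := fun t x => f x ((u + t • v) x) * v x) (x₀ := (0 : ℝ)) (s := Metric.ball 0 1)
    (Metric.ball_mem_nhds 0 one_pos)
    (Eventually.of_forall fun t => hf.aestronglyMeasurable_primitive (hu.1.add (hv.1.const_smul t)))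
    (hg.integrable_primitive hC hf (hu.add (hv.const_smul 0)))
    ((hf.aestronglyMeasurable_comp (hu.1.add (hv.1.const_smul 0))).mul hv.1) ?_ hbound ?_
  · simpa [potential] using h.2
  · filter_upwards [hb] with x hx t ht
    rw [norm_mul]
    refine mul_le_mul_of_nonneg_right ((hx _).trans ?_) (norm_nonneg _)
    have ht' : |t| ≤ 1 := by
      rw [mem_ball_zero_iff] at ht
      exact ht.le
    have h1 : |(u + t • v) x| ≤ |(|u x| + |v x|)| := by
      rw [abs_of_nonneg (a := |u x| + |v x|) (by positivity)]
      simp only [Pi.add_apply, Pi.smul_apply, smul_eq_mul]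
      refine (abs_add_le _ _).trans ?_
      rw [abs_mul]
      nlinarith [abs_nonneg (v x)]
    gcongr
    linarith
  · filter_upwards [hf.2] with x hx t ht
    have h1 : HasDerivAt (fun t : ℝ => (u + t • v) x) (v x) t := by
      simpa using ((hasDerivAt_id t).mul_const (v x)).const_add (u x)
    exact (hasDerivAt_primitive hx _).comp t h1

theorem potential_congr_ae {u v : E N → ℝ} (h : u =ᵐ[volume] v) :
    potential f u = potential f v := by
  refine integral_congr_ae ?_
  filter_upwards [h] with x hx
  rw [hx]

end Nemytskii

end FracLap

/-! ### The energy functional and the Palais–Smale condition on balls. -/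

theorem hasDerivAt_half_norm_add_smul_sq {H : Type*} [NormedAddCommGroup H] [InnerProductSpace ℝ H]
    (u v : H) : HasDerivAt (fun t : ℝ => 1 / 2 * ‖u + t • v‖ ^ 2) (inner ℝ u v) 0 := by
  have h2 : (fun t : ℝ => 1 / 2 * ‖u + t • v‖ ^ 2) = fun t : ℝ =>
      1 / 2 * ‖u‖ ^ 2 + t * inner ℝ u v + 1 / 2 * t ^ 2 * ‖v‖ ^ 2 := by
    ext t
    rw [norm_add_sq_real, inner_smul_right, norm_smul, mul_pow, Real.norm_eq_abs, sq_abs]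
    ring
  rw [h2]
  have h3 := (((hasDerivAt_id (0 : ℝ)).mul_const (inner ℝ u v)).const_add (1 / 2 * ‖u‖ ^ 2)).add
    ((((hasDerivAt_id (0 : ℝ)).pow 2).const_mul (1 / 2)).mul_const (‖v‖ ^ 2))
  exact h3.congr_deriv (by simp)

namespace FracLap

section Energy

variable {N : ℕ} {s C : ℝ} [hA : Admissible N s] {f : E N → ℝ → ℝ}

/-- The energy functional `½ [u]_s² - ∫ F(x,u)`. -/
noncomputable def energy (f : E N → ℝ → ℝ) (U : Ds N s) : ℝ :=
  1 / 2 * ‖U‖ ^ 2 - potential f (rep U)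

/-- The gradient of the energy functional. -/
noncomputable def energyGrad (hg : CritGrowth s C f) (hf : Caratheodory f) (U : Ds N s) : Ds N s :=
  U - riesz (hg.memLp_comp hf (memDs_rep U).1)

theorem inner_energyGrad (hg : CritGrowth s C f) (hf : Caratheodory f) (U V : Ds N s) :
    inner ℝ (energyGrad hg hf U) V = inner ℝ U V - ∫ x, f x (rep U x) * rep V x := by
  rw [energyGrad, inner_sub_left, inner_riesz]

theorem hasLineGradient_energy (hg : CritGrowth s C f) (hC : 0 ≤ C) (hf : Caratheodory f) :
    HasLineGradient (energy (s := s) f) (energyGrad hg hf) := by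
  intro U V
  rw [inner_energyGrad]
  have h2 : ∀ t : ℝ, potential f (rep (U + t • V)) = potential f (rep U + t • rep V) := fun t =>
    potential_congr_ae ((rep_add U (t • V)).trans ((EventuallyEq.refl _ _).add (rep_smul t V)))
  simp only [energy, h2]
  exact (hasDerivAt_half_norm_add_smul_sq U V).sub (hg.hasDerivAt_potential hC hf (memDs_rep U).1 (memDs_rep V).1)

theorem continuous_energyGrad (hg : CritGrowth s C f) (hC : 0 ≤ C) (hf : Caratheodory f) :
    Continuous (energyGrad hg hf) := by
  refine continuous_id.sub (continuous_iff_seqContinuous.2 fun U V hUV => ?_)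
  have h1 : Tendsto (fun n => eLpNorm (rep (U n) - rep V) (ENNReal.ofReal (critExp N s)))
      atTop (𝓝 0) := by
    have h2 : Tendsto (fun n => ENNReal.ofReal (sobolevBound N s * ‖U n - V‖)) atTop (𝓝 0) := by
      have := (tendsto_iff_norm_sub_tendsto_zero.1 hUV).const_mul (sobolevBound N s)
      simpa using ENNReal.tendsto_ofReal this
    refine tendsto_of_tendsto_of_tendsto_of_le_of_le tendsto_const_nhds h2 (fun _ => zero_le)
      fun n => ?_
    simp only
    rw [← eLpNorm_congr_ae (rep_sub (U n) V)]
    exact eLpNorm_rep_le _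
  have h3 := hg.tendsto_comp hC hf (fun n => (memDs_rep (U n)).1) (memDs_rep V).1 h1
  have h4 := ((ENNReal.tendsto_toReal ENNReal.zero_ne_top).comp h3).const_mul (sobolevBound N s)
  rw [ENNReal.toReal_zero, mul_zero] at h4
  rw [tendsto_iff_norm_sub_tendsto_zero]
  exact squeeze_zero (fun _ => norm_nonneg _) (fun n => norm_riesz_sub_le _ _) h4

/-- The key estimate for compactness: along `u + w n`, with `w n` bounded in `L^{2_s^*}` and tending
to zero almost everywhere, the nonlinearity tested with `w n` is controlled by `C`. -/
theorem CritGrowth.exists_integral_comp_mul_le (hg : CritGrowth s C f) (hC : 0 ≤ C)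
    {u : ℕ → E N → ℝ} {v : E N → ℝ} {w : ℕ → E N → ℝ} {B : ℝ}
    (hv : MemLp v (ENNReal.ofReal (critExp N s)))
    (hw : ∀ n, MemLp (w n) (ENNReal.ofReal (critExp N s)))
    (huvw : ∀ n, u n =ᵐ[volume] v + w n)
    (hB : ∀ n, ∫ x, |w n x| ^ critExp N s ≤ B)
    (hae : ∀ᵐ x, Tendsto (fun n => w n x) atTop (𝓝 0)) :
    ∃ o : ℕ → ℝ, Tendsto o atTop (𝓝 0) ∧ ∀ n, |∫ x, f x (u n x) * w n x| ≤
      o n + C * 2 ^ (critExp N s - 1) * ∫ x, |w n x| ^ critExp N s := by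
  have hp := two_lt_critExp' (N := N) (s := s)
  obtain ⟨k, hk, hk0, hb⟩ := id hg
  set e := critExp N s - 1 with he
  have he0 : 0 < e := by linarith
  -- `φ` collects the part of the growth bound independent of n; tested against w_n it vanishes in
  -- the limit, leaving only the purely critical term.
  set φ : E N → ℝ := fun x => k x + C * 2 ^ e * |v x| ^ e with hφ
  have hφL : MemLp φ (ENNReal.ofReal (critConj N s)) :=
    hk.add ((memLp_abs_rpow_critConj hv).const_mul _)
  refine ⟨fun n => ∫ x, |φ x| * |w n x|,
    tendsto_integral_mul_abs_zero holderConjugate_critExp hφL hw hB hae, fun n => ?_⟩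
  have hi1 : Integrable fun x => |φ x| * |w n x| := hφL.abs.integrable_mul (hw n).abs
  have hi2 := ((hw n).integrable_abs_rpow (by linarith)).const_mul (C * 2 ^ e)
  rw [← integral_const_mul, ← integral_add hi1 hi2]
  change ‖∫ x, f x (u n x) * w n x‖ ≤ _
  refine norm_integral_le_of_norm_le (hi1.add hi2) ?_
  filter_upwards [hb, huvw n, hk0] with x hx hux hkx
  rw [norm_mul, Real.norm_eq_abs, Real.norm_eq_abs]
  have h1 : |u n x| ^ e ≤ 2 ^ e * (|v x| ^ e + |w n x| ^ e) := by
    refine le_trans (Real.rpow_le_rpow (abs_nonneg _) ?_ he0.le)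
      (Real.add_rpow_le_two_rpow_mul (abs_nonneg _) (abs_nonneg _) he0.le)
    rw [hux]
    exact abs_add_le _ _
  have h2 : |f x (u n x)| ≤ φ x + C * 2 ^ e * |w n x| ^ e := by
    refine (hx (u n x)).trans ?_
    have h3 : C * |u n x| ^ e ≤ C * (2 ^ e * (|v x| ^ e + |w n x| ^ e)) := by gcongr
    simp only [hφ]
    linarith
  have h3 : |w n x| ^ e * |w n x| = |w n x| ^ critExp N s := by
    rcases (abs_nonneg (w n x)).eq_or_lt with h0 | h0
    · rw [← h0, mul_zero, Real.zero_rpow (by linarith)]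
    · rw [he, Real.rpow_sub_one h0.ne', div_mul_cancel₀ _ h0.ne']
  calc |f x (u n x)| * |w n x| ≤ (|φ x| + C * 2 ^ e * |w n x| ^ e) * |w n x| := by
        gcongr
        linarith [le_abs_self (φ x)]
    _ = |φ x| * |w n x| + C * 2 ^ e * |w n x| ^ critExp N s := by rw [← h3]; ring

theorem integral_abs_rep_rpow_le (U : Ds N s) : ∫ x, |rep U x| ^ critExp N s ≤
    sobolevBound N s ^ critExp N s * ‖U‖ ^ critExp N s := by
  have hp := two_lt_critExp' (N := N) (s := s)
  rw [(memDs_rep U).1.integral_abs_rpow (by linarith),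
    ← Real.mul_rpow sobolevBound_pos.le (norm_nonneg _)]
  exact Real.rpow_le_rpow ENNReal.toReal_nonneg (toReal_eLpNorm_rep_le U) (by linarith)

/-- Since 2* > 2, on a ball the critical power ‖W‖^{2*} is at most (2R)^(2*−2)‖W‖². The smallness
hypothesis is exactly what fits the result under half of the quadratic term. The radius is 2R
because `W` will be a difference of two points of the R-ball. -/
theorem mul_integral_abs_rep_rpow_le (hC : 0 ≤ C) {R : ℝ}
    (hsmall : C * 2 ^ (critExp N s - 1) *
      (sobolevBound N s ^ critExp N s * (2 * R) ^ (critExp N s - 2)) ≤ 1 / 2)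
    {W : Ds N s} (hW : ‖W‖ ≤ 2 * R) :
    C * 2 ^ (critExp N s - 1) * ∫ x, |rep W x| ^ critExp N s ≤ 1 / 2 * ‖W‖ ^ 2 := by
  have hp := two_lt_critExp' (N := N) (s := s)
  have hS := sobolevBound_pos (N := N) (s := s)
  have h6 : ‖W‖ ^ critExp N s ≤ (2 * R) ^ (critExp N s - 2) * ‖W‖ ^ 2 := by
    rcases (norm_nonneg W).eq_or_lt with h0 | h0
    · rw [← h0, Real.zero_rpow (by linarith)]; simp
    · have h1 : ‖W‖ ^ critExp N s = ‖W‖ ^ (critExp N s - 2) * ‖W‖ ^ 2 := by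
        rw [← Real.rpow_natCast, ← Real.rpow_add h0]
        norm_num
      rw [h1]
      exact mul_le_mul_of_nonneg_right (Real.rpow_le_rpow h0.le hW (by linarith)) (sq_nonneg _)
  calc C * 2 ^ (critExp N s - 1) * ∫ x, |rep W x| ^ critExp N s
      ≤ C * 2 ^ (critExp N s - 1) * (sobolevBound N s ^ critExp N s *
        ((2 * R) ^ (critExp N s - 2) * ‖W‖ ^ 2)) :=
          mul_le_mul_of_nonneg_left ((integral_abs_rep_rpow_le W).trans
            (mul_le_mul_of_nonneg_left h6 (by positivity))) (by positivity)
    _ = C * 2 ^ (critExp N s - 1) *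
        (sobolevBound N s ^ critExp N s * (2 * R) ^ (critExp N s - 2)) * ‖W‖ ^ 2 := by ring
    _ ≤ _ := mul_le_mul_of_nonneg_right hsmall (sq_nonneg _)

/-- The gradient at U is tested with W itself: the quadratic part yields ‖W‖² + ⟨W,V⟩, and the
critical part is absorbed, which costs the factor 2. -/
theorem norm_sub_sq_le_of_energyGrad (hg : CritGrowth s C f) (hC : 0 ≤ C) (hf : Caratheodory f)
    {R : ℝ} (hsmall : C * 2 ^ (critExp N s - 1) *
      (sobolevBound N s ^ critExp N s * (2 * R) ^ (critExp N s - 2)) ≤ 1 / 2)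
    {U V W : Ds N s} (hU : U = V + W) (hW : ‖W‖ ≤ 2 * R) {o : ℝ}
    (ho : |∫ x, f x (rep U x) * rep W x| ≤
      o + C * 2 ^ (critExp N s - 1) * ∫ x, |rep W x| ^ critExp N s) :
    ‖W‖ ^ 2 ≤ 2 * (‖energyGrad hg hf U‖ * (2 * R) - inner ℝ W V + o) := by
  have h1 := inner_energyGrad hg hf U W
  have h2 : inner ℝ U W = ‖W‖ ^ 2 + inner ℝ W V := by
    rw [hU, inner_add_left, real_inner_self_eq_norm_sq, real_inner_comm V, add_comm]
  have h3 : inner ℝ (energyGrad hg hf U) W ≤ ‖energyGrad hg hf U‖ * (2 * R) :=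
    (real_inner_le_norm _ _).trans (mul_le_mul_of_nonneg_left hW (norm_nonneg _))
  have h4 := (le_abs_self _).trans ho
  have h5 := mul_integral_abs_rep_rpow_le hC hsmall hW
  linarith

/-- After extracting a weak limit `V` and almost everywhere convergence of the differences, every
term in the bound for ‖U_n − V‖² tends to zero: the gradient by hypothesis, ⟨U_n − V, V⟩ by weak
convergence, and the remainder `o` by almost everywhere convergence. -/
theorem palaisSmale_energyGrad (hg : CritGrowth s C f) (hC : 0 ≤ C) (hf : Caratheodory f) {R : ℝ}
    (hsmall : C * 2 ^ (critExp N s - 1) *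
      (sobolevBound N s ^ critExp N s * (2 * R) ^ (critExp N s - 2)) ≤ 1 / 2) :
    PalaisSmaleOnBall (energyGrad hg hf) R := by
  intro U hUR hG
  have hp := two_lt_critExp' (N := N) (s := s)
  have hS := sobolevBound_pos (N := N) (s := s)
  obtain ⟨V, ns, hVR, hns, hweak⟩ := exists_subseq_weakly_tendsto hUR
  obtain ⟨Y, hY⟩ : ∃ Y : ℕ → Ds N s, ∀ n, U (ns n) = V + Y n :=
    ⟨fun n => U (ns n) - V, fun n => (add_sub_cancel _ _).symm⟩
  have hYeq : ∀ n, Y n = U (ns n) - V := fun n => by rw [hY, add_sub_cancel_left]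
  have hYR : ∀ n, ‖Y n‖ ≤ 2 * R := fun n => by
    rw [hYeq]
    linarith [norm_sub_le (U (ns n)) V, hUR (ns n)]
  have hYweak : ∀ Z, Tendsto (fun n => inner ℝ (Y n) Z) atTop (𝓝 0) := by
    intro Z
    have h1 := (hweak Z).sub_const (inner ℝ V Z)
    rw [sub_self] at h1
    refine h1.congr fun n => ?_
    rw [hYeq, inner_sub_left]
  obtain ⟨ms, hms, hae⟩ := exists_subseq_ae_tendsto_zero hYR hYweak
  obtain ⟨o, ho, hle⟩ := hg.exists_integral_comp_mul_le hC
    (u := fun n => rep (U (ns (ms n)))) (v := rep V) (w := fun n => rep (Y (ms n)))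
    (B := sobolevBound N s ^ critExp N s * (2 * R) ^ critExp N s) (memDs_rep V).1
    (fun n => (memDs_rep (Y (ms n))).1)
    (fun n => by
      simp only [hY]
      exact rep_add V (Y (ms n)))
    (fun n => (integral_abs_rep_rpow_le _).trans (mul_le_mul_of_nonneg_left
      (Real.rpow_le_rpow (norm_nonneg _) (hYR _) (by linarith)) (by positivity))) hae
  refine ⟨V, ns ∘ ms, hns.comp hms, ?_⟩
  have hlim : Tendsto (fun n => 2 * (‖energyGrad hg hf (U (ns (ms n)))‖ * (2 * R) -
      inner ℝ (Y (ms n)) V + o n)) atTop (𝓝 0) := by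
    have h1 := ((hG.comp (hns.comp hms).tendsto_atTop).norm).mul_const (2 * R)
    have h2 := (hYweak V).comp hms.tendsto_atTop
    have h3 := ((h1.sub h2).add ho).const_mul 2
    rw [norm_zero, zero_mul, sub_zero, add_zero, mul_zero] at h3
    exact h3
  have hsq0 : Tendsto (fun n => ‖Y (ms n)‖ ^ 2) atTop (𝓝 0) :=
    squeeze_zero (fun n => sq_nonneg _)
      (fun n => norm_sub_sq_le_of_energyGrad hg hC hf hsmall (hY (ms n)) (hYR _) (hle n)) hlim
  rw [tendsto_iff_norm_sub_tendsto_zero]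
  have h1 := hsq0.sqrt
  rw [Real.sqrt_zero] at h1
  refine h1.congr fun n => ?_
  rw [Real.sqrt_sq (norm_nonneg _), hYeq, Function.comp]
  rfl

end Energy

end FracLap

/-! ### Consequences of the growth hypotheses. -/

/-- Interpolation of membership in `L^p` spaces. -/
theorem MeasureTheory.MemLp.of_exponent_between {α : Type*} [MeasurableSpace α] {μ : Measure α}
    {a b c : ℝ} (ha : 0 < a) (hab : a ≤ b) (hbc : b ≤ c) {u : α → ℝ}
    (hua : MemLp u (ENNReal.ofReal a) μ) (huc : MemLp u (ENNReal.ofReal c) μ) :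
    MemLp u (ENNReal.ofReal b) μ := by
  have hb : 0 < b := by linarith
  have h1 := (hua.integrable_abs_rpow ha).add (huc.integrable_abs_rpow (by linarith))
  have h2 : Integrable (fun x => ‖u x‖ ^ (ENNReal.ofReal b).toReal) μ := by
    rw [ENNReal.toReal_ofReal hb.le]
    refine h1.mono' (hua.1.aemeasurable.norm.pow_const b).aestronglyMeasurable
      (Eventually.of_forall fun x => ?_)
    rw [Real.norm_of_nonneg (by positivity), Real.norm_eq_abs, Pi.add_apply]
    have hna : 0 ≤ |u x| ^ a := by positivity
    have hnc : 0 ≤ |u x| ^ c := by positivity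
    rcases (abs_nonneg (u x)).eq_or_lt with h0 | h0
    · rw [← h0, Real.zero_rpow hb.ne']
      positivity
    rcases le_total |u x| 1 with h | h
    · linarith [Real.rpow_le_rpow_of_exponent_ge h0 h hab]
    · linarith [Real.rpow_le_rpow_of_exponent_le h hbc]
  exact (integrable_norm_rpow_iff hua.1 (by simpa using hb) ENNReal.ofReal_ne_top).1 h2

namespace FracLap

theorem CritGrowth.linear_combination {N : ℕ} {s : ℝ} {f g : E N → ℝ → ℝ} {C₁ C₂ lam mu : ℝ} (hlam : 0 ≤ lam) (hmu : 0 ≤ mu)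
    (hf : CritGrowth s C₁ f) (hg : CritGrowth s C₂ g) :
    CritGrowth s (lam * C₁ + mu * C₂) fun x t => lam * f x t + mu * g x t := by
  obtain ⟨k, hk, hk0, hb⟩ := hf
  obtain ⟨l, hl, hl0, hc⟩ := hg
  refine ⟨fun x => lam * k x + mu * l x, (hk.const_mul lam).add (hl.const_mul mu), ?_, ?_⟩
  · filter_upwards [hk0, hl0] with x h1 h2
    positivity
  · filter_upwards [hb, hc] with x h1 h2 t
    refine (abs_add_le _ _).trans ?_
    rw [abs_mul, abs_mul, abs_of_nonneg hlam, abs_of_nonneg hmu]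
    have h3 := mul_le_mul_of_nonneg_left (h1 t) hlam
    have h4 := mul_le_mul_of_nonneg_left (h2 t) hmu
    linarith

theorem Caratheodory.linear_combination {N : ℕ} {f g : E N → ℝ → ℝ} (hf : Caratheodory f)
    (hg : Caratheodory g) (lam mu : ℝ) : Caratheodory fun x t => lam * f x t + mu * g x t := by
  refine ⟨fun t => ((hf.1 t).const_mul lam).add ((hg.1 t).const_mul mu), ?_⟩
  filter_upwards [hf.2, hg.2] with x h1 h2
  fun_prop

section Growth

variable {N : ℕ} {s : ℝ} [hA : Admissible N s] {f g : E N → ℝ → ℝ}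

/-- Young's inequality with (a−1)P = p − 1, where p = 2*, turns h|t|^(a−1) into ε|t|^(p−1) plus a
multiple of |h|^Q. The latter lies in the dual exponent because the dual exponent times Q is
p/(p−a). That ε is arbitrary expresses the absence of any critical obstruction from such terms. -/
theorem critGrowth_of_subcritical {a : ℝ} (ha1 : 1 < a) (ha : a < critExp N s) {h : E N → ℝ}
    (hh : MemLp h (ENNReal.ofReal (critExp N s / (critExp N s - a))))
    (hb : ∀ᵐ x, ∀ t : ℝ, |f x t| ≤ h x * |t| ^ (a - 1)) {ε : ℝ} (hε : 0 < ε) :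
    CritGrowth s ε f := by
  have hp := two_lt_critExp' (N := N) (s := s)
  set p := critExp N s with hpdef
  set P := (p - 1) / (a - 1) with hP
  set Q := (p - 1) / (p - a) with hQ
  have hP0 : 0 < P := div_pos (by linarith) (by linarith)
  have hQ0 : 0 < Q := div_pos (by linarith) (by linarith)
  have hPQ : P.HolderConjugate Q := by
    rw [Real.holderConjugate_iff]
    constructor
    · rw [hP, lt_div_iff₀ (by linarith)]
      linarith
    · rw [hP, hQ, inv_div, inv_div, ← add_div, div_eq_one_iff_eq (by linarith)]
      ring
  have hPa : (a - 1) * P = p - 1 := by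
    rw [hP, mul_div_cancel₀ _ (by linarith : a - 1 ≠ 0)]
  set K := (ε ^ (-(1 / P))) ^ Q with hK
  refine ⟨fun x => K * |h x| ^ Q, ?_, Eventually.of_forall fun x => by positivity, ?_⟩
  · refine MemLp.const_mul ⟨(hh.1.aemeasurable.abs.pow_const Q).aestronglyMeasurable, ?_⟩ K
    have h1 := eLpNorm_norm_rpow (p := ENNReal.ofReal (critConj N s)) (q := Q) (μ := volume) h hQ0
    rw [← ENNReal.ofReal_mul critConj_pos.le] at h1
    have h2 : critConj N s * Q = p / (p - a) := by
      rw [critConj, hQ, ← hpdef, div_mul_div_cancel₀ (by linarith)]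
    rw [h2] at h1
    simp only [Real.norm_eq_abs] at h1
    rw [h1]
    exact ENNReal.rpow_lt_top_of_nonneg hQ0.le hh.2.ne
  · filter_upwards [hb] with x hx t
    refine (hx t).trans ((mul_le_mul_of_nonneg_right (le_abs_self _) (by positivity)).trans ?_)
    have hy := Real.young_inequality_of_nonneg (a := ε ^ (1 / P) * |t| ^ (a - 1))
      (b := ε ^ (-(1 / P)) * |h x|) (by positivity) (by positivity) hPQ
    rw [Real.mul_rpow (by positivity) (by positivity), Real.mul_rpow (by positivity) (abs_nonneg _),
      ← Real.rpow_mul hε.le (1 / P) P, one_div_mul_cancel hP0.ne', Real.rpow_one,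
      ← Real.rpow_mul (abs_nonneg t), hPa] at hy
    have e1 : ε ^ (1 / P) * |t| ^ (a - 1) * (ε ^ (-(1 / P)) * |h x|) = |h x| * |t| ^ (a - 1) := by
      rw [Real.rpow_neg hε.le]
      have : 0 < ε ^ (1 / P) := by positivity
      field_simp
    rw [e1] at hy
    have h1 : ε * |t| ^ (p - 1) / P ≤ ε * |t| ^ (p - 1) := div_le_self (by positivity) hPQ.lt.le
    have h2 : K * |h x| ^ Q / Q ≤ K * |h x| ^ Q := div_le_self (by positivity) hPQ.symm.lt.le
    linarith

theorem GrowthG.exists_critGrowth {r : ℝ} (hg : GrowthG s r g) :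
    ∃ C, 0 ≤ C ∧ CritGrowth s C g := by
  rcases hg with ⟨h1, h2, h, δ, -, -, hh, -, hb⟩ | ⟨-, h, hh, hb, -⟩
  · exact ⟨1, zero_le_one, critGrowth_of_subcritical h1 h2 hh hb one_pos⟩
  · refine ⟨(eLpNorm h ∞ volume).toReal, ENNReal.toReal_nonneg, 0, MemLp.zero,
      Eventually.of_forall fun x => le_rfl, ?_⟩
    have hae : ∀ᵐ x, ‖h x‖ₑ ≤ eLpNorm h ∞ volume := by
      rw [eLpNorm_exponent_top]
      exact enorm_ae_le_eLpNormEssSup h volume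
    filter_upwards [hb, hae] with x hx hhx t
    refine (hx t).trans ?_
    rw [Pi.zero_apply, zero_add]
    gcongr
    have h3 := ENNReal.toReal_mono hh.2.ne hhx
    rw [toReal_enorm] at h3
    exact (le_abs_self _).trans h3

/-- Since 1 < q, the exponent 2*/(2*−q) lies between the two exponents given for the weight, so
interpolation applies. -/
theorem GrowthF.exists_weight {q : ℝ} (hq : 2 < q) (hqp : q < critExp N s) (hF : GrowthF s q f) :
    ∃ m : E N → ℝ, (∀ᵐ x, 0 < m x) ∧ MemLp m (ENNReal.ofReal (critConj N s)) ∧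
      MemLp m (ENNReal.ofReal (critExp N s / (critExp N s - q))) ∧
      ∀ᵐ x, ∀ t : ℝ, |f x t| ≤ m x * |t| ^ (q - 1) := by
  have hp := two_lt_critExp' (N := N) (s := s)
  obtain ⟨m, δ, hδ, hm0, hm1, hm2, hb⟩ := hF
  refine ⟨m, hm0, hm1, ?_, hb⟩
  refine hm1.of_exponent_between (div_pos (by linarith) (by linarith)) ?_ (by linarith) hm2
  apply div_le_div_of_nonneg_left <;> linarith

theorem potential_linear_combination {C₁ C₂ : ℝ} (hC₁ : 0 ≤ C₁) (hC₂ : 0 ≤ C₂)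
    (hfg : CritGrowth s C₁ f) (hgg : CritGrowth s C₂ g) (hf : Caratheodory f)
    (hg : Caratheodory g) (lam mu : ℝ) {u : E N → ℝ}
    (hu : MemLp u (ENNReal.ofReal (critExp N s))) :
    potential (fun x t => lam * f x t + mu * g x t) u =
      lam * potential f u + mu * potential g u := by
  unfold potential
  rw [← integral_const_mul, ← integral_const_mul, ← integral_add
    ((hfg.integrable_primitive hC₁ hf hu).const_mul lam)
    ((hgg.integrable_primitive hC₂ hg hu).const_mul mu)]
  refine integral_congr_ae ?_
  filter_upwards [hf.2, hg.2] with x h1 h2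
  unfold primitive
  rw [← intervalIntegral.integral_const_mul, ← intervalIntegral.integral_const_mul,
    ← intervalIntegral.integral_add ((h1.intervalIntegrable _ _).const_mul lam)
    ((h2.intervalIntegrable _ _).const_mul mu)]

/-- Hölder with exponents p/(p−a) and p/a, p = 2*, followed by the Sobolev inequality. -/
theorem integrable_mul_abs_rpow_rep {a : ℝ} (ha0 : 0 < a) (ha : a < critExp N s) {φ : E N → ℝ}
    (hφ : MemLp φ (ENNReal.ofReal (critExp N s / (critExp N s - a)))) (U : Ds N s) :
    Integrable (fun x => φ x * |rep U x| ^ a) ∧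
    ∫ x, φ x * |rep U x| ^ a ≤
      (eLpNorm φ (ENNReal.ofReal (critExp N s / (critExp N s - a)))).toReal *
        (sobolevBound N s * ‖U‖) ^ a := by
  have hp := two_lt_critExp' (N := N) (s := s)
  have hU := (memDs_rep U).1
  set p := critExp N s
  have hconj : (p / (p - a)).HolderConjugate (p / a) := by
    rw [Real.holderConjugate_iff]
    constructor
    · rw [lt_div_iff₀ (by linarith)]; linarith
    · rw [inv_div, inv_div, ← add_div, div_eq_one_iff_eq (by linarith)]; ring
  have : (ENNReal.ofReal (p / (p - a))).HolderConjugate (ENNReal.ofReal (p / a)) :=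
    hconj.ennrealOfReal
  have e1 : eLpNorm (fun x => |rep U x| ^ a) (ENNReal.ofReal (p / a)) =
      eLpNorm (rep U) (ENNReal.ofReal p) ^ a := by
    have h1 := eLpNorm_norm_rpow (p := ENNReal.ofReal (p / a)) (q := a) (μ := volume) (rep U) ha0
    rwa [← ENNReal.ofReal_mul (by positivity), div_mul_cancel₀ _ ha0.ne'] at h1
  have hL : MemLp (fun x => |rep U x| ^ a) (ENNReal.ofReal (p / a)) := by
    refine ⟨(hU.1.aemeasurable.abs.pow_const a).aestronglyMeasurable, ?_⟩
    rw [e1]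
    exact ENNReal.rpow_lt_top_of_nonneg ha0.le hU.2.ne
  refine ⟨hφ.integrable_mul hL, ?_⟩
  refine (le_abs_self _).trans (abs_integral_le_integral_abs.trans
    ((integral_abs_mul_le_toReal_eLpNorm hφ hL).trans ?_))
  rw [e1, ← ENNReal.toReal_rpow]
  gcongr
  exact toReal_eLpNorm_rep_le U

/-- Used near the origin, where q > 2 lets the quadratic part of the energy win. -/
theorem exists_potential_le_rpow {q : ℝ} (hq : 2 < q) (hqp : q < critExp N s)
    (hF : GrowthF s q f) (hf : Caratheodory f) :
    ∃ K, ∀ U : Ds N s, potential f (rep U) ≤ K * ‖U‖ ^ q := by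
  obtain ⟨m, hm0, -, hm, hb⟩ := hF.exists_weight hq hqp
  have hg := critGrowth_of_subcritical (by linarith) hqp hm hb one_pos
  have hS := sobolevBound_pos (N := N) (s := s)
  refine ⟨(eLpNorm m (ENNReal.ofReal (critExp N s / (critExp N s - q)))).toReal *
    sobolevBound N s ^ q, fun U => ?_⟩
  obtain ⟨h1, h2⟩ := integrable_mul_abs_rpow_rep (by linarith) hqp hm U
  rw [mul_assoc, ← Real.mul_rpow hS.le (norm_nonneg _)]
  refine le_trans ?_ h2
  refine integral_mono_ae (hg.integrable_primitive zero_le_one hf (memDs_rep U).1) h1 ?_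
  filter_upwards [hb, hm0] with x hx hmx
  have h3 := abs_primitive_le (k := 0) hmx.le (by linarith : 0 ≤ q - 1)
    (fun t => by simpa using hx t) (rep U x)
  refine (le_abs_self _).trans (h3.trans_eq ?_)
  rw [zero_add, mul_assoc]
  congr 1
  rcases (abs_nonneg (rep U x)).eq_or_lt with h0 | h0
  · rw [← h0, mul_zero, Real.zero_rpow (by linarith)]
  · rw [Real.rpow_sub_one h0.ne', div_mul_cancel₀ _ h0.ne']

/-- Used at infinity, for coercivity. Where |u| ≤ B the growth bound m|u|^q is at most B^(q−1) m|u|,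
linear in u; where |u| > B the limsup condition with tolerance 1 gives order τ < 2. -/
theorem exists_potential_le_sublinear {q τ M : ℝ} (hq : 2 < q) (hqp : q < critExp N s)
    (hF : GrowthF s q f) (hf : Caratheodory f) (hτ1 : 1 < τ) (hτ2 : τ < 2)
    {ρ : E N → ℝ} (hρpos : ∀ᵐ x, 0 < ρ x)
    (hρ : MemLp ρ (ENNReal.ofReal (critExp N s / (critExp N s - τ))))
    (hlim : LimsupLeUniformly f ρ τ M) :
    ∃ K L, 0 ≤ K ∧ 0 ≤ L ∧ ∀ U : Ds N s, potential f (rep U) ≤ K * ‖U‖ + L * ‖U‖ ^ τ := by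
  have hp := two_lt_critExp' (N := N) (s := s)
  obtain ⟨m, hm0, hm1, hm, hb⟩ := hF.exists_weight hq hqp
  have hg := critGrowth_of_subcritical (by linarith) hqp hm hb one_pos
  have hS := sobolevBound_pos (N := N) (s := s)
  obtain ⟨A, hA'⟩ := hlim 1 one_pos
  set B := max A 0
  have hB : 0 ≤ B := le_max_right _ _
  refine ⟨B ^ (q - 1) * ((eLpNorm m (ENNReal.ofReal (critConj N s))).toReal * sobolevBound N s),
    (|M| + 1) * ((eLpNorm ρ (ENNReal.ofReal (critExp N s / (critExp N s - τ)))).toReal *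
      sobolevBound N s ^ τ), by positivity, by positivity, fun U => ?_⟩
  obtain ⟨h1, h2⟩ := integrable_mul_abs_rpow_rep (by linarith) (by linarith) hρ U
  have h3 := integral_abs_mul_rep_le hm1 U
  have h4 := (integrable_mul_rep hm1 U).abs
  have hpt : ∀ᵐ x, primitive f x (rep U x) ≤
      B ^ (q - 1) * |m x * rep U x| + (|M| + 1) * (ρ x * |rep U x| ^ τ) := by
    filter_upwards [hb, hm0, hA', hρpos] with x hx hmx hAx hρx
    have hn1 : 0 ≤ B ^ (q - 1) * |m x * rep U x| := by positivity
    have hn2 : 0 ≤ (|M| + 1) * (ρ x * |rep U x| ^ τ) := by positivity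
    rcases le_or_gt |rep U x| B with hle | hlt
    · have h5 := abs_primitive_le (k := 0) hmx.le (by linarith : 0 ≤ q - 1)
        (fun t => by simpa using hx t) (rep U x)
      have h6 : (0 + m x * |rep U x| ^ (q - 1)) * |rep U x| ≤ B ^ (q - 1) * |m x * rep U x| := by
        rw [abs_mul, abs_of_pos hmx, zero_add]
        have : |rep U x| ^ (q - 1) ≤ B ^ (q - 1) :=
          Real.rpow_le_rpow (abs_nonneg _) hle (by linarith)
        have h7 : m x * |rep U x| * |rep U x| ^ (q - 1) ≤ m x * |rep U x| * B ^ (q - 1) := by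
          gcongr
        linarith
      linarith [le_abs_self (primitive f x (rep U x))]
    · have hpos : 0 < |rep U x| := by linarith
      have h5 := hAx (rep U x) ((le_max_left _ _).trans_lt hlt)
      rw [div_le_iff₀ (by positivity)] at h5
      have h6 : (M + 1) * (ρ x * |rep U x| ^ τ) ≤ (|M| + 1) * (ρ x * |rep U x| ^ τ) := by
        gcongr
        exact le_abs_self M
      linarith
  calc potential f (rep U)
      ≤ ∫ x, (B ^ (q - 1) * |m x * rep U x| + (|M| + 1) * (ρ x * |rep U x| ^ τ)) :=
        integral_mono_ae (hg.integrable_primitive zero_le_one hf (memDs_rep U).1)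
          ((h4.const_mul _).add (h1.const_mul _)) hpt
    _ = B ^ (q - 1) * (∫ x, |m x * rep U x|) + (|M| + 1) * ∫ x, ρ x * |rep U x| ^ τ := by
        rw [integral_add (h4.const_mul _) (h1.const_mul _), integral_const_mul, integral_const_mul]
    _ ≤ _ := by
        rw [Real.mul_rpow hS.le (norm_nonneg _)] at h2
        have h7 := mul_le_mul_of_nonneg_left h3 (by positivity : 0 ≤ B ^ (q - 1))
        have h8 := mul_le_mul_of_nonneg_left h2 (by positivity : 0 ≤ |M| + 1)
        linarith

end Growth

end FracLap

/-! ### Scalar inequalities for the energy geometry. -/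

/-- A quadratic function dominates terms of lower order. -/
theorem exists_bound_of_quadratic_sub_le {τ : ℝ} (hτ2 : τ < 2) (K L c : ℝ) :
    ∃ R : ℝ, ∀ x : ℝ, 0 ≤ x → 1 / 2 * x ^ 2 - (K * x + L * x ^ τ) ≤ c → x ≤ R := by
  have h1 : Tendsto (fun x : ℝ => 1 / 2 - (K * x⁻¹ + L * x ^ (τ - 2))) atTop (𝓝 (1 / 2)) := by
    have h2 : Tendsto (fun x : ℝ => x ^ (τ - 2)) atTop (𝓝 0) := by
      have := tendsto_rpow_neg_atTop (y := 2 - τ) (by linarith)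
      simpa using this
    have h3 := ((tendsto_inv_atTop_zero (𝕜 := ℝ)).const_mul K).add (h2.const_mul L)
    have h4 := h3.const_sub (1 / 2 : ℝ)
    rwa [mul_zero, mul_zero, add_zero, sub_zero] at h4
  have h2 : Tendsto (fun x : ℝ => x ^ 2 * (1 / 2 - (K * x⁻¹ + L * x ^ (τ - 2)))) atTop atTop :=
    (tendsto_pow_atTop two_ne_zero).atTop_mul_pos (by norm_num) h1
  obtain ⟨R, hR⟩ := eventually_atTop.1 ((h2.eventually_gt_atTop c).and (eventually_gt_atTop 0))
  refine ⟨R, fun x hx hle => ?_⟩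
  by_contra! hlt
  obtain ⟨h3, h4⟩ := hR x hlt.le
  have h5 : x ^ τ = x ^ 2 * x ^ (τ - 2) := by
    rw [← Real.rpow_natCast, ← Real.rpow_add h4]
    norm_num
  have h6 : x ^ 2 * (1 / 2 - (K * x⁻¹ + L * x ^ (τ - 2))) = 1 / 2 * x ^ 2 - (K * x + L * x ^ τ) := by
    rw [h5]
    field_simp
  linarith

/-- Near the origin a quadratic function dominates terms of higher order. -/
theorem exists_quadratic_le_sub_rpow {q : ℝ} (hq : 2 < q) (K : ℝ) :
    ∃ r : ℝ, 0 < r ∧ ∀ x : ℝ, 0 < x → x ≤ r → 1 / 4 * x ^ 2 ≤ 1 / 2 * x ^ 2 - K * x ^ q := by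
  have h1 : Tendsto (fun x : ℝ => K * x ^ (q - 2)) (𝓝 0) (𝓝 0) := by
    have := (Real.continuousAt_rpow_const 0 (q - 2) (Or.inr (by linarith))).tendsto.const_mul K
    simpa [Real.zero_rpow (by linarith : q - 2 ≠ 0)] using this
  obtain ⟨r, hr, hr'⟩ := Metric.eventually_nhds_iff.1 (h1.eventually_lt_const
    (by norm_num : (0 : ℝ) < 1 / 4))
  refine ⟨r / 2, by positivity, fun x hx hxr => ?_⟩
  have h2 := hr' (y := x) (by rw [Real.dist_eq, sub_zero, abs_of_pos hx]; linarith)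
  have h3 : x ^ q = x ^ (q - 2) * x ^ 2 := by
    rw [← Real.rpow_natCast, ← Real.rpow_add hx]
    norm_num
  rw [h3]
  nlinarith [sq_nonneg x]

/-- The shape in which ε and δ are chosen below; the added ones avoid division by zero. -/
theorem one_div_mul_mul_le_quarter {x y : ℝ} (hx : 0 ≤ x) (hy : 0 ≤ y) :
    1 / (4 * (x + 1) * (y + 1)) * x * y ≤ 1 / 4 := by
  rw [mul_assoc, one_div_mul_eq_div, div_le_div_iff₀ (by positivity) (by norm_num)]
  nlinarith [mul_nonneg hx hy]

/-! ### From critical points to weak solutions. -/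

namespace FracLap

section Solutions

variable {N : ℕ} {s : ℝ} [hA : Admissible N s] {f g : E N → ℝ → ℝ}

theorem rep_injective {U V : Ds N s} (h : rep U =ᵐ[volume] rep V) : U = V :=
  Subtype.ext (Lp.ext ((coe_ae_eq_diffQuot_rep U).trans ((diffQuot_congr_ae h).trans
    (coe_ae_eq_diffQuot_rep V).symm)))

theorem rep_zero : rep (0 : Ds N s) =ᵐ[volume] 0 :=
  rep_ae_eq_of MemDs.zero (by rw [diffQuot_zero]; exact Lp.coeFn_zero _ _ _)

theorem energy_zero : energy f (0 : Ds N s) = 0 := by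
  rw [energy, potential_congr_ae rep_zero]
  simp [potential, primitive]

theorem isWeakSolution_rep {C lam mu : ℝ}
    (hk : CritGrowth s C fun x t => lam * f x t + mu * g x t)
    (hc : Caratheodory fun x t => lam * f x t + mu * g x t) {U : Ds N s}
    (hU : energyGrad hk hc U = 0) : IsWeakSolution s f g lam mu (rep U) := by
  refine ⟨memDs_rep U, fun φ hφ => ?_⟩
  have h1 := hk.memLp_comp hc (memDs_rep U).1
  refine ⟨h1.integrable_mul hφ.1, ?_⟩
  have h2 := inner_energyGrad hk hc U (toDs hφ)
  rw [hU, inner_zero_left] at h2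
  rw [← inner_eq_gagliardoForm (EventuallyEq.refl _ (rep U)) (rep_toDs hφ)]
  have h3 : ∫ x, (lam * f x (rep U x) + mu * g x (rep U x)) * rep (toDs hφ) x =
      ∫ x, (lam * f x (rep U x) + mu * g x (rep U x)) * φ x := by
    refine integral_congr_ae ?_
    filter_upwards [rep_toDs hφ] with x hx
    rw [hx]
  linarith

/-- This is what makes every admissible λ nonnegative. -/
theorem theta_nonneg (s : ℝ) (f : E N → ℝ → ℝ) : 0 ≤ theta s f := by
  unfold theta
  refine mul_nonneg (by norm_num) (Real.sInf_nonneg ?_)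
  rintro c ⟨u, -, hu, rfl⟩
  positivity

/-- Above `θ` the energy takes negative values. -/
theorem exists_norm_sq_lt_mul_potential {a : ℝ} (ha : theta s f < a)
    (hsup : (0 : EReal) <
      ⨆ u : {u : E N → ℝ // MemDs s u}, ((potential f u.1 : ℝ) : EReal)) :
    ∃ e : Ds N s, 0 < potential f (rep e) ∧ 1 / 2 * ‖e‖ ^ 2 < a * potential f (rep e) := by
  obtain ⟨⟨w, hw⟩, hw0⟩ := lt_iSup_iff.1 hsup
  have hw0' : 0 < potential f w := by exact_mod_cast hw0
  unfold theta at ha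
  set S : Set ℝ := {c : ℝ | ∃ u : E N → ℝ, MemDs s u ∧ 0 < potential f u ∧
    c = (gagliardoSq s u).toReal / potential f u}
  have hS : S.Nonempty := ⟨_, w, hw, hw0', rfl⟩
  obtain ⟨c, ⟨u, hu, hu0, rfl⟩, hlt⟩ :=
    exists_lt_of_csInf_lt hS (by linarith : sInf S < 2 * a)
  refine ⟨toDs hu, ?_, ?_⟩
  · rwa [potential_congr_ae (rep_toDs hu)]
  · rw [potential_congr_ae (rep_toDs hu), norm_toDs_sq]
    rw [div_lt_iff₀ hu0] at hlt
    linarith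

/-- Two critical points of a perturbed energy on a ball. -/
theorem exists_two_solutions {C lam mu : ℝ} (hC : 0 ≤ C)
    (hk : CritGrowth s C fun x t => lam * f x t + mu * g x t)
    (hc : Caratheodory fun x t => lam * f x t + mu * g x t)
    {R c B α ρ : ℝ} (hsmall : C * 2 ^ (critExp N s - 1) *
      (sobolevBound N s ^ critExp N s * (2 * R) ^ (critExp N s - 2)) ≤ 1 / 2)
    (hlev : ∀ U : Ds N s, ‖U‖ ≤ R + 1 → energy (fun x t => lam * f x t + mu * g x t) U ≤ c → ‖U‖ ≤ R)
    (hB : ∀ U : Ds N s, ‖U‖ ≤ R + 1 → B ≤ energy (fun x t => lam * f x t + mu * g x t) U)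
    (e : Ds N s) (he : ‖e‖ ≤ R + 1) (hα : 0 < α) (hρ : 0 ≤ ρ) (hρe : ρ ≤ ‖e‖)
    (hsphere : ∀ U : Ds N s, ‖U‖ = ρ → α ≤ energy (fun x t => lam * f x t + mu * g x t) U)
    (hneg : energy (fun x t => lam * f x t + mu * g x t) e < 0)
    (hseg : ∀ t ∈ Set.Icc (0 : ℝ) 1, energy (fun x t => lam * f x t + mu * g x t) (t • e) ≤ c) :
    ∃ u v : E N → ℝ, IsWeakSolution s f g lam mu u ∧ IsWeakSolution s f g lam mu v ∧
      ¬ u =ᵐ[volume] 0 ∧ ¬ v =ᵐ[volume] 0 ∧ ¬ u =ᵐ[volume] v ∧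
      gagliardoNorm s u ≤ R ∧ gagliardoNorm s v ≤ R := by
  have hgrad := hasLineGradient_energy hk hC hc
  have hcont := continuous_energyGrad hk hC hc
  have hPS := palaisSmale_energyGrad hk hC hc hsmall
  -- The first critical point has energy at most that of `e`, hence negative; the second has energy
  -- at least `α` > 0. They are thus distinct from each other and from 0, whose energy is 0.
  obtain ⟨U, hUR, hU1, hU0⟩ := exists_critical_le_of_ball hgrad hcont (by linarith) hlev hB hPS e he
    (by simpa using hseg 1 ⟨zero_le_one, le_rfl⟩)
  obtain ⟨V, hVR, hV1, hV0⟩ := exists_critical_mountain_pass hgrad hcont (by linarith) hlev hPS e he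
    hα hρ hρe hsphere energy_zero.le hneg.le hseg
  have hne : ∀ W : Ds N s, energy (fun x t => lam * f x t + mu * g x t) W ≠ 0 →
      ¬ rep W =ᵐ[volume] 0 := by
    intro W hW h
    apply hW
    rw [rep_injective (h.trans rep_zero.symm), energy_zero]
  refine ⟨rep U, rep V, isWeakSolution_rep hk hc hU0, isWeakSolution_rep hk hc hV0,
    hne U (by linarith), hne V (by linarith), fun h => ?_, ?_, ?_⟩
  · rw [rep_injective h] at hU1
    linarith
  · rwa [gagliardoNorm_rep]
  · rwa [gagliardoNorm_rep]

end Solutions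

/-! ### Choice of the constants and the main theorem. -/

section Main

variable {N : ℕ} {s : ℝ} [hA : Admissible N s] {f g : E N → ℝ → ℝ}

theorem CritGrowth.exists_abs_potential_le {C : ℝ} (hg : CritGrowth s C f) (hC : 0 ≤ C) (R : ℝ) :
    ∃ K, 0 < K ∧ ∀ U : Ds N s, ‖U‖ ≤ R → |potential f (rep U)| ≤ K := by
  have hp := two_lt_critExp' (N := N) (s := s)
  have hS := sobolevBound_pos (N := N) (s := s)
  obtain ⟨K, hK, hb⟩ := hg.abs_potential_le hC
  refine ⟨K * (sobolevBound N s * |R|) + C * (sobolevBound N s * |R|) ^ critExp N s + 1,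
    by positivity, fun U hU => (hb U).trans ?_⟩
  have h1 : sobolevBound N s * ‖U‖ ≤ sobolevBound N s * |R| :=
    mul_le_mul_of_nonneg_left (hU.trans (le_abs_self R)) hS.le
  have h2 := mul_le_mul_of_nonneg_left h1 hK
  have h3 := mul_le_mul_of_nonneg_left
    (Real.rpow_le_rpow (by positivity) h1 (by linarith : 0 ≤ critExp N s)) hC
  linarith

theorem energy_linear_combination {C₁ C₂ : ℝ} (hC₁ : 0 ≤ C₁) (hC₂ : 0 ≤ C₂)
    (hfg : CritGrowth s C₁ f) (hgg : CritGrowth s C₂ g) (hf : Caratheodory f)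
    (hg : Caratheodory g) (lam mu : ℝ) (U : Ds N s) :
    energy (fun x t => lam * f x t + mu * g x t) U =
      1 / 2 * ‖U‖ ^ 2 - lam * potential f (rep U) - mu * potential g (rep U) := by
  rw [energy, potential_linear_combination hC₁ hC₂ hfg hgg hf hg lam mu (memDs_rep U).1]
  ring

set_option maxHeartbeats 800000 in
/-- The multiplicity result for the space `Ds N s`, with the analytic input on the nonlinearities
reduced to growth and potential estimates. -/
theorem exists_two_solutions_of_estimates {C q τ K L κ a b : ℝ}
    (hf : Caratheodory f) (hg : Caratheodory g)
    (hfg : ∀ ε, 0 < ε → CritGrowth s ε f) (hC : 0 ≤ C) (hgg : CritGrowth s C g)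
    (hq : 2 < q) (hτ2 : τ < 2) (hK : 0 ≤ K) (hL : 0 ≤ L)
    (hsub : ∀ U : Ds N s, potential f (rep U) ≤ K * ‖U‖ + L * ‖U‖ ^ τ)
    (hsuper : ∀ U : Ds N s, potential f (rep U) ≤ κ * ‖U‖ ^ q)
    (ha : 0 ≤ a) (e : Ds N s) (he0 : 0 < potential f (rep e))
    (he : 1 / 2 * ‖e‖ ^ 2 < a * potential f (rep e)) :
    ∃ r₁ : ℝ, 0 < r₁ ∧ ∀ lam ∈ Set.Icc a b, ∃ δ : ℝ, 0 < δ ∧ ∀ mu ∈ Set.Icc (0 : ℝ) δ,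
      ∃ u v : E N → ℝ, IsWeakSolution s f g lam mu u ∧ IsWeakSolution s f g lam mu v ∧
        ¬ u =ᵐ[volume] 0 ∧ ¬ v =ᵐ[volume] 0 ∧ ¬ u =ᵐ[volume] v ∧
        gagliardoNorm s u < r₁ ∧ gagliardoNorm s v < r₁ := by
  have hS := sobolevBound_pos (N := N) (s := s)
  have hp := two_lt_critExp' (N := N) (s := s)
  have hen : e ≠ 0 := by
    rintro rfl
    rw [potential_congr_ae rep_zero] at he0
    simp [potential, primitive] at he0
  have hen' : 0 < ‖e‖ := norm_pos_iff.2 hen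
  obtain ⟨Kf, hKf, hKf'⟩ := (hfg 1 one_pos).exists_abs_potential_le zero_le_one ‖e‖
  -- This bounds the unperturbed energy along the segment from 0 to `e` for all λ in [a,b].
  set c := 1 / 2 * ‖e‖ ^ 2 + |b| * Kf with hc
  have hc0 : 0 ≤ c := by positivity
  -- The perturbation costs at most 1 on the segment and 1 again in comparing sublevel sets, whence
  -- c + 2. Only |b| enters, so the radius is uniform in λ.
  obtain ⟨R₀, hR₀⟩ := exists_bound_of_quadratic_sub_le hτ2 (|b| * K) (|b| * L) (c + 2)
  set R := max R₀ 0 with hR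
  have hR0 : 0 ≤ R := le_max_right _ _
  refine ⟨R + 1, by positivity, fun lam hlam => ?_⟩
  have hlam0 : 0 ≤ lam := ha.trans hlam.1
  have hlamb : lam ≤ |b| := hlam.2.trans (le_abs_self b)
  have hcoer : ∀ U : Ds N s, 1 / 2 * ‖U‖ ^ 2 - lam * potential f (rep U) ≤ c + 2 → ‖U‖ ≤ R := by
    intro U hU
    refine (hR₀ ‖U‖ (norm_nonneg _) ?_).trans (le_max_left _ _)
    have h1 : lam * potential f (rep U) ≤ lam * (K * ‖U‖ + L * ‖U‖ ^ τ) :=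
      mul_le_mul_of_nonneg_left (hsub U) hlam0
    have h2 : lam * (K * ‖U‖ + L * ‖U‖ ^ τ) ≤ |b| * (K * ‖U‖ + L * ‖U‖ ^ τ) :=
      mul_le_mul_of_nonneg_right hlamb (by positivity)
    linarith
  have hneg : 1 / 2 * ‖e‖ ^ 2 - lam * potential f (rep e) < 0 := by
    have := mul_le_mul_of_nonneg_right hlam.1 he0.le
    linarith
  have heR : ‖e‖ ≤ R := hcoer e (by linarith)
  obtain ⟨ρ₀, hρ₀, hρ₀'⟩ := exists_quadratic_le_sub_rpow hq (lam * κ)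
  set ρ := min ρ₀ ‖e‖ with hρ
  have hρ0 : 0 < ρ := lt_min hρ₀ hen'
  set η := -(1 / 2 * ‖e‖ ^ 2 - lam * potential f (rep e)) with hη
  have hη0 : 0 < η := by linarith
  obtain ⟨Kg, hKg, hKg'⟩ := hgg.exists_abs_potential_le hC (R + 1)
  obtain ⟨Kf₂, hKf₂, hKf₂'⟩ := (hfg 1 one_pos).exists_abs_potential_le zero_le_one (R + 1)
  set T := 2 ^ (critExp N s - 1) *
    (sobolevBound N s ^ critExp N s * (2 * R) ^ (critExp N s - 2)) with hT
  have hT0 : 0 ≤ T := by positivity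
  -- The tolerated size of μΨ on the ball of radius R + 1. The bound 1 preserves the sublevel
  -- inclusion, ρ²/8 leaves half of the barrier ρ²/4 on the sphere, and η/2 keeps the energy of `e`
  -- negative.
  set β := min 1 (min (1 / 8 * ρ ^ 2) (η / 2)) with hβ
  have hβ0 : 0 < β := by positivity
  -- The compactness threshold 1/2 is shared equally: λεT ≤ 1/4 for f, and the second constraint in
  -- `δ` gives μCT ≤ 1/4 for g.
  set ε := 1 / (4 * (lam + 1) * (T + 1)) with hε
  have hε0 : 0 < ε := by positivity
  set δ := min (β / Kg) (1 / (4 * (C + 1) * (T + 1))) with hδ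
  refine ⟨δ, by positivity, fun mu hmu => ?_⟩
  have hmuC : mu ≤ 1 / (4 * (C + 1) * (T + 1)) := hmu.2.trans (min_le_right _ _)
  have hmuK : mu * Kg ≤ β := by
    have := hmu.2.trans (min_le_left _ _)
    rwa [le_div_iff₀ hKg] at this
  have hpert : ∀ U : Ds N s, ‖U‖ ≤ R + 1 → |mu * potential g (rep U)| ≤ β := by
    intro U hU
    rw [abs_mul, abs_of_nonneg hmu.1]
    exact (mul_le_mul_of_nonneg_left (hKg' U hU) hmu.1).trans hmuK
  have hβ1 : β ≤ 1 := min_le_left _ _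
  have hβ2 : β ≤ 1 / 8 * ρ ^ 2 := (min_le_right _ _).trans (min_le_left _ _)
  have hβ3 : β ≤ η / 2 := (min_le_right _ _).trans (min_le_right _ _)
  have hen2 := energy_linear_combination hε0.le hC (hfg ε hε0) hgg hf hg lam mu
  have hk := (hfg ε hε0).linear_combination hlam0 hmu.1 hgg
  have hsmall : (lam * ε + mu * C) * 2 ^ (critExp N s - 1) *
      (sobolevBound N s ^ critExp N s * (2 * R) ^ (critExp N s - 2)) ≤ 1 / 2 := by
    rw [mul_assoc, ← hT]
    have h1 : lam * ε * T ≤ 1 / 4 := by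
      rw [mul_comm lam]
      exact one_div_mul_mul_le_quarter hlam0 hT0
    have h2 : mu * C * T ≤ 1 / 4 := by
      refine le_trans ?_ (one_div_mul_mul_le_quarter hC hT0)
      gcongr
    linarith
  obtain ⟨u, v, h1, h2, h3, h4, h5, h6, h7⟩ := exists_two_solutions (f := f) (g := g) (c := c + 1)
    (B := -(lam * Kf₂) - 1) (α := 1 / 8 * ρ ^ 2) (ρ := ρ)
    (add_nonneg (mul_nonneg hlam0 hε0.le) (mul_nonneg hmu.1 hC)) hk
    (hf.linear_combination hg lam mu) hsmall
    (fun U hU hle => by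
      rw [hen2] at hle
      have := abs_le.1 (hpert U hU)
      exact hcoer U (by linarith))
    (fun U hU => by
      rw [hen2]
      have h1 := abs_le.1 (hpert U hU)
      have h2 := mul_le_mul_of_nonneg_left ((le_abs_self _).trans (hKf₂' U hU)) hlam0
      have h3 := sq_nonneg ‖U‖
      linarith)
    e (by linarith) (by positivity) hρ0.le (min_le_right _ _)
    (fun U hU => by
      rw [hen2]
      have h1 := abs_le.1 (hpert U (by rw [hU]; linarith [min_le_right ρ₀ ‖e‖]))
      have h2 := hρ₀' ρ hρ0 (min_le_left _ _)
      have h3 := mul_le_mul_of_nonneg_left (hsuper U) hlam0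
      rw [hU] at h3 ⊢
      linarith)
    (by
      rw [hen2]
      have h1 := abs_le.1 (hpert e (by linarith))
      linarith)
    (fun t ht => by
      rw [hen2]
      have hn : ‖t • e‖ ≤ ‖e‖ := by
        rw [norm_smul, Real.norm_of_nonneg ht.1]
        exact mul_le_of_le_one_left (norm_nonneg _) ht.2
      have h1 := abs_le.1 (hpert (t • e) (by linarith))
      have h2 := abs_le.1 (hKf' (t • e) hn)
      have h3 : -(lam * potential f (rep (t • e))) ≤ |b| * Kf := by
        have h4 : lam * -potential f (rep (t • e)) ≤ lam * Kf :=
          mul_le_mul_of_nonneg_left (by linarith) hlam0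
        have h5 : lam * Kf ≤ |b| * Kf := mul_le_mul_of_nonneg_right hlamb hKf.le
        linarith
      have h4 : ‖t • e‖ ^ 2 ≤ ‖e‖ ^ 2 := pow_le_pow_left₀ (norm_nonneg _) hn 2
      linarith)
  exact ⟨u, v, h1, h2, h3, h4, h5, by linarith, by linarith⟩

end Main

end FracLap

theorem theorem4p1 (N : ℕ) (s : ℝ) (hs0 : 0 < s) (hs1 : s < 1) (hsN : 2 * s < (N : ℝ))
    (q r : ℝ) (hq : 2 < q) (hqr : q < min r (FracLap.critExp N s))
    (f g : FracLap.E N → ℝ → ℝ)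
    (hf : FracLap.Caratheodory f) (hg : FracLap.Caratheodory g)
    (hF : FracLap.GrowthF s q f) (hG : FracLap.GrowthG s r g)
    (τ : ℝ) (hτ1 : 1 < τ) (hτ2 : τ < 2)
    (ρ : FracLap.E N → ℝ) (hρpos : ∀ᵐ x ∂(volume : Measure (FracLap.E N)), 0 < ρ x)
    (hρ : MemLp ρ (ENNReal.ofReal (FracLap.critExp N s / (FracLap.critExp N s - τ))) volume)
    (M : ℝ) (hlimsup : FracLap.LimsupLeUniformly f ρ τ M)
    (hsup : (0 : EReal) <
      ⨆ u : {u : FracLap.E N → ℝ // FracLap.MemDs s u}, ((FracLap.potential f u.1 : ℝ) : EReal)) :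
    ∀ a b : ℝ, a ≤ b → Set.Icc a b ⊆ Set.Ioi (FracLap.theta s f) →
      ∃ r₁ : ℝ, 0 < r₁ ∧ ∀ lam ∈ Set.Icc a b, ∃ δ : ℝ, 0 < δ ∧ ∀ mu ∈ Set.Icc (0 : ℝ) δ,
        ∃ u v : FracLap.E N → ℝ,
          FracLap.IsWeakSolution s f g lam mu u ∧ FracLap.IsWeakSolution s f g lam mu v ∧
          ¬ u =ᵐ[volume] 0 ∧ ¬ v =ᵐ[volume] 0 ∧ ¬ u =ᵐ[volume] v ∧
          FracLap.gagliardoNorm s u < r₁ ∧ FracLap.gagliardoNorm s v < r₁ := by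
  intro a b hab hI
  have hA : FracLap.Admissible N s := ⟨hs0, hs1, hsN⟩
  have hqp : q < FracLap.critExp N s := hqr.trans_le (min_le_right _ _)
  have ha : FracLap.theta s f < a := hI ⟨le_rfl, hab⟩
  obtain ⟨m, -, -, hm, hb⟩ := hF.exists_weight hq hqp
  obtain ⟨C, hC, hgg⟩ := hG.exists_critGrowth
  obtain ⟨κ, hsuper⟩ := FracLap.exists_potential_le_rpow hq hqp hF hf
  obtain ⟨K, L, hK, hL, hsub⟩ := FracLap.exists_potential_le_sublinear hq hqp hF hf hτ1 hτ2 hρpos hρ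
    hlimsup
  -- Choosing `e` at the left endpoint serves the whole interval: its potential is positive, so
  -- increasing λ only lowers its energy.
  obtain ⟨e, he0, he⟩ := FracLap.exists_norm_sq_lt_mul_potential ha hsup
  exact FracLap.exists_two_solutions_of_estimates hf hg
    (fun ε hε => FracLap.critGrowth_of_subcritical (by linarith) hqp hm hb hε) hC hgg hq hτ2
    hK hL hsub hsuper ((FracLap.theta_nonneg s f).trans ha.le) e he0 he
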